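/- Let $A$ be a finite dimensional algebra over a field $K$. Modules are finitely generated right $A$-modules unless stated otherwise, $D=\mathrm{Hom}_K(-,K)$, and a class of modules is called representation-finite if it contains only finitely many indecomposable modules up to isomorphism; $A$ is representation-finite if the class of all its modules is. Put $${}^{\perp}A=\{M : \mathrm{Ext}^i_A(M,A)=0 \text{ for all } i\ge 1\},\qquad D(A)^{\perp}=\{M : \mathrm{Ext}^i_A(D(A),M)=0 \text{ for all } i\ge 1\}.$$ A module $M$ is Gorenstein projective if $\mathrm{Ext}^i(M,A)=0=\mathrm{Ext}^i(\mathrm{Tr}\,M,A)$ for all $i\ge 1$, where $\mathrm{Tr}$ is the transpose (a left module), and Gorenstein injective if the left module $D(M)$ is Gorenstein projective. The algebra $A$ is nearly Gorenstein if ${}^{\perp}A$ is the class of Gorenstein projective modules and $D(A)^{\perp}$ is the class of Gorenstein injective modules; it is CM-finite if the class of Gorenstein projective modules is representation-finite; it is torsionless-finite if the class $\Omega^1(\text{mod-}A)$ of first syzygy modules (including all projective modules) is representation-finite; it is Gorenstein if the left and right injective dimensions of $A$ are finite and equal. The dominant dimension of $A$ is the supremum of all $n$ such that the first $n$ terms $I_0,\dots,I_{n-1}$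 of a minimal injective resolution of $A_A$ are projective. Then: 1. If ${}^{\perp}A$ and $D(A)^{\perp}$ are representation-finite, then $A$ is nearly Gorenstein. In particular, if $A$ is representation-finite, then $A$ is nearly Gorenstein. 2. Let $A$ have dominant dimension at least $2$, let $e\in A$ be an idempotent such that $eA$ is a minimal faithful projective-injective right $A$-module (that is, $eA$ is projective, injective and faithful, and a direct summand of every faithful module), and put $P=\mathrm{Hom}_A(D(eA),A)$ and $B_2=\mathrm{End}_A(P)$. If the algebra $B_2$ is representation-finite, then $A$ is CM-finite and nearly Gorenstein. 3. If $A$ is torsionless-finite, then $A$ is nearly Gorenstein. 4. If $\mathrm{rad}^2(A)=0$, then $A$ is nearly Gorenstein. If in addition $A$ is connected (that is, $A\ne 0$ and the only central idempotents of $A$ are $0$ and $1$) and not selfinjective, then ${}^{\perp}A$ is the class of finitely generated projective modules, and hence $A$ is not Gorenstein or has finite global dimension. -/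

import Mathlib

open CategoryTheory
open scoped ModuleCat

universe u

noncomputable section

namespace NearlyGor

/-! Right `A`-modules are modules over `Aᵐᵒᵖ`, as everywhere in Mathlib.
The notions that make sense over any ring are stated for left modules over a ring `R`. -/

section GeneralRing

variable {R : Type u} [Ring R]

/-- `Ext^i_R(M, N) = 0` for all `i ≥ 1`. -/
def ExtVanishes (M N : ModuleCat.{u} R) : Prop :=
  ∀ i : ℕ, 1 ≤ i → Subsingleton (Abelian.Ext M N i)

/-- A class of modules is representation-finite if it contains, up to isomorphism, only finitely
many indecomposable modules. -/
def IsRepFiniteClass (C : ModuleCat.{u} R → Prop) : Prop :=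
  ∃ (n : ℕ) (X : Fin n → ModuleCat.{u} R),
    ∀ M : ModuleCat.{u} R, C M → Indecomposable M → ∃ i, Nonempty (M ≅ X i)

/-- The first syzygies of finitely generated modules (with respect to arbitrary, not only
minimal, finitely generated projective presentations `0 → M → P → N → 0`;
this includes all finitely generated projective modules). -/
def IsFirstSyzygy (M : ModuleCat.{u} R) : Prop :=
  ∃ (P N : ModuleCat.{u} R) (f : M →ₗ[R] P) (g : P →ₗ[R] N),
    Module.Finite R M ∧ Module.Finite R P ∧ Module.Projective R P ∧
      Function.Injective f ∧ Function.Exact f g ∧ Function.Surjective g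

/-- `j : M → I` is an injective hull: an essential embedding into an injective module. -/
structure IsInjectiveHull {M I : ModuleCat.{u} R} (j : M →ₗ[R] I) : Prop where
  injective_module : Module.Injective R I
  injective_map : Function.Injective j
  essential : ∀ N : Submodule R I, N ⊓ LinearMap.range j = ⊥ → N = ⊥

/-- In a minimal injective resolution `0 → M → I₀ → I₁ → ⋯`, the first `n` terms
`I₀, …, I_{n-1}` are projective. -/
def FirstTermsProjective : ℕ → ModuleCat.{u} R → Prop
  | 0, _ => True
  | n + 1, M => ∃ (I : ModuleCat.{u} R) (j : M →ₗ[R] I),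
      IsInjectiveHull j ∧ Module.Projective R I ∧
        FirstTermsProjective n (ModuleCat.of R (I ⧸ LinearMap.range j))

/-- The dominant dimension of a module. -/
def domdim (M : ModuleCat.{u} R) : ℕ∞ :=
  ⨆ (n : ℕ) (_ : FirstTermsProjective n M), (n : ℕ∞)

/-- `M` is a minimal faithful module: it is faithful, and it is a direct summand of every
finitely generated faithful module. -/
def IsMinimalFaithful (M : ModuleCat.{u} R) : Prop :=
  FaithfulSMul R M ∧
    ∀ N : ModuleCat.{u} R, Module.Finite R N → FaithfulSMul R N →
      ∃ (i : M →ₗ[R] N) (p : N →ₗ[R] M), p ∘ₗ i = LinearMap.id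

end GeneralRing

section Transpose

variable (R S U : Type u) [Ring R] [Ring S] [AddCommGroup U] [Module R U] [Module S U]
  [SMulCommClass R S U] [SMulCommClass S R U]

/-- `N` is a transpose of the `R`-module `M`: there is a presentation `P₁ → P₀ → M → 0` by
finitely generated projective modules such that `N` is isomorphic to the cokernel of
`Hom_R(P₀, U) → Hom_R(P₁, U)`. This is used only for `U = A` and `(R, S) = (A, Aᵐᵒᵖ)` or
`(R, S) = (Aᵐᵒᵖ, A)`; then `N` is unique up to finitely generated projective direct summands. -/
def IsTranspose (M : ModuleCat.{u} R) (N : ModuleCat.{u} S) : Prop :=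
  ∃ (P₁ P₀ : ModuleCat.{u} R) (f : P₁ →ₗ[R] P₀) (g : P₀ →ₗ[R] M),
    Module.Finite R P₁ ∧ Module.Projective R P₁ ∧ Module.Finite R P₀ ∧ Module.Projective R P₀ ∧
      Function.Exact f g ∧ Function.Surjective g ∧
      Nonempty (N ≃ₗ[S] ((P₁ →ₗ[R] U) ⧸ LinearMap.range (LinearMap.lcomp S U f)))

/-- `M` is finitely generated with `Ext^i(M, U) = 0 = Ext^i(Tr M, U)` for all `i ≥ 1`. -/
def IsGPAux (M : ModuleCat.{u} R) : Prop :=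
  Module.Finite R M ∧ ExtVanishes M (ModuleCat.of R U) ∧
    ∃ N : ModuleCat.{u} S, IsTranspose R S U M N ∧ ExtVanishes N (ModuleCat.of S U)

end Transpose

section Algebras

variable (K A : Type u) [Field K] [Ring A] [Algebra K A]

/-- The regular right module `A_A`. -/
abbrev rightReg : ModuleCat.{u} Aᵐᵒᵖ := ModuleCat.of Aᵐᵒᵖ A

/-- The regular left module `_A A`. -/
abbrev leftReg : ModuleCat.{u} A := ModuleCat.of A A

/-- The left module structure on `Hom_K(M, K)`, for `M` a right module: `(a f)(x) = f(x a)`. -/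
abbrev dualOfRightModule (M : ModuleCat.{u} Aᵐᵒᵖ) : Module A (M →ₗ[K] K) where
  smul a f := f ∘ₗ Algebra.lsmul K K M (MulOpposite.op a)
  one_smul f := by ext x; change f ((1 : Aᵐᵒᵖ) • x) = f x; rw [one_smul]
  mul_smul a b f := by
    ext x
    change f ((MulOpposite.op b * MulOpposite.op a) • x) =
      f (MulOpposite.op b • (MulOpposite.op a • x))
    rw [mul_smul]
  smul_zero _ := rfl
  smul_add _ _ _ := rfl
  add_smul a b f := by
    ext x
    change f ((MulOpposite.op a + MulOpposite.op b) • x) =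
      f (MulOpposite.op a • x) + f (MulOpposite.op b • x)
    rw [add_smul, map_add]
  zero_smul f := by ext x; change f ((0 : Aᵐᵒᵖ) • x) = 0; rw [zero_smul, map_zero]

/-- The right module structure on `Hom_K(M, K)`, for `M` a left module: `(f a)(x) = f(a x)`. -/
abbrev dualOfLeftModule (M : ModuleCat.{u} A) : Module Aᵐᵒᵖ (M →ₗ[K] K) where
  smul a f := f ∘ₗ Algebra.lsmul K K M (MulOpposite.unop a)
  one_smul f := by ext x; change f ((1 : A) • x) = f x; rw [one_smul]
  mul_smul a b f := by
    ext x
    change f ((MulOpposite.unop b * MulOpposite.unop a) • x) =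
      f (MulOpposite.unop b • (MulOpposite.unop a • x))
    rw [mul_smul]
  smul_zero _ := rfl
  smul_add _ _ _ := rfl
  add_smul a b f := by
    ext x
    change f ((MulOpposite.unop a + MulOpposite.unop b) • x) =
      f (MulOpposite.unop a • x) + f (MulOpposite.unop b • x)
    rw [add_smul, map_add]
  zero_smul f := by ext x; change f ((0 : A) • x) = 0; rw [zero_smul, map_zero]

variable {A}

/-- `D(M) = Hom_K(M, K)`, a left module, for a right module `M`. -/
def dualRL (M : ModuleCat.{u} Aᵐᵒᵖ) : ModuleCat.{u} A :=
  letI := dualOfRightModule K A M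
  ModuleCat.of A (M →ₗ[K] K)

/-- `D(M) = Hom_K(M, K)`, a right module, for a left module `M`. -/
def dualLR (M : ModuleCat.{u} A) : ModuleCat.{u} Aᵐᵒᵖ :=
  letI := dualOfLeftModule K A M
  ModuleCat.of Aᵐᵒᵖ (M →ₗ[K] K)

/-- Gorenstein projective right modules; here `Tr M` is a left module. -/
def IsGorensteinProjective (M : ModuleCat.{u} Aᵐᵒᵖ) : Prop := IsGPAux Aᵐᵒᵖ A A M

/-- Gorenstein projective left modules; here `Tr M` is a right module. -/
def IsGorensteinProjectiveLeft (M : ModuleCat.{u} A) : Prop := IsGPAux A Aᵐᵒᵖ A M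

/-- Gorenstein injective right modules: `D(M)` is a Gorenstein projective left module. -/
def IsGorensteinInjective (M : ModuleCat.{u} Aᵐᵒᵖ) : Prop :=
  Module.Finite Aᵐᵒᵖ M ∧ IsGorensteinProjectiveLeft (dualRL K M)

/-- `⊥A`: the finitely generated right modules `M` with `Ext^i(M, A) = 0` for all `i ≥ 1`. -/
def InPerpA (M : ModuleCat.{u} Aᵐᵒᵖ) : Prop :=
  Module.Finite Aᵐᵒᵖ M ∧ ExtVanishes M (rightReg A)

/-- `D(A)^⊥`: the finitely generated right modules `M` with `Ext^i(D(A), M) = 0` for all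
`i ≥ 1`. -/
def InDAPerp (M : ModuleCat.{u} Aᵐᵒᵖ) : Prop :=
  Module.Finite Aᵐᵒᵖ M ∧ ExtVanishes (dualLR K (leftReg A)) M

variable (A)

def IsLeftNearlyGorenstein : Prop :=
  ∀ M : ModuleCat.{u} Aᵐᵒᵖ, IsGorensteinProjective M ↔ InPerpA M

def IsRightNearlyGorenstein : Prop :=
  ∀ M : ModuleCat.{u} Aᵐᵒᵖ, IsGorensteinInjective K M ↔ InDAPerp K M

def IsNearlyGorenstein : Prop := IsLeftNearlyGorenstein A ∧ IsRightNearlyGorenstein K A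

/-- The category of finitely generated right modules is representation-finite. -/
def IsRepFinite : Prop :=
  IsRepFiniteClass (fun M : ModuleCat.{u} Aᵐᵒᵖ => Module.Finite Aᵐᵒᵖ M)

def IsCMFinite : Prop :=
  IsRepFiniteClass (fun M : ModuleCat.{u} Aᵐᵒᵖ => IsGorensteinProjective M)

def IsTorsionlessFinite : Prop :=
  IsRepFiniteClass (fun M : ModuleCat.{u} Aᵐᵒᵖ => IsFirstSyzygy M)

/-- `A` is nonzero and has no central idempotents except `0` and `1`. -/
def IsConnectedAlgebra : Prop :=
  Nontrivial A ∧ ∀ e ∈ Subring.center A, IsIdempotentElem e → e = 0 ∨ e = 1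

def IsSelfinjective : Prop := Module.Injective Aᵐᵒᵖ A

/-- The right and left injective dimensions of `A` are equal and finite. -/
def IsGorenstein : Prop :=
  ∃ g : ℕ, injectiveDimension (rightReg A) = g ∧ injectiveDimension (leftReg A) = g

/-- The projective dimensions of the finitely generated right modules are bounded. -/
def HasFiniteGlobalDimension : Prop :=
  ∃ n : ℕ, ∀ M : ModuleCat.{u} Aᵐᵒᵖ, Module.Finite Aᵐᵒᵖ M → HasProjectiveDimensionLE M n

variable {A}

/-- The right ideal `eA`. -/
def rightIdeal (e : A) : ModuleCat.{u} Aᵐᵒᵖ :=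
  ModuleCat.of Aᵐᵒᵖ (Submodule.span Aᵐᵒᵖ ({e} : Set A))

/-- `e` is an idempotent such that `eA` is a minimal faithful projective-injective right
module. -/
def IsMinimalFaithfulIdempotent (e : A) : Prop :=
  IsIdempotentElem e ∧ Module.Projective Aᵐᵒᵖ (rightIdeal e) ∧
    Module.Injective Aᵐᵒᵖ (rightIdeal e) ∧ IsMinimalFaithful (rightIdeal e)

/-- The right module `P = Hom_A(D(eA), A)` of left module homomorphisms, with
`(φ a)(x) = φ(x) a`. -/
def moduleP (e : A) : ModuleCat.{u} Aᵐᵒᵖ :=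
  ModuleCat.of Aᵐᵒᵖ (dualRL K (rightIdeal e) →ₗ[A] A)

/-- `B₂ = End_A(P)`. -/
abbrev algebraB₂ (e : A) : Type u := Module.End Aᵐᵒᵖ (moduleP K e)

end Algebras

end NearlyGor

end

/-! Everything reduces to torsionlessness. Let `U` be the regular bimodule and suppose that every
finitely generated module in `⊥U` is torsionless. A left approximation `M → Q` of a module in `⊥U`
is then injective and its cokernel lies in `⊥U` again. The transpose of the cokernel is a syzygy of
the transpose of `M`, so `Ext^i(Tr M, U) = 0` for all `i ≥ 1` by coinduction
(`isGPAux_of_torsionless`). Vector space duality turns the Gorenstein injective half into the same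
statement for left modules (`inDAPerp_iff`).

Torsionlessness comes from recurrence (`torsionless_of_recurrence`). On `⊥U` taking syzygies is
fully faithful in the stable category. If `Y k` are the iterated syzygies of an indecomposable
nonprojective `M` in `⊥U`, and `Y k` is a stable summand of `Y l` for some `k < l`, then `M` is a
stable summand of `Y (l - k)`, which embeds in a projective. The pigeonhole principle supplies `k`
and `l`, applied either to the `Y k` (`torsionless_of_finite`) or to their duals on the other side,
the `Y k` with `k ≥ 2` being reflexive (`torsionless_of_finite_dual`). So finiteness of the second
syzygies on one side settles both halves (`isNearlyGorenstein_of_finiteNonproj`).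

The finite class varies. For torsionless-finite algebras it consists of the first syzygies. For
dominant dimension at least two, second syzygies are kernels of maps between products of copies of
`eA`; on these `Hom(-, eA)` is fully faithful into modules over `End(eA) ≅ B₂`. Gorenstein
projectives are reflexive, hence second syzygies, which gives CM-finiteness. For radical square
zero, torsionless indecomposable nonprojective modules are simple.

For the last claim let `L` be the common annihilator of the simple nonprojective modules in `⊥U`.
Modulo the radical it is generated by an idempotent `f`, and `f` turns out to be central. By
connectedness `f = 0`, which would make `U` injective, or `f = 1`, which leaves no such simple
module. Finally, if `⊥A` consists of projectives and `A` has injective dimension `n`, every `n`-th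
syzygy is projective. -/

set_option linter.unusedSectionVars false

noncomputable section

namespace NearlyGor

/-! ### Vanishing of Ext along short exact sequences. -/

section ExtVanishing

variable {R : Type u} [Ring R]

/-- `Ext^i(M, N) = 0`, for unbundled modules. -/
abbrev ExtZero (R : Type u) [Ring R] (M N : Type u) [AddCommGroup M] [Module R M]
    [AddCommGroup N] [Module R N] (i : ℕ) : Prop :=
  Subsingleton (Abelian.Ext (ModuleCat.of R M) (ModuleCat.of R N) i)

variable {K P X U I M M' : Type u} [AddCommGroup K] [Module R K] [AddCommGroup P] [Module R P]
  [AddCommGroup X] [Module R X] [AddCommGroup U] [Module R U] [AddCommGroup I] [Module R I]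
  [AddCommGroup M] [Module R M] [AddCommGroup M'] [Module R M']

theorem shortExact_of_linearMap (f : K →ₗ[R] P) (g : P →ₗ[R] X) (hf : Function.Injective f)
    (hfg : Function.Exact f g) (hg : Function.Surjective g) :
    (ShortComplex.mk (ModuleCat.ofHom f) (ModuleCat.ofHom g)
      (by ext x; exact hfg.apply_apply_eq_zero x)).ShortExact where
  exact := (ShortComplex.ShortExact.moduleCat_exact_iff_function_exact _).2 hfg
  mono_f := (ModuleCat.mono_iff_injective _).2 hf
  epi_g := (ModuleCat.epi_iff_surjective _).2 hg

theorem extZero_projective (hP : Module.Projective R P) (i : ℕ) : ExtZero R P U (i + 1) := by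
  have := (IsProjective.iff_projective P).1 hP
  exact ⟨fun a b => (Abelian.Ext.eq_zero_of_projective a).trans
    (Abelian.Ext.eq_zero_of_projective b).symm⟩

theorem extZero_injective (hI : Module.Injective R I) (i : ℕ) : ExtZero R X I (i + 1) := by
  have := (Module.injective_iff_injective_object R I).1 hI
  exact ⟨fun a b => (Abelian.Ext.eq_zero_of_injective a).trans
    (Abelian.Ext.eq_zero_of_injective b).symm⟩

section Shift
variable {f : K →ₗ[R] P} {g : P →ₗ[R] X} (hf : Function.Injective f)
    (hfg : Function.Exact f g) (hg : Function.Surjective g)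
include hf hfg hg

theorem extZero_one_iff_extend (hP : Module.Projective R P) :
    ExtZero R X U 1 ↔ ∀ φ : K →ₗ[R] U, ∃ ψ : P →ₗ[R] U, ψ ∘ₗ f = φ := by
  have S := shortExact_of_linearMap f g hf hfg hg
  constructor
  · intro h φ
    obtain ⟨y, hy⟩ := Abelian.Ext.contravariant_sequence_exact₁ S (ModuleCat.of R U)
      (Abelian.Ext.mk₀ (ModuleCat.ofHom φ)) (n₁ := 1) rfl (h.elim _ _)
    obtain ⟨ψ, rfl⟩ := Abelian.Ext.addEquiv₀.symm.surjective y
    refine ⟨ψ.hom, ?_⟩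
    have := hy
    simp only [Abelian.Ext.addEquiv₀_symm_apply, Abelian.Ext.mk₀_comp_mk₀] at this
    have := Abelian.Ext.addEquiv₀.symm.injective this
    exact congrArg ModuleCat.Hom.hom this
  · intro h
    refine ⟨fun a b => ?_⟩
    suffices H : ∀ a : Abelian.Ext (ModuleCat.of R X) (ModuleCat.of R U) 1, a = 0 by
      rw [H a, H b]
    intro a
    obtain ⟨y, rfl⟩ := Abelian.Ext.contravariant_sequence_exact₃ S (ModuleCat.of R U) a
      ((extZero_projective (U := U) hP 0).elim _ _) (n₀ := 0) rfl
    obtain ⟨φ, rfl⟩ := Abelian.Ext.addEquiv₀.symm.surjective y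
    obtain ⟨ψ, hψ⟩ := h φ.hom
    have : φ = ModuleCat.ofHom f ≫ ModuleCat.ofHom ψ := by
      ext x; exact (LinearMap.congr_fun hψ x).symm
    simp only [Abelian.Ext.addEquiv₀_symm_apply, this]
    rw [← Abelian.Ext.mk₀_comp_mk₀]
    exact S.extClass_comp_assoc _

theorem extZero_succ_iff (hP : Module.Projective R P) (i : ℕ) :
    ExtZero R X U (i + 2) ↔ ExtZero R K U (i + 1) := by
  have S := shortExact_of_linearMap f g hf hfg hg
  constructor
  · intro h
    suffices H : ∀ a : Abelian.Ext (ModuleCat.of R K) (ModuleCat.of R U) (i + 1), a = 0 from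
      ⟨fun a b => (H a).trans (H b).symm⟩
    intro a
    obtain ⟨y, hy⟩ := Abelian.Ext.contravariant_sequence_exact₁ S (ModuleCat.of R U)
      a (n₁ := i + 2) (by omega) (h.elim _ _)
    rw [← hy, (extZero_projective (U := U) hP i).elim y 0, Abelian.Ext.comp_zero]
  · intro h
    suffices H : ∀ a : Abelian.Ext (ModuleCat.of R X) (ModuleCat.of R U) (i + 2), a = 0 from
      ⟨fun a b => (H a).trans (H b).symm⟩
    intro a
    obtain ⟨y, rfl⟩ := Abelian.Ext.contravariant_sequence_exact₃ S (ModuleCat.of R U) a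
      ((extZero_projective (U := U) hP _).elim _ _) (n₀ := i + 1) (by omega)
    rw [h.elim y 0, Abelian.Ext.comp_zero]

/-- Long exact sequence at the middle term. -/
theorem extZero_middle (i : ℕ) (h₁ : ExtZero R K U i) (h₂ : ExtZero R X U i) :
    ExtZero R P U i := by
  have S := shortExact_of_linearMap f g hf hfg hg
  suffices H : ∀ a : Abelian.Ext (ModuleCat.of R P) (ModuleCat.of R U) i, a = 0 from
    ⟨fun a b => (H a).trans (H b).symm⟩
  intro a
  obtain ⟨y, rfl⟩ := Abelian.Ext.contravariant_sequence_exact₂ S (ModuleCat.of R U) a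
    (h₁.elim _ _)
  rw [h₂.elim y 0, Abelian.Ext.comp_zero]

theorem extZero_one_iff_lift (hP : Module.Injective R P) :
    ExtZero R U K 1 ↔ ∀ φ : U →ₗ[R] X, ∃ ψ : U →ₗ[R] P, g ∘ₗ ψ = φ := by
  have S := shortExact_of_linearMap f g hf hfg hg
  constructor
  · intro h φ
    obtain ⟨y, hy⟩ := Abelian.Ext.covariant_sequence_exact₃ (ModuleCat.of R U) S
      (Abelian.Ext.mk₀ (ModuleCat.ofHom φ)) (n₁ := 1) rfl (h.elim _ _)
    obtain ⟨ψ, rfl⟩ := Abelian.Ext.addEquiv₀.symm.surjective y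
    refine ⟨ψ.hom, ?_⟩
    have := hy
    simp only [Abelian.Ext.addEquiv₀_symm_apply, Abelian.Ext.mk₀_comp_mk₀] at this
    have := Abelian.Ext.addEquiv₀.symm.injective this
    exact congrArg ModuleCat.Hom.hom this
  · intro h
    suffices H : ∀ a : Abelian.Ext (ModuleCat.of R U) (ModuleCat.of R K) 1, a = 0 from
      ⟨fun a b => (H a).trans (H b).symm⟩
    intro a
    obtain ⟨y, rfl⟩ := Abelian.Ext.covariant_sequence_exact₁ (ModuleCat.of R U) S a
      ((extZero_injective (X := U) hP 0).elim _ _) (n₀ := 0) rfl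
    obtain ⟨φ, rfl⟩ := Abelian.Ext.addEquiv₀.symm.surjective y
    obtain ⟨ψ, hψ⟩ := h φ.hom
    have : φ = ModuleCat.ofHom ψ ≫ ModuleCat.ofHom g := by
      ext x; exact (LinearMap.congr_fun hψ x).symm
    simp only [Abelian.Ext.addEquiv₀_symm_apply, this]
    rw [← Abelian.Ext.mk₀_comp_mk₀]
    rw [Abelian.Ext.comp_assoc_of_second_deg_zero]
    rw [S.comp_extClass, Abelian.Ext.comp_zero]

theorem extZero_succ_iff' (hP : Module.Injective R P) (i : ℕ) :
    ExtZero R U K (i + 2) ↔ ExtZero R U X (i + 1) := by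
  have S := shortExact_of_linearMap f g hf hfg hg
  constructor
  · intro h
    suffices H : ∀ a : Abelian.Ext (ModuleCat.of R U) (ModuleCat.of R X) (i + 1), a = 0 from
      ⟨fun a b => (H a).trans (H b).symm⟩
    intro a
    obtain ⟨y, hy⟩ := Abelian.Ext.covariant_sequence_exact₃ (ModuleCat.of R U) S
      a (n₁ := i + 2) (by omega) (h.elim _ _)
    rw [← hy, (extZero_injective (X := U) hP i).elim y 0, Abelian.Ext.zero_comp]
  · intro h
    suffices H : ∀ a : Abelian.Ext (ModuleCat.of R U) (ModuleCat.of R K) (i + 2), a = 0 from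
      ⟨fun a b => (H a).trans (H b).symm⟩
    intro a
    obtain ⟨y, rfl⟩ := Abelian.Ext.covariant_sequence_exact₁ (ModuleCat.of R U) S a
      ((extZero_injective (X := U) hP _).elim _ _) (n₀ := i + 1) (by omega)
    rw [h.elim y 0, Abelian.Ext.zero_comp]

end Shift

theorem ExtZero.of_retract {i : ℕ} (a : M →ₗ[R] M') (b : M' →ₗ[R] M)
    (hab : b ∘ₗ a = LinearMap.id) (h : ExtZero R M' U i) : ExtZero R M U i := by
  suffices H : ∀ x : Abelian.Ext (ModuleCat.of R M) (ModuleCat.of R U) i, x = 0 from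
    ⟨fun a b => (H a).trans (H b).symm⟩
  intro x
  have e : ModuleCat.ofHom a ≫ ModuleCat.ofHom b = 𝟙 (ModuleCat.of R M) := by
    ext y; exact LinearMap.congr_fun hab y
  rw [← Abelian.Ext.mk₀_id_comp x, ← e, ← Abelian.Ext.mk₀_comp_mk₀,
    Abelian.Ext.comp_assoc_of_second_deg_zero,
    h.elim ((Abelian.Ext.mk₀ (ModuleCat.ofHom b)).comp x (zero_add i)) 0, Abelian.Ext.comp_zero]

/-- `Ext^i(M, N) = 0` for all `i ≥ 1`, for unbundled modules. -/
abbrev ExtVan (R : Type u) [Ring R] (M N : Type u) [AddCommGroup M] [Module R M]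
    [AddCommGroup N] [Module R N] : Prop :=
  ExtVanishes (ModuleCat.of R M) (ModuleCat.of R N)

theorem extVan_iff : ExtVan R M U ↔ ∀ i, ExtZero R M U (i + 1) :=
  ⟨fun h i => h (i + 1) (by omega), fun h i hi => by
    obtain ⟨j, rfl⟩ := Nat.exists_eq_add_of_le' hi
    exact h j⟩

theorem ExtVan.of_retract (a : M →ₗ[R] M') (b : M' →ₗ[R] M)
    (hab : b ∘ₗ a = LinearMap.id) (h : ExtVan R M' U) : ExtVan R M U :=
  fun i hi => ExtZero.of_retract a b hab (h i hi)

theorem ExtVan.of_projective (hP : Module.Projective R P) : ExtVan R P U :=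
  extVan_iff.2 fun i => extZero_projective hP i

/-- The form in which Ext is used from here on: left to right it passes from a module in `⊥U` to its
syzygy, right to left from a module to the cokernel of a left approximation. -/
theorem extVan_iff_of_exact {f : K →ₗ[R] P} {g : P →ₗ[R] X} (hf : Function.Injective f)
    (hfg : Function.Exact f g) (hg : Function.Surjective g) (hP : Module.Projective R P) :
    ExtVan R X U ↔ (∀ φ : K →ₗ[R] U, ∃ ψ : P →ₗ[R] U, ψ ∘ₗ f = φ) ∧ ExtVan R K U := by
  rw [extVan_iff, extVan_iff, ← extZero_one_iff_extend hf hfg hg hP]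
  constructor
  · exact fun h => ⟨h 0, fun i => (extZero_succ_iff hf hfg hg hP i).1 (h (i + 1))⟩
  · rintro ⟨h₁, h₂⟩ (_ | i)
    · exact h₁
    · exact (extZero_succ_iff hf hfg hg hP i).2 (h₂ i)

/-- Coinduction principle for the vanishing of `Ext`. -/
theorem extVan_of_coinduction (C : ∀ (N : Type u) [AddCommGroup N] [Module R N], Prop)
    (step : ∀ (N : Type u) [AddCommGroup N] [Module R N], C N →
      ∃ (L Q : Type u) (_ : AddCommGroup L) (_ : Module R L) (_ : AddCommGroup Q)
        (_ : Module R Q) (f : L →ₗ[R] Q) (g : Q →ₗ[R] N), Module.Projective R Q ∧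
        Function.Injective f ∧ Function.Exact f g ∧ Function.Surjective g ∧
        (∀ φ : L →ₗ[R] U, ∃ ψ : Q →ₗ[R] U, ψ ∘ₗ f = φ) ∧ C L)
    (N : Type u) [AddCommGroup N] [Module R N] (hN : C N) : ExtVan R N U := by
  rw [extVan_iff]
  intro i
  induction i generalizing N with
  | zero =>
    obtain ⟨L, Q, _, _, _, _, f, g, hQ, hf, hfg, hg, hext, -⟩ := step N hN
    exact (extZero_one_iff_extend hf hfg hg hQ).2 hext
  | succ i ih =>
    obtain ⟨L, Q, _, _, _, _, f, g, hQ, hf, hfg, hg, -, hL⟩ := step N hN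
    exact (extZero_succ_iff hf hfg hg hQ i).2 (ih L hL)

end ExtVanishing

/-! ### The stable category: indecomposability, summands and the pigeonhole principle. -/

section Stable

variable {R : Type u} [Ring R]

/-- A nonzero module whose only idempotent endomorphisms are `0` and `1`. -/
def Indec (R M : Type u) [Ring R] [AddCommGroup M] [Module R M] : Prop :=
  Nontrivial M ∧ ∀ e : M →ₗ[R] M, e ∘ₗ e = e → e = 0 ∨ e = LinearMap.id

theorem isZero_iff_subsingleton (X : ModuleCat.{u} R) : Limits.IsZero X ↔ Subsingleton X :=
  ⟨fun h => ModuleCat.subsingleton_of_isZero h, fun _ => ModuleCat.isZero_of_subsingleton X⟩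

/-- Idempotent endomorphisms, unlike biproduct decompositions, transfer directly to stable maps and
to duals. -/
theorem indecomposable_iff (X : ModuleCat.{u} R) : Indecomposable X ↔ Indec R X := by
  unfold Indecomposable Indec
  rw [isZero_iff_subsingleton, not_subsingleton_iff_nontrivial]
  refine and_congr_right fun hX => ⟨fun h e he => ?_, fun h Y Z φ => ?_⟩
  · have hidem : ∀ x, e (e x) = e x := fun x => LinearMap.congr_fun he x
    let ψ : X ≃ₗ[R] (LinearMap.range e × LinearMap.ker e) :=
      { toFun := fun x => (⟨e x, x, rfl⟩, ⟨x - e x, by simp [hidem]⟩)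
        map_add' := fun x y => by
          ext <;> simp
          abel
        map_smul' := fun r x => by ext <;> simp [smul_sub]
        invFun := fun y => y.1.1 + y.2.1
        left_inv := fun x => by simp
        right_inv := by
          rintro ⟨⟨_, x, rfl⟩, ⟨y, hy⟩⟩
          have hy : e y = 0 := hy
          ext <;> simp [hidem, hy] }
    rcases h (ModuleCat.of R (LinearMap.range e)) (ModuleCat.of R (LinearMap.ker e))
      (ψ.toModuleIso ≪≫ (ModuleCat.biprodIsoProd (ModuleCat.of R (LinearMap.range e))
        (ModuleCat.of R (LinearMap.ker e))).symm) with h | h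
    · left
      have := (isZero_iff_subsingleton _).1 h
      ext x
      exact congrArg Subtype.val (this.elim (⟨e x, x, rfl⟩ : LinearMap.range e) 0)
    · right
      have := (isZero_iff_subsingleton _).1 h
      ext x
      have := congrArg Subtype.val (this.elim (⟨x - e x, by simp [hidem]⟩ : LinearMap.ker e) 0)
      exact (sub_eq_zero.1 this).symm
  · obtain ⟨p, i, q, j, hip, hjp, hjq⟩ : ∃ (p : X ⟶ Y) (i : Y ⟶ X) (q : X ⟶ Z) (j : Z ⟶ X),
        i ≫ p = 𝟙 Y ∧ j ≫ p = 0 ∧ j ≫ q = 𝟙 Z :=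
      ⟨φ.hom ≫ Limits.biprod.fst, Limits.biprod.inl ≫ φ.inv, φ.hom ≫ Limits.biprod.snd,
        Limits.biprod.inr ≫ φ.inv, by simp, by simp, by simp⟩
    have he : (p ≫ i) ≫ (p ≫ i) = p ≫ i := by
      rw [Category.assoc, reassoc_of% hip]
    rcases h (p ≫ i).hom (congrArg ModuleCat.Hom.hom he) with h | h
    · left
      have h0 : p ≫ i = 0 := ModuleCat.hom_ext h
      rw [Limits.IsZero.iff_id_eq_zero]
      have : i ≫ (p ≫ i) ≫ p = 𝟙 Y := by
        rw [Category.assoc, hip, Category.comp_id, hip]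
      rw [← this, h0, Limits.zero_comp, Limits.comp_zero]
    · right
      have h0 : p ≫ i = 𝟙 X := ModuleCat.hom_ext h
      rw [Limits.IsZero.iff_id_eq_zero]
      have : j ≫ (p ≫ i) ≫ q = 𝟙 Z := by rw [h0, Category.id_comp, hjq]
      rw [← this, Category.assoc p, ← Category.assoc, hjp, Limits.zero_comp]

variable {M N L M' N' : Type u} [AddCommGroup M] [Module R M] [AddCommGroup N] [Module R N]
  [AddCommGroup L] [Module R L] [AddCommGroup M'] [Module R M'] [AddCommGroup N'] [Module R N']

/-- A linear map that factors through a finitely generated projective module. -/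
def StablyZero (f : M →ₗ[R] N) : Prop :=
  ∃ (P : Type u) (_ : AddCommGroup P) (_ : Module R P) (a : M →ₗ[R] P) (b : P →ₗ[R] N),
    Module.Finite R P ∧ Module.Projective R P ∧ b ∘ₗ a = f

theorem StablyZero.zero : StablyZero (0 : M →ₗ[R] N) :=
  ⟨PUnit, inferInstance, inferInstance, 0, 0, inferInstance, inferInstance, by simp⟩

theorem StablyZero.add {f g : M →ₗ[R] N} (hf : StablyZero f) (hg : StablyZero g) :
    StablyZero (f + g) := by
  obtain ⟨P, _, _, a, b, _, _, rfl⟩ := hf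
  obtain ⟨Q, _, _, c, d, _, _, rfl⟩ := hg
  exact ⟨P × Q, inferInstance, inferInstance, a.prod c, b.coprod d, inferInstance, inferInstance,
    by ext; simp⟩

theorem StablyZero.comp_left {f : M →ₗ[R] N} (hf : StablyZero f) (g : N →ₗ[R] L) :
    StablyZero (g ∘ₗ f) := by
  obtain ⟨P, _, _, a, b, h1, h2, rfl⟩ := hf
  exact ⟨P, _, _, a, g ∘ₗ b, h1, h2, rfl⟩

theorem StablyZero.comp_right {f : M →ₗ[R] N} (hf : StablyZero f) (g : L →ₗ[R] M) :
    StablyZero (f ∘ₗ g) := by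
  obtain ⟨P, _, _, a, b, h1, h2, rfl⟩ := hf
  exact ⟨P, _, _, a ∘ₗ g, b, h1, h2, rfl⟩

theorem StablyZero.neg {f : M →ₗ[R] N} (hf : StablyZero f) : StablyZero (-f) := by
  simpa using hf.comp_left (-LinearMap.id)

theorem StablyZero.sub {f g : M →ₗ[R] N} (hf : StablyZero f) (hg : StablyZero g) :
    StablyZero (f - g) := by
  rw [sub_eq_add_neg]; exact hf.add hg.neg

theorem StablyZero.lift {f : M →ₗ[R] N} (hf : StablyZero f) (π : L →ₗ[R] N)
    (hπ : Function.Surjective π) : ∃ h : M →ₗ[R] L, π ∘ₗ h = f := by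
  obtain ⟨P, _, _, a, b, _, _, rfl⟩ := hf
  obtain ⟨c, hc⟩ := Module.projective_lifting_property π b hπ
  exact ⟨c ∘ₗ a, by rw [← LinearMap.comp_assoc, hc]⟩

theorem stablyZero_id_iff :
    StablyZero (LinearMap.id : M →ₗ[R] M) ↔ Module.Finite R M ∧ Module.Projective R M := by
  constructor
  · rintro ⟨P, _, _, a, b, _, _, h⟩
    exact ⟨Module.Finite.of_surjective b fun x => ⟨a x, LinearMap.congr_fun h x⟩,
      Module.Projective.of_split a b h⟩
  · rintro ⟨_, _⟩
    exact ⟨M, _, _, LinearMap.id, LinearMap.id, inferInstance, inferInstance, by simp⟩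

/-- `M` is a direct summand of `N` in the stable category. -/
def StRetract (R M N : Type u) [Ring R] [AddCommGroup M] [Module R M] [AddCommGroup N]
    [Module R N] : Prop :=
  ∃ (f : M →ₗ[R] N) (g : N →ₗ[R] M), StablyZero (g ∘ₗ f - LinearMap.id)

theorem StRetract.trans (h₁ : StRetract R M N) (h₂ : StRetract R N L) : StRetract R M L := by
  obtain ⟨f, g, h⟩ := h₁
  obtain ⟨f', g', h'⟩ := h₂
  refine ⟨f' ∘ₗ f, g ∘ₗ g', ?_⟩
  have : (g ∘ₗ g') ∘ₗ (f' ∘ₗ f) - LinearMap.id =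
    g ∘ₗ (g' ∘ₗ f' - LinearMap.id) ∘ₗ f + (g ∘ₗ f - LinearMap.id) := by
    ext x; simp
  rw [this]
  exact ((h'.comp_right f).comp_left g).add h

theorem StRetract.of_retract (f : M →ₗ[R] N) (g : N →ₗ[R] M) (h : g ∘ₗ f = LinearMap.id) :
    StRetract R M N := ⟨f, g, by rw [h, sub_self]; exact StablyZero.zero⟩

theorem StRetract.projective [Module.Finite R N] [Module.Projective R N]
    (h : StRetract R M N) : Module.Finite R M ∧ Module.Projective R M := by
  obtain ⟨f, g, h⟩ := h
  rw [← stablyZero_id_iff]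
  have : StablyZero (g ∘ₗ f) := ⟨N, _, _, f, g, inferInstance, inferInstance, rfl⟩
  simpa using this.sub h

/-- The stable endomorphism ring of `M` has no idempotents but `0` and `1`. -/
def StablyIndec (R M : Type u) [Ring R] [AddCommGroup M] [Module R M] : Prop :=
  ∀ e : M →ₗ[R] M, StablyZero (e ∘ₗ e - e) → StablyZero e ∨ StablyZero (e - LinearMap.id)

/-- Fitting's lemma for indecomposable modules of finite length. -/
theorem Indec.isNilpotent_or_bijective [IsArtinian R M] [IsNoetherian R M] (h : Indec R M)
    (f : M →ₗ[R] M) : (∃ n, f ^ n = 0) ∨ Function.Bijective f := by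
  obtain ⟨n, hn⟩ := Filter.eventually_atTop.1 f.eventually_isCompl_ker_pow_range_pow
  have hc := hn (n + 1) (by omega)
  let e : M →ₗ[R] M := Submodule.projection _ _ hc
  have he : e ∘ₗ e = e := by
    ext x; exact LinearMap.congr_fun (Submodule.isIdempotentElem_projection hc) x
  rcases h.2 e he with h0 | h1
  · right
    have hker : LinearMap.ker (f ^ (n + 1)) = ⊥ := by
      rw [← Submodule.range_projection hc]
      show LinearMap.range e = ⊥
      rw [h0, LinearMap.range_zero]
    have hinj : Function.Injective f := by
      rw [← LinearMap.ker_eq_bot, eq_bot_iff, ← hker]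
      intro x hx
      rw [LinearMap.mem_ker] at hx ⊢
      rw [pow_succ, Module.End.mul_apply, hx, map_zero]
    exact ⟨hinj, IsArtinian.surjective_of_injective_endomorphism f hinj⟩
  · left
    refine ⟨n + 1, ?_⟩
    have hker : LinearMap.ker (f ^ (n + 1)) = ⊤ := by
      rw [← Submodule.range_projection hc]
      show LinearMap.range e = ⊤
      rw [h1, LinearMap.range_id]
    exact LinearMap.ker_eq_top.1 hker

/-- By Fitting's lemma `e` is nilpotent or invertible. If `e² ≡ e` modulo maps through projectives,
then every positive power is congruent to `e`, so nilpotency gives `e ≡ 0`; otherwise cancel the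
invertible `e`. Stable indecomposability survives syzygies taken along arbitrary, not minimal,
projectives. -/
theorem Indec.stablyIndec [IsArtinian R M] [IsNoetherian R M] (h : Indec R M) :
    StablyIndec R M := by
  intro e he
  rcases h.isNilpotent_or_bijective e with ⟨n, hn⟩ | hb
  · left
    have key : ∀ k : ℕ, StablyZero (e ^ (k + 1) - e) := by
      intro k
      induction k with
      | zero => simpa using StablyZero.zero
      | succ k ih =>
        have : e ^ (k + 1 + 1) - e = (e ^ (k + 1) - e) ∘ₗ e + (e ∘ₗ e - e) := by
          ext x; simp [pow_succ]
        rw [this]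
        exact (ih.comp_right e).add he
    have := key n
    rw [pow_succ, hn] at this
    simpa using this.neg
  · right
    let E := LinearEquiv.ofBijective e hb
    have : e - LinearMap.id = E.symm.toLinearMap ∘ₗ (e ∘ₗ e - e) := by
      ext x
      have h1 : ∀ y, E.symm (e y) = y := fun y => E.symm_apply_apply y
      simp [h1]
    rw [this]
    exact he.comp_left _

theorem range_lt_of_idempotent {e e₁ : M →ₗ[R] M} (h₁ : e ∘ₗ e₁ = e₁) (h₂ : e₁ ∘ₗ e = e₁)
    (h₃ : e₁ ∘ₗ e₁ = e₁) (hne : e₁ ≠ e) : LinearMap.range e₁ < LinearMap.range e := by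
  refine lt_of_le_of_ne ?_ fun heq => hne ?_
  · rintro _ ⟨x, rfl⟩
    exact ⟨e₁ x, LinearMap.congr_fun h₁ x⟩
  · ext x
    obtain ⟨y, hy⟩ : e x ∈ LinearMap.range e₁ := heq ▸ ⟨x, rfl⟩
    rw [← hy]
    have := LinearMap.congr_fun h₂ x
    simp only [LinearMap.comp_apply] at this
    rw [← this, ← hy]
    exact LinearMap.congr_fun h₃ y

/-- If an idempotent with a given property has minimal range and the property passes to one of the
parts of every decomposition into orthogonal idempotents, then the range is indecomposable. -/
theorem exists_indec_range [IsArtinian R M] (p : (M →ₗ[R] M) → Prop) (h0 : ¬ p 0)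
    (hid : p LinearMap.id)
    (hsplit : ∀ e e₁ : M →ₗ[R] M, e ∘ₗ e = e → p e → e ∘ₗ e₁ = e₁ → e₁ ∘ₗ e = e₁ →
      e₁ ∘ₗ e₁ = e₁ → p e₁ ∨ p (e - e₁)) :
    ∃ e : M →ₗ[R] M, e ∘ₗ e = e ∧ p e ∧ Indec R (LinearMap.range e) := by
  let 𝒮 : Set (Submodule R M) := {Z | ∃ e : M →ₗ[R] M, e ∘ₗ e = e ∧ p e ∧ LinearMap.range e = Z}
  -- The minimum is taken over the ranges, since `M` is artinian; a proper part of `e` has strictly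
  -- smaller range.
  obtain ⟨_, ⟨e, he, hpe, rfl⟩, hmin⟩ := (IsWellFounded.wf : WellFounded
    ((· < ·) : Submodule R M → Submodule R M → Prop)).has_min 𝒮
      ⟨_, LinearMap.id, by simp, hid, rfl⟩
  refine ⟨e, he, hpe, ?_, fun f hf => ?_⟩
  · by_contra hnt
    rw [not_nontrivial_iff_subsingleton] at hnt
    apply h0
    convert hpe
    ext x
    exact (congrArg Subtype.val (hnt.elim (⟨e x, x, rfl⟩ : LinearMap.range e) 0)).symm
  · let e' : M →ₗ[R] LinearMap.range e := e.rangeRestrict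
    let e₁ : M →ₗ[R] M := (LinearMap.range e).subtype ∘ₗ f ∘ₗ e'
    have hidem : ∀ x, e (e x) = e x := fun x => LinearMap.congr_fun he x
    have hres : ∀ z : LinearMap.range e, e z.1 = z.1 := by
      rintro ⟨_, x, rfl⟩; exact hidem x
    have hres' : ∀ z : LinearMap.range e, e' z.1 = z := fun z => Subtype.ext (hres z)
    have hff : ∀ z, f (f z) = f z := fun z => LinearMap.congr_fun hf z
    have h1 : e ∘ₗ e₁ = e₁ := by ext x; exact hres _
    have h2 : e₁ ∘ₗ e = e₁ := by
      ext x
      have : e' (e x) = e' x := Subtype.ext (hidem x)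
      simp [e₁, this]
    have h3 : e₁ ∘ₗ e₁ = e₁ := by
      ext x; simp [e₁, hres', hff]
    have hfe : ∀ z : LinearMap.range e, (f z : M) = e₁ z.1 := fun z => by simp [e₁, hres']
    rcases hsplit e e₁ he hpe h1 h2 h3 with hp | hp
    · right
      have : e₁ = e := by
        by_contra hne
        exact hmin _ ⟨e₁, h3, hp, rfl⟩ (range_lt_of_idempotent h1 h2 h3 hne)
      ext z
      rw [hfe, this, hres]; rfl
    · left
      have h3' : (e - e₁) ∘ₗ (e - e₁) = e - e₁ := by
        rw [LinearMap.sub_comp, LinearMap.comp_sub, LinearMap.comp_sub, he, h1, h2, h3]; simp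
      have : e - e₁ = e := by
        by_contra hne
        exact hmin _ ⟨e - e₁, h3', hp, rfl⟩ (range_lt_of_idempotent
          (by rw [LinearMap.comp_sub, he, h1]) (by rw [LinearMap.sub_comp, he, h2]) h3' hne)
      have h0 : e₁ = 0 := by simpa using this
      ext z
      rw [hfe, h0]; rfl

theorem rangeRestrict_comp_subtype {e : M →ₗ[R] M} (he : e ∘ₗ e = e) :
    e.rangeRestrict ∘ₗ (LinearMap.range e).subtype = LinearMap.id := by
  ext ⟨_, x, rfl⟩
  exact LinearMap.congr_fun he x

/-- This strips off projective summands: choose an idempotent stably equal to the identity with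
minimal range. When it splits, stable indecomposability makes one part stably zero, so the other is
still stably the identity. -/
theorem StablyIndec.exists_indec [IsArtinian R M] (h : StablyIndec R M)
    (hM : ¬ StablyZero (LinearMap.id : M →ₗ[R] M)) :
    ∃ e : M →ₗ[R] M, e ∘ₗ e = e ∧ StablyZero (e - LinearMap.id) ∧ Indec R (LinearMap.range e) := by
  refine exists_indec_range (fun e => StablyZero (e - LinearMap.id)) ?_ ?_ ?_
  · intro h0
    apply hM
    simpa using h0.neg
  · simpa using StablyZero.zero
  · intro e e₁ _ hpe _ _ h3
    rcases h e₁ (by rw [h3, sub_self]; exact StablyZero.zero) with h | h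
    · right
      have : e - e₁ - LinearMap.id = (e - LinearMap.id) - e₁ := by abel
      rw [this]
      exact hpe.sub h
    · exact Or.inl h

/-- Only finitely many indecomposable nonprojective modules belong to the class `C`. -/
def FiniteNonproj (C : ModuleCat.{u} R → Prop) : Prop :=
  IsRepFiniteClass (fun M => C M ∧ ¬ Module.Projective R M)

theorem IsRepFiniteClass.mono {C C' : ModuleCat.{u} R → Prop} (h : IsRepFiniteClass C)
    (hC : ∀ M, C' M → C M) : IsRepFiniteClass C' := by
  obtain ⟨n, X, hX⟩ := h
  exact ⟨n, X, fun M hM => hX M (hC M hM)⟩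

/-- A class of modules closed under direct summands. -/
def SummandClosed (C : ModuleCat.{u} R → Prop) : Prop :=
  ∀ (M N : ModuleCat.{u} R) (f : M →ₗ[R] N) (g : N →ₗ[R] M), g ∘ₗ f = LinearMap.id → C N → C M

/-- Each `Y k` is stably equivalent to an indecomposable nonprojective summand `Z k`, which stays in
`C`. Infinitely many indices meet finitely many isomorphism classes, so two of the `Z k` are
isomorphic. -/
theorem exists_stRetract_of_finiteNonproj {C : ModuleCat.{u} R → Prop} (hC : SummandClosed C)
    (hfin : FiniteNonproj C) [IsArtinianRing R] (Y : ℕ → ModuleCat.{u} R)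
    (hf : ∀ k, Module.Finite R (Y k)) (hSI : ∀ k, StablyIndec R (Y k))
    (hproj : ∀ k, ¬ Module.Projective R (Y k)) (hY : ∀ k, C (Y k)) :
    ∃ k l, k < l ∧ StRetract R (Y k) (Y l) ∧ StRetract R (Y l) (Y k) := by
  have hz : ∀ k, ∃ Z : ModuleCat.{u} R, C Z ∧ ¬ Module.Projective R Z ∧ Indec R Z ∧
      StRetract R (Y k) Z ∧ StRetract R Z (Y k) := by
    intro k
    have := hf k
    obtain ⟨e, he, hst, hind⟩ := (hSI k).exists_indec
      (fun h => hproj k (stablyZero_id_iff.1 h).2)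
    have hret := rangeRestrict_comp_subtype he
    have hst1 : StRetract R (Y k) (LinearMap.range e) :=
      ⟨e.rangeRestrict, (LinearMap.range e).subtype, hst⟩
    refine ⟨ModuleCat.of R (LinearMap.range e), hC _ (Y k) _ _ hret (hY k), fun hP => ?_, hind,
      hst1, StRetract.of_retract _ _ hret⟩
    have : Module.Projective R (LinearMap.range e) := hP
    have : Module.Finite R (LinearMap.range e) :=
      Module.Finite.of_surjective e.rangeRestrict e.surjective_rangeRestrict
    exact hproj k hst1.projective.2
  choose Z hZC hZP hZI h1 h2 using hz
  obtain ⟨n, X, hX⟩ := hfin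
  choose i hi using fun k => hX (Z k) ⟨hZC k, hZP k⟩ ((indecomposable_iff _).2 (hZI k))
  have main : ∀ k l, i k = i l → StRetract R (Y k) (Y l) := by
    intro k l hkl
    obtain ⟨a⟩ := hi k
    obtain ⟨b⟩ := hi l
    rw [← hkl] at b
    let c := (a ≪≫ b.symm).toLinearEquiv
    exact (h1 k).trans ((StRetract.of_retract c.toLinearMap c.symm.toLinearMap
      (by ext x; simp)).trans (h2 l))
  obtain ⟨k, l, hne, hkl⟩ := Finite.exists_ne_map_eq_of_infinite i
  rcases lt_or_gt_of_ne hne with h | h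
  · exact ⟨k, l, h, main k l hkl, main l k hkl.symm⟩
  · exact ⟨l, k, h, main l k hkl.symm, main k l hkl⟩

end Stable

/-! ### Full faithfulness of syzygies in the stable category. -/

section Syzygies

variable {R : Type u} [Ring R]
variable {K P M K' P' M' N : Type u} [AddCommGroup K] [Module R K] [AddCommGroup P] [Module R P]
  [AddCommGroup M] [Module R M] [AddCommGroup K'] [Module R K'] [AddCommGroup P'] [Module R P']
  [AddCommGroup M'] [Module R M'] [AddCommGroup N] [Module R N]

theorem exists_lift_of_exact {f : K →ₗ[R] P} {g : P →ₗ[R] M} (hf : Function.Injective f)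
    (hfg : Function.Exact f g) (x : N →ₗ[R] P) (hx : g ∘ₗ x = 0) :
    ∃ θ : N →ₗ[R] K, f ∘ₗ θ = x := by
  have hr : ∀ n, x n ∈ LinearMap.range f := fun n => (hfg _).1 (LinearMap.congr_fun hx n)
  refine ⟨(LinearEquiv.ofInjective f hf).symm.toLinearMap ∘ₗ x.codRestrict _ hr, ?_⟩
  ext n
  have := (LinearEquiv.ofInjective f hf).apply_symm_apply (x.codRestrict _ hr n)
  exact congrArg Subtype.val this

theorem exists_desc_of_exact {f : K →ₗ[R] P} {g : P →ₗ[R] M} (hfg : Function.Exact f g)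
    (hg : Function.Surjective g) (y : P →ₗ[R] N) (hy : y ∘ₗ f = 0) :
    ∃ c : M →ₗ[R] N, c ∘ₗ g = y := by
  have hk : LinearMap.ker g ≤ LinearMap.ker y := by
    intro p hp
    obtain ⟨k, rfl⟩ := (hfg p).1 hp
    exact LinearMap.congr_fun hy k
  refine ⟨(LinearMap.ker g).liftQ y hk ∘ₗ (g.quotKerEquivOfSurjective hg).symm.toLinearMap, ?_⟩
  ext p
  have : (g.quotKerEquivOfSurjective hg).symm (g p) = Submodule.Quotient.mk p := by
    rw [LinearEquiv.symm_apply_eq]; rfl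
  simp [this]

/-- `0 → K → P → M → 0` is exact. -/
structure ShortEx (f : K →ₗ[R] P) (g : P →ₗ[R] M) : Prop where
  inj : Function.Injective f
  exact : Function.Exact f g
  surj : Function.Surjective g

theorem shortEx_ker (g : P →ₗ[R] M) (hg : Function.Surjective g) :
    ShortEx (LinearMap.ker g).subtype g :=
  ⟨Subtype.val_injective, LinearMap.exact_subtype_ker_map g, hg⟩

/-- Every linear map from `K` to a finitely generated projective module extends along `f`. -/
def ExtendsProj (f : K →ₗ[R] P) : Prop :=
  ∀ (Q : Type u) [AddCommGroup Q] [Module R Q], Module.Finite R Q → Module.Projective R Q →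
    ∀ φ : K →ₗ[R] Q, ∃ ψ : P →ₗ[R] Q, ψ ∘ₗ f = φ

variable {f : K →ₗ[R] P} {g : P →ₗ[R] M} {f' : K' →ₗ[R] P'} {g' : P' →ₗ[R] M'}

/-- Faithfulness of the syzygy. If `φ = b ∘ a` through a projective, extend `a` to `α` on `P`. Then
`Φ - f' ∘ b ∘ α` kills `K`, so it descends to a map `M → P'`, and this map followed by `g'` is `χ`.
-/
theorem StablyZero.cokernel (hS : ShortEx f g)
    (hext : ExtendsProj f) [Module.Finite R P'] [Module.Projective R P']
    {φ : K →ₗ[R] K'} {Φ : P →ₗ[R] P'} {χ : M →ₗ[R] M'}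
    (h1 : f' ∘ₗ φ = Φ ∘ₗ f) (h2 : g' ∘ₗ Φ = χ ∘ₗ g) (h0 : g' ∘ₗ f' = 0) (hφ : StablyZero φ) :
    StablyZero χ := by
  obtain ⟨Q, _, _, a, b, hQ1, hQ2, rfl⟩ := hφ
  obtain ⟨α, rfl⟩ := hext Q hQ1 hQ2 a
  obtain ⟨c, hc⟩ := exists_desc_of_exact hS.exact hS.surj (Φ - f' ∘ₗ b ∘ₗ α) (by
    rw [LinearMap.sub_comp, ← h1]; ext x; simp)
  refine ⟨P', _, _, c, g', inferInstance, inferInstance, ?_⟩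
  ext m
  obtain ⟨p, rfl⟩ := hS.surj m
  have e1 := LinearMap.congr_fun hc p
  have e2 := LinearMap.congr_fun h2 p
  have e3 := LinearMap.congr_fun h0 (b (α p))
  simp only [LinearMap.comp_apply, LinearMap.sub_apply, LinearMap.zero_apply] at e1 e2 e3 ⊢
  rw [e1, map_sub, e2, e3, sub_zero]

/-- A stably zero `χ` lifts through `g'`; subtracting this lift from `Φ` leaves a map `P → K'` that
restricts to `φ` on `K`. No extension property is needed in this direction. -/
theorem StablyZero.syzygy [Module.Finite R P] [Module.Projective R P]
    (hS' : ShortEx f' g') {φ : K →ₗ[R] K'} {Φ : P →ₗ[R] P'} {χ : M →ₗ[R] M'}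
    (h1 : f' ∘ₗ φ = Φ ∘ₗ f) (h2 : g' ∘ₗ Φ = χ ∘ₗ g) (h0 : g ∘ₗ f = 0) (hχ : StablyZero χ) :
    StablyZero φ := by
  obtain ⟨h, hh⟩ := hχ.lift g' hS'.surj
  obtain ⟨θ, hθ⟩ := exists_lift_of_exact hS'.inj hS'.exact (Φ - h ∘ₗ g) (by
    rw [LinearMap.comp_sub, ← LinearMap.comp_assoc, hh, h2, sub_self])
  refine ⟨P, _, _, f, θ, inferInstance, inferInstance, ?_⟩
  ext k
  apply hS'.inj
  have e1 := LinearMap.congr_fun hθ (f k)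
  have e2 := LinearMap.congr_fun h1 k
  have e3 := LinearMap.congr_fun h0 k
  simp only [LinearMap.comp_apply, LinearMap.sub_apply, LinearMap.zero_apply] at e1 e2 e3 ⊢
  rw [e1, e2, e3, map_zero, sub_zero]

theorem exists_cokernel_map (hS : ShortEx f g) (hS' : ShortEx f' g') (hext : ExtendsProj f)
    [Module.Finite R P'] [Module.Projective R P'] (φ : K →ₗ[R] K') :
    ∃ (Φ : P →ₗ[R] P') (χ : M →ₗ[R] M'), f' ∘ₗ φ = Φ ∘ₗ f ∧ g' ∘ₗ Φ = χ ∘ₗ g := by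
  obtain ⟨Φ, hΦ⟩ := hext P' inferInstance inferInstance (f' ∘ₗ φ)
  obtain ⟨χ, hχ⟩ := exists_desc_of_exact hS.exact hS.surj (g' ∘ₗ Φ) (by
    rw [LinearMap.comp_assoc, hΦ, ← LinearMap.comp_assoc, hS'.exact.linearMap_comp_eq_zero,
      LinearMap.zero_comp])
  exact ⟨Φ, χ, hΦ.symm, hχ.symm⟩

/-- Maps between the syzygies extend to the projectives and descend to the cokernels;
`StablyZero.cokernel` shows that the composite remains stably the identity. This lets stable
retractions be carried back along a resolution. -/
theorem StRetract.cokernel (hS : ShortEx f g) (hS' : ShortEx f' g') (hext : ExtendsProj f)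
    (hext' : ExtendsProj f') [Module.Finite R P] [Module.Projective R P]
    [Module.Finite R P'] [Module.Projective R P'] (h : StRetract R K K') : StRetract R M M' := by
  obtain ⟨a, b, hab⟩ := h
  obtain ⟨A, α, h1, h2⟩ := exists_cokernel_map hS hS' hext a
  obtain ⟨B, β, h3, h4⟩ := exists_cokernel_map hS' hS hext' b
  refine ⟨α, β, StablyZero.cokernel (Φ := B ∘ₗ A - LinearMap.id) hS hext ?_ ?_
    hS.exact.linearMap_comp_eq_zero hab⟩
  · rw [LinearMap.comp_sub, LinearMap.sub_comp, ← LinearMap.comp_assoc, h3, LinearMap.comp_assoc,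
      h1]; rfl
  · rw [LinearMap.comp_sub, LinearMap.sub_comp, ← LinearMap.comp_assoc, h4, LinearMap.comp_assoc,
      h2]; rfl

/-- Every stably idempotent endomorphism of `K` is induced from one of `M`. -/
theorem StablyIndec.syzygy (hS : ShortEx f g) (hext : ExtendsProj f) [Module.Finite R P]
    [Module.Projective R P] (h : StablyIndec R M) : StablyIndec R K := by
  intro e he
  obtain ⟨E, ε, h1, h2⟩ := exists_cokernel_map hS hS hext e
  have h0 := hS.exact.linearMap_comp_eq_zero
  rcases h ε (StablyZero.cokernel (Φ := E ∘ₗ E - E) hS hext (by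
      rw [LinearMap.comp_sub, LinearMap.sub_comp, ← LinearMap.comp_assoc, h1, LinearMap.comp_assoc,
        h1]; rfl) (by
      rw [LinearMap.comp_sub, LinearMap.sub_comp, ← LinearMap.comp_assoc, h2, LinearMap.comp_assoc,
        h2]; rfl) h0 he) with h | h
  · exact Or.inl (StablyZero.syzygy hS h1 h2 h0 h)
  · refine Or.inr (StablyZero.syzygy (Φ := E - LinearMap.id) hS ?_ ?_ h0 h)
    · rw [LinearMap.comp_sub, LinearMap.sub_comp, h1]; rfl
    · rw [LinearMap.comp_sub, LinearMap.sub_comp, h2]; rfl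

theorem projective_of_projective_syzygy (hS : ShortEx f g) (hext : ExtendsProj f)
    [Module.Finite R P] [Module.Projective R P] (h1 : Module.Finite R K)
    (h2 : Module.Projective R K) : Module.Projective R M := by
  have : StablyZero (LinearMap.id : M →ₗ[R] M) :=
    StablyZero.cokernel (φ := LinearMap.id) (Φ := LinearMap.id) hS hext (f' := f) (g' := g)
      rfl rfl hS.exact.linearMap_comp_eq_zero (stablyZero_id_iff.2 ⟨h1, h2⟩)
  exact (stablyZero_id_iff.1 this).2

/-- `N` is a syzygy of `M` with respect to a finitely generated projective module. -/
def IsSyzygyOf (N M : ModuleCat.{u} R) : Prop :=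
  ∃ (P : Type u) (_ : AddCommGroup P) (_ : Module R P) (f : N →ₗ[R] P) (g : P →ₗ[R] M),
    Module.Finite R P ∧ Module.Projective R P ∧ ShortEx f g

/-- The kernel of a map between finitely generated projective modules. -/
def IsSecondSyzygy (M : ModuleCat.{u} R) : Prop :=
  ∃ (P Q : Type u) (_ : AddCommGroup P) (_ : Module R P) (_ : AddCommGroup Q) (_ : Module R Q)
    (f : M →ₗ[R] P) (g : P →ₗ[R] Q), Module.Finite R P ∧ Module.Projective R P ∧
      Module.Finite R Q ∧ Module.Projective R Q ∧ Function.Injective f ∧ Function.Exact f g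

theorem exists_isSyzygyOf [IsNoetherianRing R] (M : ModuleCat.{u} R) (hM : Module.Finite R M) :
    ∃ N : ModuleCat.{u} R, Module.Finite R N ∧ IsSyzygyOf N M := by
  obtain ⟨n, g, hg⟩ := Module.Finite.exists_fin' R M
  exact ⟨ModuleCat.of R (LinearMap.ker g), inferInstanceAs (Module.Finite R (LinearMap.ker g)),
    Fin n → R, _, _, _, g, inferInstance, inferInstance, shortEx_ker g hg⟩

theorem exists_resolution [IsNoetherianRing R] (M : ModuleCat.{u} R) (hM : Module.Finite R M) :
    ∃ Y : ℕ → ModuleCat.{u} R, Y 0 = M ∧ (∀ k, Module.Finite R (Y k)) ∧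
      ∀ k, IsSyzygyOf (Y (k + 1)) (Y k) := by
  choose F hF1 hF2 using fun M : {M : ModuleCat.{u} R // Module.Finite R M} =>
    exists_isSyzygyOf M.1 M.2
  let Z : ℕ → {M : ModuleCat.{u} R // Module.Finite R M} :=
    fun n => Nat.rec ⟨M, hM⟩ (fun _ X => ⟨F X, hF1 X⟩) n
  exact ⟨fun n => (Z n).1, rfl, fun n => (Z n).2, fun n => hF2 (Z n)⟩

theorem IsSyzygyOf.isSecondSyzygy {X Y Z : ModuleCat.{u} R} (h : IsSyzygyOf X Y)
    (h' : IsSyzygyOf Y Z) : IsSecondSyzygy X := by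
  obtain ⟨P, _, _, f, g, h1, h2, hS⟩ := h
  obtain ⟨Q, _, _, f', g', h3, h4, hS'⟩ := h'
  refine ⟨P, Q, _, _, _, _, f, f' ∘ₗ g, h1, h2, h3, h4, hS.inj, fun p => ?_⟩
  rw [← hS.exact p, LinearMap.comp_apply, map_eq_zero_iff _ hS'.inj]

end Syzygies

/-! ### Duality `Hom(-, U)` with the regular bimodule, treating left and right modules at once. -/

section Dual

variable {R S U : Type u} [Ring R] [Ring S] [AddCommGroup U] [Module R U] [Module S U]
  [SMulCommClass R S U] [SMulCommClass S R U]

/-- The bimodule `U` is free of rank one on both sides with a common generator `u`, like the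
regular bimodule. -/
structure IsRegular (R S : Type u) {U : Type u} [Ring R] [Ring S] [AddCommGroup U] [Module R U]
    [Module S U] (u : U) : Prop where
  left : Function.Bijective fun r : R => r • u
  right : Function.Bijective fun s : S => s • u

theorem IsRegular.symm {u : U} (h : IsRegular R S u) : IsRegular S R u := ⟨h.right, h.left⟩

/-- The isomorphism of left modules given by a regular generator. -/
def IsRegular.equiv {u : U} (h : IsRegular R S u) : R ≃ₗ[R] U :=
  LinearEquiv.ofBijective (LinearMap.toSpanSingleton R U u) h.left

@[simp] theorem IsRegular.equiv_apply {u : U} (h : IsRegular R S u) (r : R) :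
    h.equiv r = r • u := rfl

variable {K P M X N : Type u} [AddCommGroup K] [Module R K] [AddCommGroup P] [Module R P]
  [AddCommGroup M] [Module R M] [AddCommGroup X] [Module R X] [AddCommGroup N] [Module R N]

/-- As `R ≅ U`, extension works coordinatewise for finite free modules, hence for their direct
summands. -/
theorem IsRegular.extendsProj {u : U} (h : IsRegular R S u) {f : K →ₗ[R] P}
    (hf : ∀ φ : K →ₗ[R] U, ∃ ψ : P →ₗ[R] U, ψ ∘ₗ f = φ) : ExtendsProj f := by
  intro Q _ _ _ _ φ
  obtain ⟨n, π, hπ⟩ := Module.Finite.exists_fin' R Q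
  obtain ⟨s, hs⟩ := Module.projective_lifting_property π LinearMap.id hπ
  choose ψ hψ using fun i : Fin n => hf (h.equiv.toLinearMap ∘ₗ LinearMap.proj i ∘ₗ s ∘ₗ φ)
  refine ⟨π ∘ₗ LinearMap.pi fun i => h.equiv.symm.toLinearMap ∘ₗ ψ i, ?_⟩
  ext k
  have : (LinearMap.pi fun i => h.equiv.symm.toLinearMap ∘ₗ ψ i) (f k) = s (φ k) := by
    ext i
    have := LinearMap.congr_fun (hψ i) k
    simp only [LinearMap.comp_apply, LinearEquiv.coe_coe] at this
    show h.equiv.symm (ψ i (f k)) = _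
    rw [this, LinearEquiv.symm_apply_apply]
    rfl
  simp only [LinearMap.comp_apply, this]
  exact LinearMap.congr_fun hs (φ k)

variable (R S U) in
/-- The evaluation map into the bidual. -/
def ev (M : Type u) [AddCommGroup M] [Module R M] : M →ₗ[R] ((M →ₗ[R] U) →ₗ[S] U) where
  toFun m :=
    { toFun := fun φ => φ m
      map_add' := fun _ _ => rfl
      map_smul' := fun _ _ => rfl }
  map_add' x y := by ext φ; exact map_add φ x y
  map_smul' r x := by ext φ; exact map_smul φ r x

@[simp] theorem ev_apply (m : M) (φ : M →ₗ[R] U) : ev R S U M m φ = φ m := rfl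

variable (U) in
/-- The linear maps to `U` separate the points. -/
def Torsionless (R : Type u) [Ring R] [Module R U] (M : Type u) [AddCommGroup M] [Module R M] :
    Prop :=
  ∀ m : M, (∀ φ : M →ₗ[R] U, φ m = 0) → m = 0

theorem Torsionless.of_injective (f : M →ₗ[R] N) (hf : Function.Injective f)
    (h : Torsionless U R N) : Torsionless U R M := fun m hm =>
  hf (by rw [map_zero]; exact h _ fun φ => hm (φ ∘ₗ f))

theorem IsRegular.torsionless {u : U} (h : IsRegular R S u) [Module.Projective R P] :
    Torsionless U R P := by
  intro p hp
  obtain ⟨s, hs⟩ := Module.projective_def'.1 (inferInstance : Module.Projective R P)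
  have : s p = 0 := by
    ext x
    have := hp (h.equiv.toLinearMap ∘ₗ Finsupp.lapply x ∘ₗ s)
    simpa using (map_eq_zero_iff _ h.equiv.injective).1 this
  have e := LinearMap.congr_fun hs p
  simpa [this] using e.symm

/-- The identity of `M` is `g ∘ f` minus a map through a projective; an element invisible to `U`
dies in `N` and in that projective. -/
theorem StRetract.torsionless {u : U} (hu : IsRegular R S u) (h : StRetract R M N)
    (hN : Torsionless U R N) : Torsionless U R M := by
  obtain ⟨f, g, P, _, _, a, b, _, _, hab⟩ := h
  intro m hm
  have h1 : f m = 0 := hN _ fun φ => hm (φ ∘ₗ f)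
  have h2 : a m = 0 := hu.torsionless _ fun φ => hm (φ ∘ₗ a)
  have := LinearMap.congr_fun hab m
  simp only [LinearMap.comp_apply, LinearMap.sub_apply, h1, h2, map_zero, zero_sub,
    LinearMap.id_apply] at this
  exact (neg_eq_zero.1 this.symm)

/-- Dual bases of a finitely generated projective module. -/
theorem IsRegular.exists_dualBasis {u : U} (h : IsRegular R S u) (P : Type u) [AddCommGroup P]
    [Module R P] [Module.Finite R P] [Module.Projective R P] :
    ∃ (n : ℕ) (p : Fin n → P) (φ : Fin n → P →ₗ[R] U) (c : Fin n → (P →ₗ[R] U) →ₗ[S] S),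
      (∀ ψ : P →ₗ[R] U, ∑ i, c i ψ • φ i = ψ) ∧
      (∀ ψ i, c i ψ • u = ψ (p i)) := by
  obtain ⟨n, π, hπ⟩ := Module.Finite.exists_fin' R P
  obtain ⟨s, hs⟩ := Module.projective_lifting_property π LinearMap.id hπ
  let p : Fin n → P := fun i => π (Pi.single i 1)
  have hp : ∀ x, ∑ i, s x i • p i = x := by
    intro x
    have : π (s x) = x := LinearMap.congr_fun hs x
    conv_rhs => rw [← this, ← Finset.univ_sum_single (s x), map_sum]
    refine Finset.sum_congr rfl fun i _ => ?_
    rw [← map_smul, ← Pi.single_smul, smul_eq_mul, mul_one]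
  let φ : Fin n → P →ₗ[R] U := fun i => h.equiv.toLinearMap ∘ₗ LinearMap.proj i ∘ₗ s
  let evp : Fin n → (P →ₗ[R] U) →ₗ[S] U := fun i => ev R S U P (p i)
  let c : Fin n → (P →ₗ[R] U) →ₗ[S] S := fun i => h.symm.equiv.symm.toLinearMap ∘ₗ evp i
  have hc : ∀ ψ i, c i ψ • u = ψ (p i) := fun ψ i => h.symm.equiv.apply_symm_apply (ψ (p i))
  refine ⟨n, p, φ, c, fun ψ => ?_, hc⟩
  ext x
  conv_rhs => rw [← hp x, map_sum]
  rw [LinearMap.sum_apply]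
  refine Finset.sum_congr rfl fun i _ => ?_
  rw [map_smul, ← hc ψ i, smul_comm]
  rfl

theorem IsRegular.finite_dual_projective {u : U} (h : IsRegular R S u) [Module.Finite R P]
    [Module.Projective R P] : Module.Finite S (P →ₗ[R] U) := by
  obtain ⟨n, p, φ, c, h1, h2⟩ := h.exists_dualBasis P
  exact Module.Finite.of_surjective (Fintype.linearCombination S φ) fun ψ =>
    ⟨fun i => c i ψ, by rw [Fintype.linearCombination_apply]; exact h1 ψ⟩

theorem IsRegular.projective_dual {u : U} (h : IsRegular R S u) [Module.Finite R P]
    [Module.Projective R P] : Module.Projective S (P →ₗ[R] U) := by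
  obtain ⟨n, p, φ, c, h1, h2⟩ := h.exists_dualBasis P
  refine Module.Projective.of_split (LinearMap.pi c) (Fintype.linearCombination S φ) ?_
  ext1 ψ
  rw [LinearMap.comp_apply, Fintype.linearCombination_apply]
  exact h1 ψ

theorem IsRegular.bijective_ev {u : U} (h : IsRegular R S u) [Module.Finite R P]
    [Module.Projective R P] : Function.Bijective (ev R S U P) := by
  constructor
  · rw [injective_iff_map_eq_zero]
    exact fun p hp => h.torsionless p fun φ => LinearMap.congr_fun hp φ
  · intro F
    obtain ⟨n, p, φ, c, h1, h2⟩ := h.exists_dualBasis P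
    refine ⟨∑ i, h.equiv.symm (F (φ i)) • p i, ?_⟩
    ext ψ
    have e1 : ∀ i, h.equiv.symm (F (φ i)) • u = F (φ i) :=
      fun i => h.equiv.apply_symm_apply _
    conv_rhs => rw [← h1 ψ, map_sum]
    rw [ev_apply, map_sum]
    refine Finset.sum_congr rfl fun i _ => ?_
    rw [map_smul, map_smul, ← h2, smul_comm, e1]

theorem lcomp_injective_of_surjective {f : M →ₗ[R] N} (hf : Function.Surjective f) :
    Function.Injective (LinearMap.lcomp S U f) := by
  intro a b hab
  ext x
  obtain ⟨y, rfl⟩ := hf x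
  exact LinearMap.congr_fun hab y

theorem lcomp_exact {f : K →ₗ[R] P} {g : P →ₗ[R] M} (hfg : Function.Exact f g)
    (hg : Function.Surjective g) :
    Function.Exact (LinearMap.lcomp S U g) (LinearMap.lcomp S U f) := by
  intro ψ
  constructor
  · intro h
    exact exists_desc_of_exact hfg hg ψ h
  · rintro ⟨c, rfl⟩
    ext x
    have := hfg.apply_apply_eq_zero x
    simp [LinearMap.lcomp_apply, this]

theorem IsRegular.finite_dual {u : U} (h : IsRegular R S u) [IsNoetherianRing S]
    [Module.Finite R M] : Module.Finite S (M →ₗ[R] U) := by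
  obtain ⟨n, π, hπ⟩ := Module.Finite.exists_fin' R M
  have : Module.Finite S ((Fin n → R) →ₗ[R] U) := h.finite_dual_projective
  exact Module.Finite.of_injective (LinearMap.lcomp S U π) (lcomp_injective_of_surjective hπ)

theorem StablyZero.dual {u : U} (h : IsRegular R S u) {f : M →ₗ[R] N} (hf : StablyZero f) :
    StablyZero (LinearMap.lcomp S U f) := by
  obtain ⟨P, _, _, a, b, _, _, rfl⟩ := hf
  exact ⟨P →ₗ[R] U, _, _, LinearMap.lcomp S U b, LinearMap.lcomp S U a,
    h.finite_dual_projective, h.projective_dual, rfl⟩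

/-- Reflexivity of `N` makes duality full: `f` is the double dual of `e`, transported back along
`ev`. This needs only that `U` is a bimodule, and is reused with an injective module and its
endomorphism ring. -/
theorem exists_eq_lcomp (hN : Function.Bijective (ev R S U N))
    (e : (N →ₗ[R] U) →ₗ[S] (M →ₗ[R] U)) : ∃ f : M →ₗ[R] N, e = LinearMap.lcomp S U f := by
  let E := LinearEquiv.ofBijective (ev R S U N) hN
  refine ⟨E.symm.toLinearMap ∘ₗ LinearMap.lcomp R U e ∘ₗ ev R S U M, ?_⟩
  ext ψ x
  have : ev R S U N (E.symm (LinearMap.lcomp R U e (ev R S U M x))) =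
    LinearMap.lcomp R U e (ev R S U M x) := E.apply_symm_apply _
  exact (LinearMap.congr_fun this ψ).symm

theorem StablyZero.of_dual {u : U} (h : IsRegular R S u) (hN : Function.Bijective (ev R S U N))
    {f : M →ₗ[R] N} (hf : StablyZero (LinearMap.lcomp S U f)) : StablyZero f := by
  let E := LinearEquiv.ofBijective (ev R S U N) hN
  have h2 := ((hf.dual h.symm).comp_right (ev R S U M)).comp_left E.symm.toLinearMap
  convert h2
  ext x
  simp only [LinearMap.comp_apply, LinearEquiv.coe_coe]
  rw [LinearEquiv.eq_symm_apply]
  rfl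

theorem lcomp_comp (f : M →ₗ[R] N) (g : N →ₗ[R] X) :
    LinearMap.lcomp S U (g ∘ₗ f) = LinearMap.lcomp S U f ∘ₗ LinearMap.lcomp S U g := rfl

theorem lcomp_sub (f g : M →ₗ[R] N) :
    LinearMap.lcomp S U (f - g) = LinearMap.lcomp S U f - LinearMap.lcomp S U g := by
  ext φ x; simp [LinearMap.lcomp_apply]

theorem lcomp_id : LinearMap.lcomp S U (LinearMap.id : M →ₗ[R] M) = LinearMap.id := rfl

theorem StablyIndec.dual {u : U} (h : IsRegular R S u) (hM : Function.Bijective (ev R S U M))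
    (hI : StablyIndec R M) : StablyIndec S (M →ₗ[R] U) := by
  intro e he
  obtain ⟨f, rfl⟩ := exists_eq_lcomp hM e
  rw [← lcomp_comp, ← lcomp_sub] at he
  rcases hI f (he.of_dual h hM) with h' | h'
  · exact Or.inl (h'.dual h)
  · right
    rw [← lcomp_id, ← lcomp_sub]
    exact h'.dual h

theorem StRetract.of_dual {u : U} (h : IsRegular R S u) (hM : Function.Bijective (ev R S U M))
    (hN : Function.Bijective (ev R S U N)) (hr : StRetract S (M →ₗ[R] U) (N →ₗ[R] U)) :
    StRetract R M N := by
  obtain ⟨a, b, hab⟩ := hr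
  obtain ⟨f, rfl⟩ := exists_eq_lcomp hM a
  obtain ⟨g, rfl⟩ := exists_eq_lcomp hN b
  rw [← lcomp_comp, ← lcomp_id, ← lcomp_sub] at hab
  exact ⟨g, f, hab.of_dual h hM⟩

theorem projective_of_dual {u : U} (h : IsRegular R S u) (hM : Function.Bijective (ev R S U M))
    (h1 : Module.Finite S (M →ₗ[R] U)) (h2 : Module.Projective S (M →ₗ[R] U)) :
    Module.Projective R M := by
  have := stablyZero_id_iff.2 ⟨h1, h2⟩
  rw [← lcomp_id] at this
  exact (stablyZero_id_iff.1 (this.of_dual h hM)).2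

/-- A functional on `Hom(K, U)`, pulled back to `Hom(P, U)`, is evaluation at some `q`. Maps
factoring through `M` vanish on `K`, so `g q` is invisible to `U`; torsionlessness of `M` puts `q`
in `K`. -/
theorem IsRegular.bijective_ev_of_shortEx {u : U} (h : IsRegular R S u) [Module.Finite R P]
    [Module.Projective R P] {f : K →ₗ[R] P} {g : P →ₗ[R] M} (hS : ShortEx f g)
    (hext : ∀ φ : K →ₗ[R] U, ∃ ψ : P →ₗ[R] U, ψ ∘ₗ f = φ) (hM : Torsionless U R M) :
    Function.Bijective (ev R S U K) := by
  constructor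
  · rw [injective_iff_map_eq_zero]
    exact fun p hp => (h.torsionless (P := P)).of_injective f hS.inj p
      fun φ => LinearMap.congr_fun hp φ
  · intro F
    obtain ⟨q, hq⟩ := h.bijective_ev.2 (F ∘ₗ LinearMap.lcomp S U f)
    have hq' : ∀ ψ : P →ₗ[R] U, F (ψ ∘ₗ f) = ψ q := fun ψ => (LinearMap.congr_fun hq ψ).symm
    have hgq : g q = 0 := hM _ fun φ => by
      have := hq' (φ ∘ₗ g)
      rw [LinearMap.comp_assoc, hS.exact.linearMap_comp_eq_zero, LinearMap.comp_zero,
        map_zero] at this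
      exact this.symm
    obtain ⟨k, rfl⟩ := (hS.exact q).1 hgq
    refine ⟨k, ?_⟩
    ext φ
    obtain ⟨ψ, rfl⟩ := hext φ
    exact (hq' ψ).symm

end Dual

/-! ### Recurrence of syzygies, torsionlessness and Gorenstein projectivity. -/

section Weakly

variable {R S U : Type u} [Ring R] [Ring S] [AddCommGroup U] [Module R U] [Module S U]
  [SMulCommClass R S U] [SMulCommClass S R U]

/-- The sequences of syzygies of a stably indecomposable nonprojective module in `⊥U`. -/
structure IsSyzygySeq (U : Type u) [AddCommGroup U] [Module R U] (Y : ℕ → ModuleCat.{u} R) :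
    Prop where
  finite : ∀ k, Module.Finite R (Y k)
  syzygy : ∀ k, IsSyzygyOf (Y (k + 1)) (Y k)
  extVan : ∀ k, ExtVan R (Y k) U
  stablyIndec : ∀ k, StablyIndec R (Y k)
  not_projective : ∀ k, ¬ Module.Projective R (Y k)

theorem exists_isSyzygySeq [IsArtinianRing R] {u : U} (h : IsRegular R S u)
    (M : ModuleCat.{u} R) (hM : Module.Finite R M) (hExt : ExtVan R M U)
    (hI : StablyIndec R M) (hP : ¬ Module.Projective R M) :
    ∃ Y : ℕ → ModuleCat.{u} R, Y 0 = M ∧ IsSyzygySeq U Y := by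
  obtain ⟨Y, rfl, hfin, hsyz⟩ := exists_resolution M hM
  have key : ∀ k, ExtVan R (Y k) U ∧ StablyIndec R (Y k) ∧ ¬ Module.Projective R (Y k) := by
    intro k
    induction k with
    | zero => exact ⟨hExt, hI, hP⟩
    | succ k ih =>
      obtain ⟨P, _, _, f, g, h1, h2, hS⟩ := hsyz k
      obtain ⟨i1, i2, i3⟩ := ih
      obtain ⟨e1, e2⟩ := (extVan_iff_of_exact hS.inj hS.exact hS.surj h2).1 i1
      have hext := h.extendsProj e1
      exact ⟨e2, i2.syzygy hS hext,
        fun hp => i3 (projective_of_projective_syzygy hS hext (hfin (k + 1)) hp)⟩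
  exact ⟨Y, rfl, hfin, hsyz, fun k => (key k).1, fun k => (key k).2.1, fun k => (key k).2.2⟩

/-- Undo `a` syzygies one at a time with `StRetract.cokernel`, which applies because all terms lie
in `⊥U`. -/
theorem IsSyzygySeq.stRetract_of_add {u : U} (h : IsRegular R S u) {Y : ℕ → ModuleCat.{u} R}
    (hY : IsSyzygySeq U Y) (a c : ℕ) (hr : StRetract R (Y a) (Y (a + c))) :
    StRetract R (Y 0) (Y c) := by
  induction a with
  | zero => rw [zero_add] at hr; exact hr
  | succ a ih =>
    apply ih
    rw [show a + 1 + c = (a + c) + 1 by omega] at hr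
    obtain ⟨P, _, _, f, g, h1, h2, hS⟩ := hY.syzygy a
    obtain ⟨P', _, _, f', g', h1', h2', hS'⟩ := hY.syzygy (a + c)
    have e := ((extVan_iff_of_exact hS.inj hS.exact hS.surj h2).1 (hY.extVan a)).1
    have e' := ((extVan_iff_of_exact hS'.inj hS'.exact hS'.surj h2').1 (hY.extVan (a + c))).1
    exact hr.cokernel hS hS' (h.extendsProj e) (h.extendsProj e')

theorem IsSyzygySeq.torsionless {u : U} (h : IsRegular R S u) {Y : ℕ → ModuleCat.{u} R}
    (hY : IsSyzygySeq U Y) (k : ℕ) : Torsionless U R (Y (k + 1)) := by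
  obtain ⟨P, _, _, f, g, h1, h2, hS⟩ := hY.syzygy k
  exact (h.torsionless (P := P)).of_injective f hS.inj

/-- If sequences of syzygies in `⊥U` recur, then all finitely generated modules in `⊥U` are
torsionless. -/
theorem torsionless_of_recurrence [IsArtinianRing R] {u : U} (h : IsRegular R S u)
    (hrec : ∀ Y : ℕ → ModuleCat.{u} R, IsSyzygySeq U Y →
      ∃ k l, k < l ∧ StRetract R (Y k) (Y l))
    (M : Type u) [AddCommGroup M] [Module R M] [Module.Finite R M] (hExt : ExtVan R M U) :
    Torsionless U R M := by
  intro m hm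
  by_contra hne
  -- The bad element `m` has a nonzero component in some indecomposable summand, so only
  -- indecomposable modules need to be treated.
  obtain ⟨e, he, hem, hind⟩ := exists_indec_range (R := R) (M := M) (fun e => e m ≠ 0)
    (by simp) (by simpa using hne) (fun e e₁ _ hp _ _ _ => by
      by_contra hcon
      push Not at hcon
      apply hp
      simpa [hcon.1] using hcon.2)
  have hret := rangeRestrict_comp_subtype he
  have hfin : Module.Finite R (LinearMap.range e) :=
    Module.Finite.of_surjective e.rangeRestrict e.surjective_rangeRestrict
  have hZ : Torsionless U R (LinearMap.range e) := by
    by_cases hP : Module.Projective R (LinearMap.range e)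
    · exact h.torsionless
    · obtain ⟨Y, hY0, hY⟩ := exists_isSyzygySeq h (ModuleCat.of R (LinearMap.range e)) hfin
        (hExt.of_retract _ _ hret) hind.stablyIndec hP
      obtain ⟨k, l, hkl, hr⟩ := hrec Y hY
      obtain ⟨c, rfl⟩ := Nat.exists_eq_add_of_lt hkl
      have := hY.stRetract_of_add h k (c + 1) hr
      rw [hY0] at this
      exact this.torsionless h (hY.torsionless h c)
  apply hem
  have := hZ (e.rangeRestrict m) fun φ => hm (φ ∘ₗ e.rangeRestrict)
  exact congrArg Subtype.val this

/-- The first finiteness criterion: second syzygies in `⊥U`. -/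
theorem torsionless_of_finite [IsArtinianRing R] {u : U} (h : IsRegular R S u)
    {C : ModuleCat.{u} R → Prop} (hC : SummandClosed C) (hfin : FiniteNonproj C)
    (hsub : ∀ X : ModuleCat.{u} R, Module.Finite R X → ExtVan R X U → IsSecondSyzygy X → C X)
    (M : Type u) [AddCommGroup M] [Module R M] [Module.Finite R M] (hExt : ExtVan R M U) :
    Torsionless U R M := by
  refine torsionless_of_recurrence h (fun Y hY => ?_) M hExt
  -- From index two on, every term is a second syzygy.
  obtain ⟨k, l, hkl, hr, -⟩ := exists_stRetract_of_finiteNonproj hC hfin (fun k => Y (k + 2))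
    (fun k => hY.finite _) (fun k => hY.stablyIndec _) (fun k => hY.not_projective _)
    (fun k => hsub _ (hY.finite _) (hY.extVan _)
      ((hY.syzygy (k + 1)).isSecondSyzygy (hY.syzygy k)))
  exact ⟨k + 2, l + 2, by omega, hr⟩

/-- The shift by two occurs because reflexivity of a syzygy of `Y (k + 1)` needs `Y (k + 1)` itself
to be torsionless. -/
theorem IsSyzygySeq.bijective_ev {u : U} (h : IsRegular R S u) {Y : ℕ → ModuleCat.{u} R}
    (hY : IsSyzygySeq U Y) (k : ℕ) : Function.Bijective (ev R S U (Y (k + 2))) := by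
  obtain ⟨P, _, _, f, g, h1, h2, hS⟩ := hY.syzygy (k + 1)
  exact h.bijective_ev_of_shortEx hS
    ((extVan_iff_of_exact hS.inj hS.exact hS.surj h2).1 (hY.extVan (k + 1))).1
    (hY.torsionless h k)

/-- Dualizing a projective presentation of `X` exhibits `Hom(X, U)` as the kernel of a map between
finitely generated projectives. -/
theorem isSecondSyzygy_dual {u : U} (h : IsRegular R S u) {X Y : ModuleCat.{u} R}
    (hYX : IsSyzygyOf Y X) (hY : Module.Finite R Y)
    [IsNoetherianRing R] :
    IsSecondSyzygy (ModuleCat.of S (X →ₗ[R] U)) := by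
  obtain ⟨P, _, _, f, g, h1, h2, hS⟩ := hYX
  obtain ⟨n, π, hπ⟩ := Module.Finite.exists_fin' R Y
  refine ⟨P →ₗ[R] U, (Fin n → R) →ₗ[R] U, _, _, _, _, LinearMap.lcomp S U g,
    LinearMap.lcomp S U (f ∘ₗ π), h.finite_dual_projective, h.projective_dual,
    h.finite_dual_projective, h.projective_dual, lcomp_injective_of_surjective hS.surj, ?_⟩
  intro ψ
  rw [← lcomp_exact hS.exact hS.surj ψ, lcomp_comp, LinearMap.comp_apply,
    map_eq_zero_iff _ (lcomp_injective_of_surjective hπ)]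

/-- The second finiteness criterion: second syzygies on the other side. -/
theorem torsionless_of_finite_dual [IsArtinianRing R] [IsArtinianRing S] {u : U}
    (h : IsRegular R S u)
    {C : ModuleCat.{u} S → Prop} (hC : SummandClosed C) (hfin : FiniteNonproj C)
    (hsub : ∀ X : ModuleCat.{u} S, Module.Finite S X → IsSecondSyzygy X → C X)
    (M : Type u) [AddCommGroup M] [Module R M] [Module.Finite R M] (hExt : ExtVan R M U) :
    Torsionless U R M := by
  refine torsionless_of_recurrence h (fun Y hY => ?_) M hExt
  have hev := hY.bijective_ev h
  have hf : ∀ k, Module.Finite S (Y (k + 2) →ₗ[R] U) := fun k => by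
    have := hY.finite (k + 2)
    exact h.finite_dual
  -- The pigeonhole principle acts on the duals; reflexivity carries the resulting retraction back.
  obtain ⟨k, l, hkl, hr, -⟩ := exists_stRetract_of_finiteNonproj hC hfin
    (fun k => ModuleCat.of S (Y (k + 2) →ₗ[R] U)) hf
    (fun k => (hY.stablyIndec _).dual h (hev k))
    (fun k hp => hY.not_projective _ (projective_of_dual h (hev k) (hf k) hp))
    (fun k => hsub _ (hf k)
      (isSecondSyzygy_dual h (hY.syzygy (k + 2)) (hY.finite _)))
  exact ⟨k + 2, l + 2, by omega, hr.of_dual h (hev k) (hev l)⟩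

/-- A left approximation of a torsionless module. -/
theorem exists_leftApprox [IsNoetherianRing R] [IsNoetherianRing S] {u : U} (h : IsRegular R S u)
    (M : Type u) [AddCommGroup M] [Module R M] [Module.Finite R M] (hM : Torsionless U R M) :
    ∃ (Q : Type u) (_ : AddCommGroup Q) (_ : Module R Q) (j : M →ₗ[R] Q), Module.Finite R Q ∧
      Module.Projective R Q ∧ Function.Injective j ∧
      ∀ φ : M →ₗ[R] U, ∃ ψ : Q →ₗ[R] U, ψ ∘ₗ j = φ := by
  have : Module.Finite S (M →ₗ[R] U) := h.finite_dual
  obtain ⟨n, π, hπ⟩ := Module.Finite.exists_fin' S (M →ₗ[R] U)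
  let b : Fin n → M →ₗ[R] U := fun i => π (Pi.single i 1)
  have hb : ∀ c, π c = ∑ i, c i • b i := by
    intro c
    conv_lhs => rw [← Finset.univ_sum_single c, map_sum]
    refine Finset.sum_congr rfl fun i _ => ?_
    rw [← map_smul, ← Pi.single_smul, smul_eq_mul, mul_one]
  have hfin : Module.Finite R U := Module.Finite.equiv h.equiv
  have hproj : Module.Projective R (Fin n → U) :=
    Module.Projective.of_equiv (LinearEquiv.piCongrRight fun _ => h.equiv)
  have hext : ∀ φ : M →ₗ[R] U, ∃ ψ : (Fin n → U) →ₗ[R] U, ψ ∘ₗ LinearMap.pi b = φ := by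
    intro φ
    obtain ⟨c, rfl⟩ := hπ φ
    refine ⟨∑ i, c i • LinearMap.proj i, ?_⟩
    ext m
    simp [hb]
  refine ⟨Fin n → U, inferInstance, inferInstance, LinearMap.pi b, inferInstance, inferInstance,
    ?_, hext⟩
  rw [injective_iff_map_eq_zero]
  intro m hm
  refine hM m fun φ => ?_
  obtain ⟨ψ, rfl⟩ := hext φ
  rw [LinearMap.comp_apply, hm, map_zero]

theorem shortEx_mkQ {M P : Type u} [AddCommGroup M] [Module R M] [AddCommGroup P] [Module R P]
    (f : M →ₗ[R] P) (hf : Function.Injective f) : ShortEx f (LinearMap.range f).mkQ :=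
  ⟨hf, LinearMap.exact_map_mkQ_range f, Submodule.mkQ_surjective _⟩

theorem exists_leftApprox_extVan [IsNoetherianRing R] [IsNoetherianRing S] {u : U}
    (h : IsRegular R S u)
    (M : Type u) [AddCommGroup M] [Module R M] [Module.Finite R M] (hM : Torsionless U R M)
    (hExt : ExtVan R M U) :
    ∃ (Q C : Type u) (_ : AddCommGroup Q) (_ : Module R Q) (_ : AddCommGroup C) (_ : Module R C)
      (j : M →ₗ[R] Q) (q : Q →ₗ[R] C), Module.Finite R Q ∧
      Module.Projective R Q ∧ ShortEx j q ∧ Module.Finite R C ∧ ExtVan R C U ∧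
      ∀ φ : M →ₗ[R] U, ∃ ψ : Q →ₗ[R] U, ψ ∘ₗ j = φ := by
  obtain ⟨Q, _, _, j, h1, h2, hj, hext⟩ := exists_leftApprox h M hM
  have hS := shortEx_mkQ j hj
  exact ⟨Q, Q ⧸ LinearMap.range j, _, _, _, _, j, _, h1, h2, hS, inferInstance,
    (extVan_iff_of_exact hS.inj hS.exact hS.surj h2).2 ⟨hext, hExt⟩, hext⟩

theorem exists_isTranspose [IsNoetherianRing R]
    (M : Type u) [AddCommGroup M] [Module R M] [Module.Finite R M] :
    ∃ N : ModuleCat.{u} S, IsTranspose R S U (ModuleCat.of R M) N := by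
  obtain ⟨n, g, hg⟩ := Module.Finite.exists_fin' R M
  obtain ⟨m, π, hπ⟩ := Module.Finite.exists_fin' R (LinearMap.ker g)
  refine ⟨ModuleCat.of S (((Fin m → R) →ₗ[R] U) ⧸
    LinearMap.range (LinearMap.lcomp S U ((LinearMap.ker g).subtype ∘ₗ π))),
    ModuleCat.of R (Fin m → R), ModuleCat.of R (Fin n → R), (LinearMap.ker g).subtype ∘ₗ π, g,
    inferInstanceAs (Module.Finite R (Fin m → R)),
    inferInstanceAs (Module.Projective R (Fin m → R)),
    inferInstanceAs (Module.Finite R (Fin n → R)),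
    inferInstanceAs (Module.Projective R (Fin n → R)), ?_, hg, ⟨LinearEquiv.refl _ _⟩⟩
  intro x
  rw [LinearMap.coe_comp, hπ.range_comp]
  exact LinearMap.exact_subtype_ker_map g x

/-- If all modules in `⊥U` are torsionless, then they are Gorenstein projective. -/
theorem isGPAux_of_torsionless [IsNoetherianRing R] [IsNoetherianRing S] {u : U}
    (h : IsRegular R S u)
    (ht : ∀ (M : Type u) [AddCommGroup M] [Module R M] [Module.Finite R M], ExtVan R M U →
      Torsionless U R M)
    (M : ModuleCat.{u} R) (hfin : Module.Finite R M) (hExt : ExtVan R M U) :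
    IsGPAux R S U M := by
  obtain ⟨N, hN⟩ := exists_isTranspose (R := R) (S := S) (U := U) M
  refine ⟨hfin, hExt, N, hN, ?_⟩
  -- The coinductive class is that of all transposes of modules in `⊥U`.
  refine extVan_of_coinduction (R := S) (U := U) (fun N _ _ => ∃ M : ModuleCat.{u} R,
    Module.Finite R M ∧ ExtVan R M U ∧ IsTranspose R S U M (ModuleCat.of S N)) ?_ N
    ⟨M, hfin, hExt, hN⟩
  clear hN N hfin hExt M
  rintro N _ _ ⟨M, hfin, hExt, P₁, P₀, f, g, hP₁, hP₁', hP₀, hP₀', hfg, hg, ⟨ε⟩⟩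
  obtain ⟨Q, C, _, _, _, _, j, q, hQ, hQ', hS, hC, hCE, hext⟩ :=
    exists_leftApprox_extVan h M (ht M hExt) hExt
  let F := LinearMap.lcomp S U f
  -- `D` is the transpose of `C` for the presentation `P₀ → Q → C → 0`. Maps `M → U` extend along
  -- `j`, so the image of `Hom(Q, U)` in `Hom(P₀, U)` is that of `Hom(M, U)`, the kernel of `F`.
  -- Hence `D` embeds in `Hom(P₁, U)` with cokernel `N`.
  let D : Type u := (P₀ →ₗ[R] U) ⧸ LinearMap.range (LinearMap.lcomp S U (j ∘ₗ g))
  have hr : LinearMap.range (LinearMap.lcomp S U (j ∘ₗ g)) = LinearMap.ker F := by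
    ext ψ
    rw [LinearMap.mem_ker, lcomp_exact hfg hg ψ]
    constructor
    · rintro ⟨χ, rfl⟩
      exact ⟨χ ∘ₗ j, rfl⟩
    · rintro ⟨φ, rfl⟩
      obtain ⟨χ, rfl⟩ := hext φ
      exact ⟨χ, rfl⟩
  let f' : D →ₗ[S] (P₁ →ₗ[R] U) := Submodule.liftQ _ F hr.le
  have hf' : ∀ ψ, f' (Submodule.Quotient.mk ψ) = F ψ := fun ψ => rfl
  refine ⟨D, P₁ →ₗ[R] U, _, _, _, _, f', ε.symm.toLinearMap ∘ₗ (LinearMap.range F).mkQ,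
    h.projective_dual, ?_, ?_, ?_, ?_, ?_⟩
  · rw [← LinearMap.ker_eq_bot]
    exact Submodule.ker_liftQ_eq_bot _ _ _ hr.ge
  · intro ψ
    rw [LinearMap.comp_apply, LinearEquiv.coe_coe, LinearEquiv.map_eq_zero_iff,
      Submodule.mkQ_apply, Submodule.Quotient.mk_eq_zero]
    constructor
    · rintro ⟨χ, rfl⟩
      exact ⟨Submodule.Quotient.mk χ, rfl⟩
    · rintro ⟨x, rfl⟩
      obtain ⟨χ, rfl⟩ := Submodule.Quotient.mk_surjective _ x
      exact ⟨χ, rfl⟩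
  · exact ε.symm.surjective.comp (Submodule.mkQ_surjective _)
  · intro κ
    -- On `Hom(P₀, U)` the map `κ` is evaluation at `p`. It kills `Hom(M, U)`, so `g p = 0` because
    -- `M` is torsionless; then `p = f x`, and evaluation at `x` extends `κ`.
    obtain ⟨p, hp⟩ := h.bijective_ev.2 (κ ∘ₗ (LinearMap.range
      (LinearMap.lcomp S U (j ∘ₗ g))).mkQ)
    have hp' : ∀ ψ : P₀ →ₗ[R] U, κ (Submodule.Quotient.mk ψ) = ψ p :=
      fun ψ => (LinearMap.congr_fun hp ψ).symm
    have hgp : g p = 0 := ht M hExt _ fun φ => by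
      obtain ⟨χ, rfl⟩ := hext φ
      have := hp' (χ ∘ₗ j ∘ₗ g)
      have hz : (Submodule.Quotient.mk (χ ∘ₗ j ∘ₗ g) : D) = 0 :=
        (Submodule.Quotient.mk_eq_zero _).2 ⟨χ, rfl⟩
      rw [hz, map_zero] at this
      exact this.symm
    obtain ⟨x, rfl⟩ := (hfg p).1 hgp
    refine ⟨ev R S U P₁ x, ?_⟩
    refine LinearMap.ext fun y => ?_
    obtain ⟨ψ, rfl⟩ := Submodule.Quotient.mk_surjective _ y
    exact (hp' ψ).symm
  · refine ⟨ModuleCat.of R C, hC, hCE, P₀, ModuleCat.of R Q, j ∘ₗ g, q, hP₀, hP₀', hQ, hQ', ?_,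
      hS.surj, ⟨LinearEquiv.refl _ _⟩⟩
    intro x
    rw [LinearMap.coe_comp, hg.range_comp]
    exact hS.exact x

/-- Gorenstein projective modules are reflexive. -/
theorem IsGPAux.bijective_ev {u : U} (h : IsRegular R S u) {M : ModuleCat.{u} R}
    (hM : IsGPAux R S U M) : Function.Bijective (ev R S U M) := by
  obtain ⟨hfin, hExt, N, ⟨P₁, P₀, f, g, hP₁, hP₁', hP₀, hP₀', hfg, hg, ⟨ε⟩⟩, hN⟩ := hM
  let F := LinearMap.lcomp S U f
  have hS₁ : ShortEx (LinearMap.range F).subtype (LinearMap.range F).mkQ :=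
    ⟨Subtype.val_injective, LinearMap.exact_subtype_mkQ _, Submodule.mkQ_surjective _⟩
  have hcok : ExtVan S ((P₁ →ₗ[R] U) ⧸ LinearMap.range F) U :=
    ExtVan.of_retract ε.symm.toLinearMap ε.toLinearMap (by ext x; simp) hN
  -- Here `e1` expresses `Ext^1(N, U) = 0` and yields injectivity of `ev`; `e3` below expresses
  -- `Ext^2(N, U) = 0` and yields surjectivity.
  obtain ⟨e1, e2⟩ := (extVan_iff_of_exact hS₁.inj hS₁.exact hS₁.surj h.projective_dual).1 hcok
  have hS₂ : ShortEx (LinearMap.lcomp S U g) F.rangeRestrict := by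
    refine ⟨lcomp_injective_of_surjective hg, fun ψ => ?_, F.surjective_rangeRestrict⟩
    rw [← lcomp_exact hfg hg ψ, ← Subtype.val_inj]
    rfl
  obtain ⟨e3, -⟩ := (extVan_iff_of_exact hS₂.inj hS₂.exact hS₂.surj h.projective_dual).1 e2
  constructor
  · rw [injective_iff_map_eq_zero]
    intro m hm
    obtain ⟨p, rfl⟩ := hg m
    obtain ⟨c, hc⟩ := exists_desc_of_exact hS₂.exact hS₂.surj (ev R S U P₀ p) (by
      ext φ; exact LinearMap.congr_fun hm φ)
    obtain ⟨d, rfl⟩ := e1 c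
    obtain ⟨q, rfl⟩ := h.bijective_ev.2 d
    have : p = f q := h.bijective_ev.1 (by
      ext ψ; exact (LinearMap.congr_fun hc ψ).symm)
    rw [this]
    exact hfg.apply_apply_eq_zero q
  · intro G
    obtain ⟨H, rfl⟩ := e3 G
    obtain ⟨p, rfl⟩ := h.bijective_ev.2 H
    exact ⟨g p, rfl⟩

theorem IsSecondSyzygy.of_equiv {M N : ModuleCat.{u} R} (e : M ≃ₗ[R] N) (h : IsSecondSyzygy N) :
    IsSecondSyzygy M := by
  obtain ⟨P, Q, _, _, _, _, f, g, h1, h2, h3, h4, h5, h6⟩ := h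
  refine ⟨P, Q, _, _, _, _, f ∘ₗ e.toLinearMap, g, h1, h2, h3, h4, h5.comp e.injective, ?_⟩
  intro x
  rw [LinearMap.coe_comp, LinearEquiv.coe_coe, e.surjective.range_comp]
  exact h6 x

/-- A reflexive module is the dual of its finitely generated dual, and duals are second syzygies. -/
theorem IsGPAux.isSecondSyzygy [IsNoetherianRing S] {u : U} (h : IsRegular R S u)
    {M : ModuleCat.{u} R} (hM : IsGPAux R S U M) : IsSecondSyzygy M := by
  have := hM.1
  have hfin : Module.Finite S (M →ₗ[R] U) := h.finite_dual
  obtain ⟨N, hN, hs⟩ := exists_isSyzygyOf (ModuleCat.of S (M →ₗ[R] U)) hfin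
  exact (isSecondSyzygy_dual h.symm hs hN).of_equiv
    (LinearEquiv.ofBijective _ (hM.bijective_ev h))

end Weakly

/-! ### Vector space duality, expressed through perfect pairings. -/

section KDuality

variable {K R S : Type u} [Field K] [Ring R] [Ring S] [Algebra K R] [Algebra K S]

/-- An anti-isomorphism of `K`-algebras. -/
structure IsAnti (K : Type u) {R S : Type u} [Field K] [Ring R] [Ring S] [Algebra K R]
    [Algebra K S] (τ : R ≃ S) : Prop where
  add : ∀ a b, τ (a + b) = τ a + τ b
  mul : ∀ a b, τ (a * b) = τ b * τ a
  one : τ 1 = 1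
  smul : ∀ (k : K) a, τ (k • a) = k • τ a

theorem IsAnti.symm {τ : R ≃ S} (h : IsAnti K τ) : IsAnti K τ.symm where
  add a b := by rw [Equiv.symm_apply_eq, h.add]; simp
  mul a b := by rw [Equiv.symm_apply_eq, h.mul]; simp
  one := by rw [Equiv.symm_apply_eq, h.one]
  smul k a := by rw [Equiv.symm_apply_eq, h.smul]; simp

variable {M N M' N' M'' N'' : Type u}
  [AddCommGroup M] [Module R M] [Module K M] [IsScalarTower K R M]
  [AddCommGroup N] [Module S N] [Module K N] [IsScalarTower K S N]
  [AddCommGroup M'] [Module R M'] [Module K M'] [IsScalarTower K R M']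
  [AddCommGroup N'] [Module S N'] [Module K N'] [IsScalarTower K S N']
  [AddCommGroup M''] [Module R M''] [Module K M''] [IsScalarTower K R M'']
  [AddCommGroup N''] [Module S N''] [Module K N''] [IsScalarTower K S N'']

/-- A perfect pairing between an `R`-module and an `S`-module. -/
structure IsDualPair (τ : R ≃ S) (β : M →ₗ[K] N →ₗ[K] K) : Prop where
  smul : ∀ (r : R) m n, β (r • m) n = β m (τ r • n)
  left : Function.Bijective β
  right : Function.Bijective β.flip

theorem IsDualPair.symm {τ : R ≃ S} {β : M →ₗ[K] N →ₗ[K] K} (h : IsDualPair τ β) :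
    IsDualPair τ.symm β.flip where
  smul s n m := by simp [h.smul]
  left := h.right
  right := h.left

theorem IsDualPair.left_ext {τ : R ≃ S} {β : M →ₗ[K] N →ₗ[K] K} (h : IsDualPair τ β) {m m' : M}
    (hm : ∀ n, β m n = β m' n) : m = m' := h.left.1 (LinearMap.ext hm)

theorem IsDualPair.right_ext {τ : R ≃ S} {β : M →ₗ[K] N →ₗ[K] K} (h : IsDualPair τ β) {n n' : N}
    (hn : ∀ m, β m n = β m n') : n = n' := h.right.1 (LinearMap.ext hn)

theorem IsDualPair.exists_right {τ : R ≃ S} {β : M →ₗ[K] N →ₗ[K] K} (h : IsDualPair τ β)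
    (φ : M →ₗ[K] K) : ∃ n, ∀ m, β m n = φ m := by
  obtain ⟨n, rfl⟩ := h.right.2 φ
  exact ⟨n, fun _ => rfl⟩

/-- The maps `f : M → M'` and `g : N' → N` are adjoint with respect to the pairings. -/
def Adj (β : M →ₗ[K] N →ₗ[K] K) (β' : M' →ₗ[K] N' →ₗ[K] K) (f : M →ₗ[R] M')
    (g : N' →ₗ[S] N) : Prop :=
  ∀ m n, β' (f m) n = β m (g n)

variable {τ : R ≃ S} {β : M →ₗ[K] N →ₗ[K] K} {β' : M' →ₗ[K] N' →ₗ[K] K}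
  {β'' : M'' →ₗ[K] N'' →ₗ[K] K}

theorem Adj.symm {f : M →ₗ[R] M'} {g : N' →ₗ[S] N} (h : Adj β β' f g) :
    Adj β'.flip β.flip g f := fun n m => (h m n).symm

theorem Adj.comp {f : M →ₗ[R] M'} {g : N' →ₗ[S] N} {f' : M' →ₗ[R] M''} {g' : N'' →ₗ[S] N'}
    (h : Adj β β' f g) (h' : Adj β' β'' f' g') : Adj β β'' (f' ∘ₗ f) (g ∘ₗ g') :=
  fun m n => (h' (f m) n).trans (h m (g' n))

theorem Adj.unique_left (h' : IsDualPair τ β') {f f' : M →ₗ[R] M'} {g : N' →ₗ[S] N}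
    (hf : Adj β β' f g) (hf' : Adj β β' f' g) : f = f' := by
  ext m
  exact h'.left_ext fun n => (hf m n).trans (hf' m n).symm

theorem Adj.unique_right (h : IsDualPair τ β) {f : M →ₗ[R] M'} {g g' : N' →ₗ[S] N}
    (hf : Adj β β' f g) (hf' : Adj β β' f g') : g = g' := by
  ext n
  exact h.right_ext fun m => (hf m n).symm.trans (hf' m n)

theorem adj_id : Adj β β (LinearMap.id : M →ₗ[R] M) (LinearMap.id : N →ₗ[S] N) :=
  fun _ _ => rfl

theorem exists_adj_right (h : IsDualPair τ β) (h' : IsDualPair τ β') (f : M →ₗ[R] M') :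
    ∃ g : N' →ₗ[S] N, Adj β β' f g := by
  choose g hg using fun n => h.exists_right (β'.flip n ∘ₗ f.restrictScalars K)
  have hg : ∀ n m, β m (g n) = β' (f m) n := hg
  refine ⟨⟨⟨g, fun x y => h.right_ext fun m => ?_⟩, fun s x => h.right_ext fun m => ?_⟩,
    fun m n => (hg n m).symm⟩
  · simp only [hg, map_add]
  · obtain ⟨r, rfl⟩ := τ.surjective s
    simp only [RingHom.id_apply]
    rw [hg, ← h'.smul, ← h.smul, hg, f.map_smul]

theorem exists_adj_left (h : IsDualPair τ β) (h' : IsDualPair τ β') (g : N' →ₗ[S] N) :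
    ∃ f : M →ₗ[R] M', Adj β β' f g := by
  obtain ⟨f, hf⟩ := exists_adj_right h'.symm h.symm g
  exact ⟨f, fun m n => (hf n m).symm⟩

theorem Adj.surjective (h : IsDualPair τ β) (h' : IsDualPair τ β') {f : M →ₗ[R] M'}
    {g : N' →ₗ[S] N} (hfg : Adj β β' f g) (hf : Function.Injective f) :
    Function.Surjective g := by
  intro n
  -- The splitting is only `K`-linear, which suffices to extend functionals.
  obtain ⟨l, hl⟩ := (f.restrictScalars K).exists_leftInverse_of_injective
    (LinearMap.ker_eq_bot.2 hf)
  obtain ⟨n', hn'⟩ := h'.exists_right (β.flip n ∘ₗ l)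
  refine ⟨n', h.right_ext fun m => ?_⟩
  rw [← hfg, hn']
  have : l (f m) = m := LinearMap.congr_fun hl m
  simp [this]

theorem Adj.injective (h' : IsDualPair τ β') {f : M →ₗ[R] M'}
    {g : N' →ₗ[S] N} (hfg : Adj β β' f g) (hf : Function.Surjective f) :
    Function.Injective g := by
  intro x y hxy
  refine h'.right_ext fun m => ?_
  obtain ⟨m, rfl⟩ := hf m
  rw [hfg, hfg, hxy]

theorem Adj.shortEx (h : IsDualPair τ β) (h' : IsDualPair τ β') (h'' : IsDualPair τ β'')
    {f : M →ₗ[R] M'} {g : N' →ₗ[S] N} {f' : M' →ₗ[R] M''} {g' : N'' →ₗ[S] N'}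
    (hfg : Adj β β' f g) (hfg' : Adj β' β'' f' g') (hS : ShortEx f f') : ShortEx g' g := by
  refine ⟨hfg'.injective h'' hS.surj, fun n => ⟨fun hn => ?_, ?_⟩, hfg.surjective h h' hS.inj⟩
  · have hexK : Function.Exact (f.restrictScalars K) (f'.restrictScalars K) := hS.exact
    obtain ⟨c, hc⟩ := exists_desc_of_exact hexK hS.surj (β'.flip n) (by
      ext m
      change β' (f m) n = 0
      rw [hfg, hn, map_zero])
    obtain ⟨x, hx⟩ := h''.exists_right c
    refine ⟨x, h'.right_ext fun m => ?_⟩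
    rw [← hfg', hx]
    exact LinearMap.congr_fun hc m
  · rintro ⟨x, rfl⟩
    refine h.right_ext fun m => ?_
    rw [← hfg, ← hfg', hS.exact.apply_apply_eq_zero]
    simp

/-- The dual space of a finite dimensional `S`-module. -/
theorem exists_dualPair (hτ : IsAnti K τ) (N : Type u) [AddCommGroup N] [Module S N] [Module K N]
    [IsScalarTower K S N] [Module.Finite K N] :
    ∃ (M : Type u) (_ : AddCommGroup M) (_ : Module R M) (_ : Module K M)
      (_ : IsScalarTower K R M) (_ : Module.Finite K M) (β : M →ₗ[K] N →ₗ[K] K),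
      IsDualPair τ β := by
  let i : Module R (N →ₗ[K] K) :=
    { smul := fun r φ => φ ∘ₗ Algebra.lsmul K K N (τ r)
      one_smul := fun φ => by
        ext n; change φ (τ 1 • n) = φ n; rw [hτ.one, one_smul]
      mul_smul := fun a b φ => by
        ext n; change φ (τ (a * b) • n) = φ (τ b • τ a • n); rw [hτ.mul, mul_smul]
      smul_zero := fun _ => rfl
      smul_add := fun _ _ _ => rfl
      add_smul := fun a b φ => by
        ext n
        change φ (τ (a + b) • n) = φ (τ a • n) + φ (τ b • n)
        rw [hτ.add, add_smul, map_add]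
      zero_smul := fun φ => by
        have h0 : τ 0 = 0 := by
          have := hτ.add 0 0
          simpa using this
        ext n; change φ (τ 0 • n) = 0; rw [h0, zero_smul, map_zero] }
  have hi : IsScalarTower K R (N →ₗ[K] K) := ⟨fun k r φ => by
    ext n
    change φ (τ (k • r) • n) = k • φ (τ r • n)
    rw [hτ.smul, smul_assoc, map_smul]⟩
  refine ⟨N →ₗ[K] K, inferInstance, i, inferInstance, hi, inferInstance, LinearMap.id,
    fun _ _ _ => rfl, Function.bijective_id, ?_⟩
  exact Module.bijective_dual_eval K N

theorem exists_dualPair' (hτ : IsAnti K τ) (M : Type u) [AddCommGroup M] [Module R M] [Module K M]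
    [IsScalarTower K R M] [Module.Finite K M] :
    ∃ (N : Type u) (_ : AddCommGroup N) (_ : Module S N) (_ : Module K N)
      (_ : IsScalarTower K S N) (_ : Module.Finite K N) (β : M →ₗ[K] N →ₗ[K] K),
      IsDualPair τ β := by
  obtain ⟨N, _, _, _, _, h, β, hβ⟩ := exists_dualPair hτ.symm M
  exact ⟨N, _, _, _, ‹_›, h, β.flip, hβ.symm⟩

/-- Baer's criterion: dualizing turns the extension problem for `I ≤ R` into a lifting problem out
of the projective module `N`. -/
theorem IsDualPair.injective (hτ : IsAnti K τ) (h : IsDualPair τ β) [Module.Finite K R]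
    [Module.Projective S N] : Module.Injective R M := by
  apply Module.Baer.injective
  intro I g
  obtain ⟨DI, _, _, _, _, _, γ, hγ⟩ := exists_dualPair' hτ I
  obtain ⟨DR, _, _, _, _, _, δ, hδ⟩ := exists_dualPair' hτ R
  obtain ⟨ι, hι⟩ := exists_adj_right hγ hδ (Submodule.subtype I)
  obtain ⟨g', hg'⟩ := exists_adj_right hγ h g
  obtain ⟨k, hk⟩ := Module.projective_lifting_property ι g'
    (hι.surjective hγ hδ Subtype.val_injective)
  obtain ⟨G, hG⟩ := exists_adj_left hδ h k
  refine ⟨G, fun x hx => ?_⟩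
  have := Adj.unique_left h (hk ▸ hι.comp hG) hg'
  exact LinearMap.congr_fun this ⟨x, hx⟩

theorem exists_section_of_injective {X Y : Type u} [AddCommGroup X] [Module R X] [AddCommGroup Y]
    [Module R Y] (hX : Module.Injective R X) (f : X →ₗ[R] Y) (hf : Function.Injective f) :
    ∃ r : Y →ₗ[R] X, r ∘ₗ f = LinearMap.id := by
  obtain ⟨r, hr⟩ := hX.out f hf LinearMap.id
  exact ⟨r, LinearMap.ext hr⟩

theorem IsDualPair.projective (hτ : IsAnti K τ) (h : IsDualPair τ β) [Module.Finite K S]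
    (hM : Module.Injective R M) [Module.Finite S N] : Module.Projective S N := by
  obtain ⟨n, g, hg⟩ := Module.Finite.exists_fin' S N
  obtain ⟨DF, _, _, _, _, _, γ, hγ⟩ := exists_dualPair hτ (Fin n → S)
  obtain ⟨f, hf⟩ := exists_adj_left h hγ g
  obtain ⟨r, hr⟩ := exists_section_of_injective hM f (hf.symm.injective h.symm hg)
  obtain ⟨s, hs⟩ := exists_adj_right hγ h r
  refine Module.Projective.of_split s g ?_
  exact Adj.unique_right h (hr ▸ hf.comp hs) adj_id

variable {V W : Type u}
  [AddCommGroup V] [Module R V] [Module K V] [IsScalarTower K R V]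
  [AddCommGroup W] [Module S W] [Module K W] [IsScalarTower K S W]
  {γ : V →ₗ[K] W →ₗ[K] K}

/-- `Ext^i(V, M) = 0` if and only if `Ext^i(N, W) = 0`, for dual modules `V`, `W` and `M`, `N`. -/
theorem IsDualPair.extZero_iff (hτ : IsAnti K τ) [Module.Finite K R] [Module.Finite K S]
    (hV : IsDualPair τ γ) (i : ℕ) {M N : Type u}
    [AddCommGroup M] [Module R M] [Module K M] [IsScalarTower K R M]
    [AddCommGroup N] [Module S N] [Module K N] [IsScalarTower K S N]
    {β : M →ₗ[K] N →ₗ[K] K} (h : IsDualPair τ β) [Module.Finite S N] :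
    ExtZero R V M (i + 1) ↔ ExtZero S N W (i + 1) := by
  induction i generalizing M N with
  | zero => ?_
  | succ i ih => ?_
  -- In both cases a free presentation of `N` dualizes to `0 → M → DF → DL → 0` with `DF` injective.
  -- Extension problems out of the kernel match lifting problems into `DL`, and dimension shifting
  -- proceeds on both sides in parallel.
  all_goals
    obtain ⟨n, g, hg⟩ := Module.Finite.exists_fin' S N
    have hS := shortEx_ker g hg
    have hfd : Module.Finite K (LinearMap.ker g) :=
      inferInstanceAs (Module.Finite K ((LinearMap.ker g).restrictScalars K))
    have hfs : Module.Finite S (LinearMap.ker g) := Module.Finite.of_restrictScalars_finite K S _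
    obtain ⟨DF, _, _, _, _, _, δ, hδ⟩ := exists_dualPair hτ (Fin n → S)
    obtain ⟨DL, _, _, _, _, _, ε, hε⟩ := exists_dualPair hτ (LinearMap.ker g)
    obtain ⟨a, ha⟩ := exists_adj_left h hδ g
    obtain ⟨b, hb⟩ := exists_adj_left hδ hε (LinearMap.ker g).subtype
    have hD : ShortEx a b := Adj.shortEx hε.symm hδ.symm h.symm hb.symm ha.symm hS
    have hinj : Module.Injective R DF := hδ.injective hτ
  · rw [extZero_one_iff_lift hD.inj hD.exact hD.surj hinj,
      extZero_one_iff_extend hS.inj hS.exact hS.surj inferInstance]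
    constructor
    · intro H φ
      obtain ⟨φ', hφ⟩ := exists_adj_left hV hε φ
      obtain ⟨ψ', hψ'⟩ := H φ'
      obtain ⟨ψ, hψ⟩ := exists_adj_right hV hδ ψ'
      exact ⟨ψ, Adj.unique_right hV (hψ' ▸ hψ.comp hb) hφ⟩
    · intro H φ
      obtain ⟨φ', hφ⟩ := exists_adj_right hV hε φ
      obtain ⟨ψ', hψ'⟩ := H φ'
      obtain ⟨ψ, hψ⟩ := exists_adj_left hV hδ ψ'
      exact ⟨ψ, Adj.unique_left hε (hψ.comp hb) (hψ' ▸ hφ)⟩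
  · rw [extZero_succ_iff' hD.inj hD.exact hD.surj hinj,
      extZero_succ_iff hS.inj hS.exact hS.surj inferInstance]
    exact ih hε

theorem IsDualPair.indec (h : IsDualPair τ β) (hN : Indec S N) : Indec R M := by
  refine ⟨?_, fun e he => ?_⟩
  · by_contra hM
    rw [not_nontrivial_iff_subsingleton] at hM
    have := hN.1
    obtain ⟨x, y, hxy⟩ := exists_pair_ne N
    exact hxy (h.right_ext fun m => by rw [Subsingleton.elim m 0]; simp)
  · obtain ⟨f, hf⟩ := exists_adj_right h h e
    have : f ∘ₗ f = f := Adj.unique_right h (hf.comp hf) (he.symm ▸ hf)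
    rcases hN.2 f this with rfl | rfl
    · left
      exact Adj.unique_left h hf (fun m n => by simp)
    · right
      exact Adj.unique_left h hf adj_id

theorem IsDualPair.equiv (h : IsDualPair τ β) (h' : IsDualPair τ β') (e : M ≃ₗ[R] M') :
    Nonempty (N ≃ₗ[S] N') := by
  obtain ⟨f, hf⟩ := exists_adj_right h h' e.toLinearMap
  obtain ⟨g, hg⟩ := exists_adj_right h' h e.symm.toLinearMap
  refine ⟨LinearEquiv.ofLinearMap g f ?_ ?_⟩
  · have := hg.comp hf
    rw [LinearEquiv.comp_symm] at this
    exact Adj.unique_right h' this adj_id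
  · have := hf.comp hg
    rw [LinearEquiv.symm_comp] at this
    exact Adj.unique_right h this adj_id

/-- Duality preserves representation-finiteness. -/
theorem IsRepFiniteClass.dual {C : ModuleCat.{u} R → Prop} {C' : ModuleCat.{u} S → Prop}
    (hC : IsRepFiniteClass C)
    (H : ∀ N : ModuleCat.{u} S, C' N → ∃ (M : Type u) (_ : AddCommGroup M) (_ : Module R M)
      (_ : Module K M) (_ : IsScalarTower K R M) (β : M →ₗ[K] N →ₗ[K] K), IsDualPair τ β ∧
      C (ModuleCat.of R M)) : IsRepFiniteClass C' := by
  classical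
  obtain ⟨n, X, hX⟩ := hC
  let Q : Fin n → ModuleCat.{u} S → Prop := fun i N => ∃ (M : Type u) (_ : AddCommGroup M)
    (_ : Module R M) (_ : Module K M) (_ : IsScalarTower K R M) (β : M →ₗ[K] N →ₗ[K] K),
    IsDualPair τ β ∧ Nonempty (ModuleCat.of R M ≅ X i)
  -- `PUnit` fills the indices whose module is not the dual of any `S`-module; these are never
  -- selected.
  refine ⟨n, fun i => if h : ∃ N, Q i N then h.choose else ModuleCat.of S PUnit,
    fun N hN hI => ?_⟩
  obtain ⟨M, _, _, _, _, β, hβ, hM⟩ := H N hN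
  obtain ⟨i, ⟨e⟩⟩ := hX _ hM ((indecomposable_iff _).2
    (hβ.indec ((indecomposable_iff _).1 hI)))
  have hQ : ∃ N, Q i N := ⟨N, M, _, _, _, ‹_›, β, hβ, ⟨e⟩⟩
  refine ⟨i, ?_⟩
  simp only [dif_pos hQ]
  obtain ⟨M', _, _, _, _, β', hβ', ⟨e'⟩⟩ := hQ.choose_spec
  obtain ⟨ε⟩ := hβ.equiv hβ' (e ≪≫ e'.symm).toLinearEquiv
  exact ⟨ε.toModuleIso⟩

end KDuality

/-! ### Application to a finite dimensional algebra: the representation-finite and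
torsionless-finite cases. -/

section Concrete

theorem isFirstSyzygy_iff {R : Type u} [Ring R] (M : ModuleCat.{u} R) :
    IsFirstSyzygy M ↔ Module.Finite R M ∧ ∃ (P : Type u) (_ : AddCommGroup P) (_ : Module R P)
      (f : M →ₗ[R] P), Module.Finite R P ∧ Module.Projective R P ∧ Function.Injective f := by
  constructor
  · rintro ⟨P, N, f, g, h1, h2, h3, hf, -, -⟩
    exact ⟨h1, P, _, _, f, h2, h3, hf⟩
  · rintro ⟨h1, P, _, _, f, h2, h3, hf⟩
    have hS := shortEx_mkQ f hf
    exact ⟨ModuleCat.of R P, ModuleCat.of R (P ⧸ LinearMap.range f), f, _, h1, h2, h3, hS.inj,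
      hS.exact, hS.surj⟩

theorem finite_of_retract {R M N : Type u} [Ring R] [AddCommGroup M] [Module R M]
    [AddCommGroup N] [Module R N] (f : M →ₗ[R] N) (g : N →ₗ[R] M) (h : g ∘ₗ f = LinearMap.id)
    (hN : Module.Finite R N) : Module.Finite R M :=
  Module.Finite.of_surjective g fun x => ⟨f x, LinearMap.congr_fun h x⟩

theorem injective_of_retract {R M N : Type u} [Ring R] [AddCommGroup M] [Module R M]
    [AddCommGroup N] [Module R N] {f : M →ₗ[R] N} {g : N →ₗ[R] M} (h : g ∘ₗ f = LinearMap.id) :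
    Function.Injective f :=
  Function.LeftInverse.injective (g := g) fun x => LinearMap.congr_fun h x

theorem summandClosed_isFirstSyzygy {R : Type u} [Ring R] :
    SummandClosed (IsFirstSyzygy (R := R)) := by
  intro M N f g hgf hN
  rw [isFirstSyzygy_iff] at hN ⊢
  obtain ⟨h1, P, _, _, j, h2, h3, hj⟩ := hN
  exact ⟨finite_of_retract f g hgf h1, P, _, _, j ∘ₗ f, h2, h3,
    hj.comp (injective_of_retract hgf)⟩

theorem IsSecondSyzygy.isFirstSyzygy {R : Type u} [Ring R] {M : ModuleCat.{u} R}
    (hM : Module.Finite R M) (h : IsSecondSyzygy M) : IsFirstSyzygy M := by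
  rw [isFirstSyzygy_iff]
  obtain ⟨P, Q, _, _, _, _, f, g, h1, h2, h3, h4, h5, h6⟩ := h
  exact ⟨hM, P, _, _, f, h1, h2, h5⟩

variable (K A : Type u) [Field K] [Ring A] [Algebra K A]

theorem isRegular_one : IsRegular Aᵐᵒᵖ A (1 : A) where
  left := by
    convert MulOpposite.unop_bijective (α := A) using 1
    ext r
    exact one_mul _
  right := by
    convert Function.bijective_id (α := A) using 1
    ext r
    exact mul_one _

theorem isAnti_op : IsAnti K (MulOpposite.opEquiv.symm : Aᵐᵒᵖ ≃ A) where
  add _ _ := rfl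
  mul _ _ := rfl
  one := rfl
  smul _ _ := rfl

variable {A}

theorem isDualPair_dualRL [Module.Finite K A] (M : ModuleCat.{u} Aᵐᵒᵖ)
    (hM : Module.Finite Aᵐᵒᵖ M) :
    ∃ β : M →ₗ[K] dualRL K M →ₗ[K] K,
      IsDualPair (MulOpposite.opEquiv.symm : Aᵐᵒᵖ ≃ A) β := by
  have hfin : Module.Finite K M := Module.Finite.trans Aᵐᵒᵖ M
  let i : dualRL K M → (M →ₗ[K] K) := fun n => n
  have hi : ∀ (k : K) (n : dualRL K M) (m : M), i (k • n) m = k * i n m := by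
    intro k n m
    change i n (MulOpposite.op (algebraMap K A k) • m) = _
    exact map_smul (i n) k m
  have ha : ∀ (n n' : dualRL K M) (m : M), i (n + n') m = i n m + i n' m := fun _ _ _ => rfl
  refine ⟨LinearMap.mk₂ K (fun m n => i n m) (fun m m' n => map_add (i n) m m')
    (fun k m n => map_smul (i n) k m) (fun m n n' => ha n n' m) (fun k m n => hi k n m), ?_, ?_, ?_⟩
  · intro r m n
    rfl
  · constructor
    · intro m m' h
      apply (Module.bijective_dual_eval K M).1
      ext φ
      exact LinearMap.congr_fun h φ
    · intro φ
      let ψ : Module.Dual K (Module.Dual K M) :=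
        { toFun := fun n => φ n
          map_add' := fun x y => map_add φ x y
          map_smul' := fun k x => by
            have : (k • x : M →ₗ[K] K) = i (k • (show dualRL K M from x)) := by
              ext m; exact (hi k x m).symm
            rw [this]
            exact map_smul φ k (show dualRL K M from x) }
      obtain ⟨m, hm⟩ := (Module.bijective_dual_eval K M).2 ψ
      exact ⟨m, LinearMap.ext fun n => LinearMap.congr_fun hm n⟩
  · constructor
    · intro n n' h
      exact LinearMap.ext (fun m => LinearMap.congr_fun h m : ∀ m, i n m = i n' m)
    · intro φ
      exact ⟨(show dualRL K M from φ), rfl⟩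

theorem isDualPair_dualLR [Module.Finite K A] (N : ModuleCat.{u} A)
    (hN : Module.Finite A N) :
    ∃ β : dualLR K N →ₗ[K] N →ₗ[K] K,
      IsDualPair (MulOpposite.opEquiv.symm : Aᵐᵒᵖ ≃ A) β := by
  have hfin : Module.Finite K N := Module.Finite.trans A N
  let i : dualLR K N → (N →ₗ[K] K) := fun n => n
  have hi : ∀ (k : K) (n : dualLR K N) (m : N), i (k • n) m = k * i n m := by
    intro k n m
    change i n (algebraMap K A k • m) = _
    exact map_smul (i n) k m
  have ha : ∀ (n n' : dualLR K N) (m : N), i (n + n') m = i n m + i n' m := fun _ _ _ => rfl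
  refine ⟨LinearMap.mk₂ K (fun n m => i n m) (fun n n' m => ha n n' m) (fun k m n => hi k m n)
    (fun n m m' => map_add (i n) m m') (fun k n m => map_smul (i n) k m), ?_, ?_, ?_⟩
  · intro r m n
    rfl
  · constructor
    · intro n n' h
      exact LinearMap.ext (fun m => LinearMap.congr_fun h m : ∀ m, i n m = i n' m)
    · intro φ
      exact ⟨(show dualLR K N from φ), rfl⟩
  · constructor
    · intro m m' h
      apply (Module.bijective_dual_eval K N).1
      ext φ
      exact LinearMap.congr_fun h φ
    · intro φ
      let ψ : Module.Dual K (Module.Dual K N) :=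
        { toFun := fun n => φ n
          map_add' := fun x y => map_add φ x y
          map_smul' := fun k x => by
            have : (k • x : N →ₗ[K] K) = i (k • (show dualLR K N from x)) := by
              ext m; exact (hi k x m).symm
            rw [this]
            exact map_smul φ k (show dualLR K N from x) }
      obtain ⟨m, hm⟩ := (Module.bijective_dual_eval K N).2 ψ
      exact ⟨m, LinearMap.ext fun n => LinearMap.congr_fun hm n⟩

theorem IsDualPair.finite_right {R S : Type u} [Ring R] [Ring S] [Algebra K R] [Algebra K S]
    {M N : Type u} [AddCommGroup M] [Module R M] [Module K M] [IsScalarTower K R M]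
    [AddCommGroup N] [Module S N] [Module K N] [IsScalarTower K S N] {τ : R ≃ S}
    {β : M →ₗ[K] N →ₗ[K] K} (h : IsDualPair τ β) [Module.Finite K R] [Module.Finite R M] :
    Module.Finite S N := by
  have : Module.Finite K M := Module.Finite.trans R M
  have : Module.Finite K N := Module.Finite.of_injective β.flip h.right.1
  exact Module.Finite.of_restrictScalars_finite K S N

variable [Module.Finite K A]

include K in
theorem isArtinianRing_of_finite : IsArtinianRing A := IsArtinianRing.of_finite K A

theorem finite_op : Module.Finite K Aᵐᵒᵖ := Module.Finite.equiv (MulOpposite.opLinearEquiv K)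

theorem extVan_dualLR_iff (L : ModuleCat.{u} A) (hL : Module.Finite A L) {M N : Type u} [AddCommGroup M] [Module Aᵐᵒᵖ M] [Module K M]
    [IsScalarTower K Aᵐᵒᵖ M] [AddCommGroup N] [Module A N] [Module K N] [IsScalarTower K A N]
    {β : M →ₗ[K] N →ₗ[K] K} (h : IsDualPair (MulOpposite.opEquiv.symm : Aᵐᵒᵖ ≃ A) β)
    [Module.Finite A N] :
    ExtVanishes (dualLR K L) (ModuleCat.of Aᵐᵒᵖ M) ↔ ExtVan A N L := by
  have := finite_op K (A := A)
  obtain ⟨γ, hγ⟩ := isDualPair_dualLR K L hL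
  rw [extVan_iff]
  refine Iff.trans (extVan_iff (R := Aᵐᵒᵖ) (M := dualLR K L) (U := M)) (forall_congr' fun i => ?_)
  exact hγ.extZero_iff (isAnti_op K A) i h

theorem inDAPerp_iff (M : ModuleCat.{u} Aᵐᵒᵖ) :
    InDAPerp K M ↔ Module.Finite Aᵐᵒᵖ M ∧ ExtVan A (dualRL K M) A := by
  unfold InDAPerp
  refine and_congr_right fun hM => ?_
  have := finite_op K (A := A)
  obtain ⟨β, hβ⟩ := isDualPair_dualRL K M hM
  have := hβ.finite_right
  exact extVan_dualLR_iff K (leftReg A) (inferInstanceAs (Module.Finite A A)) hβ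

include K in
theorem isLeftNearlyGorenstein_of_torsionless
    (ht : ∀ (M : Type u) [AddCommGroup M] [Module Aᵐᵒᵖ M] [Module.Finite Aᵐᵒᵖ M],
      ExtVan Aᵐᵒᵖ M A → Torsionless A Aᵐᵒᵖ M) : IsLeftNearlyGorenstein A := by
  have := finite_op K (A := A)
  have := isArtinianRing_of_finite K (A := A)
  have := isArtinianRing_of_finite K (A := Aᵐᵒᵖ)
  exact fun M => ⟨fun h => ⟨h.1, h.2.1⟩,
    fun h => isGPAux_of_torsionless (isRegular_one A) ht M h.1 h.2⟩

theorem isRightNearlyGorenstein_of_torsionless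
    (ht : ∀ (M : Type u) [AddCommGroup M] [Module A M] [Module.Finite A M],
      ExtVan A M A → Torsionless A A M) : IsRightNearlyGorenstein K A := by
  have := finite_op K (A := A)
  have := isArtinianRing_of_finite K (A := A)
  have := isArtinianRing_of_finite K (A := Aᵐᵒᵖ)
  intro M
  rw [inDAPerp_iff]
  refine and_congr_right fun hM => ⟨fun h => h.2.1, fun h => ?_⟩
  obtain ⟨β, hβ⟩ := isDualPair_dualRL K M hM
  have := hβ.finite_right
  exact isGPAux_of_torsionless (isRegular_one A).symm ht _ this h

/-- Right modules are handled by the first criterion and left modules by the dual one, so a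
finiteness assumption on right modules alone controls both halves. -/
theorem isNearlyGorenstein_of_finiteNonproj {C : ModuleCat.{u} Aᵐᵒᵖ → Prop} (hC : SummandClosed C)
    (hfin : FiniteNonproj C)
    (hsub : ∀ X : ModuleCat.{u} Aᵐᵒᵖ, Module.Finite Aᵐᵒᵖ X → IsSecondSyzygy X → C X) :
    IsNearlyGorenstein K A := by
  have := finite_op K (A := A)
  have := isArtinianRing_of_finite K (A := A)
  have := isArtinianRing_of_finite K (A := Aᵐᵒᵖ)
  refine ⟨isLeftNearlyGorenstein_of_torsionless K fun M _ _ _ h => ?_,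
    isRightNearlyGorenstein_of_torsionless K fun M _ _ _ h => ?_⟩
  · exact torsionless_of_finite (isRegular_one A) hC hfin (fun X h1 _ h3 => hsub X h1 h3) M h
  · exact torsionless_of_finite_dual (isRegular_one A).symm hC hfin hsub M h

theorem isNearlyGorenstein_of_isRepFiniteClass (h1 : IsRepFiniteClass (InPerpA (A := A)))
    (h2 : IsRepFiniteClass (InDAPerp K (A := A))) : IsNearlyGorenstein K A := by
  have := finite_op K (A := A)
  have := isArtinianRing_of_finite K (A := A)
  have := isArtinianRing_of_finite K (A := Aᵐᵒᵖ)
  refine ⟨isLeftNearlyGorenstein_of_torsionless K fun M _ _ _ h => ?_,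
    isRightNearlyGorenstein_of_torsionless K fun M _ _ _ h => ?_⟩
  · refine torsionless_of_finite (isRegular_one A) (C := InPerpA) ?_ (h1.mono fun M hM => hM.1)
      (fun X h1 h2 _ => ⟨h1, h2⟩) M h
    exact fun M N f g hgf hN => ⟨finite_of_retract f g hgf hN.1,
      ExtVan.of_retract f g hgf hN.2⟩
  · let C : ModuleCat.{u} A → Prop := fun N => Module.Finite A N ∧ ExtVan A N A
    -- `C` is the left module version of `⊥A`; duality identifies it with `D(A)^⊥`.
    have hrep : IsRepFiniteClass C := by
      refine h2.dual (τ := (MulOpposite.opEquiv.symm : Aᵐᵒᵖ ≃ A)) (K := K) fun N hN => ?_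
      obtain ⟨hN1, hN2⟩ := hN
      have : Module.Finite K N := Module.Finite.trans A N
      obtain ⟨M, _, _, _, _, _, β, hβ⟩ := exists_dualPair (isAnti_op K A) N
      exact ⟨M, _, _, _, ‹_›, β, hβ, Module.Finite.of_restrictScalars_finite K Aᵐᵒᵖ M,
        (extVan_dualLR_iff K (leftReg A) (inferInstanceAs (Module.Finite A A)) hβ).2 hN2⟩
    refine torsionless_of_finite (isRegular_one A).symm (C := C) ?_ (hrep.mono fun M hM => hM.1)
      (fun X h1 h2 _ => ⟨h1, h2⟩) M h
    exact fun M N f g hgf hN => ⟨finite_of_retract f g hgf hN.1, hN.2.of_retract f g hgf⟩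

theorem isNearlyGorenstein_of_isTorsionlessFinite (h : IsTorsionlessFinite A) :
    IsNearlyGorenstein K A :=
  isNearlyGorenstein_of_finiteNonproj K summandClosed_isFirstSyzygy (h.mono fun _ hM => hM.1)
    fun _ h1 h2 => h2.isFirstSyzygy h1

theorem isNearlyGorenstein_of_isRepFinite (h : IsRepFinite A) : IsNearlyGorenstein K A :=
  isNearlyGorenstein_of_isTorsionlessFinite K (h.mono fun M hM => ((isFirstSyzygy_iff M).1 hM).1)

end Concrete

/-! ### Transfer of representation-finiteness between rings. -/

section RepFiniteTransfer

/-- Representation-finiteness is reflected by assignments on objects that preserve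
indecomposability and reflect isomorphism. -/
theorem IsRepFiniteClass.of_map {R S : Type u} [Ring R] [Ring S] {C : ModuleCat.{u} R → Prop}
    {C' : ModuleCat.{u} S → Prop} (hC : IsRepFiniteClass C)
    (F : ModuleCat.{u} S → ModuleCat.{u} R)
    (hF : ∀ N, C' N → Indec S N → C (F N) ∧ Indec R (F N))
    (hiso : ∀ N N', C' N → C' N' → (F N ≃ₗ[R] F N') → Nonempty (N ≃ₗ[S] N')) :
    IsRepFiniteClass C' := by
  classical
  obtain ⟨n, X, hX⟩ := hC
  let Q : Fin n → ModuleCat.{u} S → Prop := fun i N => C' N ∧ Nonempty (F N ≅ X i)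
  refine ⟨n, fun i => if h : ∃ N, Q i N then h.choose else ModuleCat.of S PUnit,
    fun N hN hI => ?_⟩
  obtain ⟨h1, h2⟩ := hF N hN ((indecomposable_iff _).1 hI)
  obtain ⟨i, ⟨e⟩⟩ := hX _ h1 ((indecomposable_iff _).2 h2)
  have hQ : ∃ N, Q i N := ⟨N, hN, ⟨e⟩⟩
  refine ⟨i, ?_⟩
  simp only [dif_pos hQ]
  obtain ⟨h3, ⟨e'⟩⟩ := hQ.choose_spec
  obtain ⟨ε⟩ := hiso _ _ hN h3 (e ≪≫ e'.symm).toLinearEquiv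
  exact ⟨ε.toModuleIso⟩

theorem IsRepFiniteClass.of_ringEquiv {R S : Type u} [Ring R] [Ring S] (ρ : S ≃+* R)
    (h : IsRepFiniteClass fun M : ModuleCat.{u} R => Module.Finite R M) :
    IsRepFiniteClass fun M : ModuleCat.{u} S => Module.Finite S M := by
  let F : ModuleCat.{u} S → ModuleCat.{u} R :=
    (ModuleCat.restrictScalars ρ.symm.toRingHom).obj
  let j : ∀ N : ModuleCat.{u} S, N → F N := fun N x => x
  have hj : ∀ (N : ModuleCat.{u} S) (s : S) (x : N), j N (s • x) = ρ s • j N x := by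
    intro N s x
    change s • x = ρ.symm (ρ s) • x
    rw [ρ.symm_apply_apply]
  let G : ∀ N N' : ModuleCat.{u} S, (F N →ₗ[R] F N') → (N →ₗ[S] N') := fun N N' f =>
    { toFun := fun x => f (j N x)
      map_add' := fun x y => map_add f (j N x) (j N y)
      map_smul' := fun s x => by
        have h1 := f.map_smul (ρ s) (j N x)
        rw [← hj] at h1
        refine h1.trans ?_
        exact (hj N' s (f (j N x))).symm }
  refine h.of_map F (fun N hN hI => ⟨?_, hI.1, fun e he => ?_⟩) (fun N N' _ _ e => ?_)
  · let f : N →ₛₗ[(ρ : S →+* R)] F N :=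
      { toFun := j N, map_add' := fun _ _ => rfl, map_smul' := hj N }
    exact Module.Finite.of_surjective f fun x => ⟨x, rfl⟩
  · have he' : ∀ x, e (e x) = e x := fun x => LinearMap.congr_fun he x
    rcases hI.2 (G N N e) (LinearMap.ext fun x => he' x) with h | h
    · exact Or.inl (LinearMap.ext fun x => LinearMap.congr_fun h x)
    · exact Or.inr (LinearMap.ext fun x => LinearMap.congr_fun h x)
  · refine ⟨LinearEquiv.ofLinearMap (G N N' e.toLinearMap) (G N' N e.symm.toLinearMap) ?_ ?_⟩
    · exact LinearMap.ext fun x => e.apply_symm_apply x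
    · exact LinearMap.ext fun x => e.symm_apply_apply x

theorem IsRepFiniteClass.of_op (K : Type u) {B : Type u} [Field K] [Ring B] [Algebra K B]
    [Module.Finite K B] (h : IsRepFinite B) :
    IsRepFiniteClass fun N : ModuleCat.{u} B => Module.Finite B N := by
  refine IsRepFiniteClass.dual (τ := (MulOpposite.opEquiv.symm : Bᵐᵒᵖ ≃ B)) (K := K) h
    fun N (hN : Module.Finite B N) => ?_
  have : Module.Finite K N := Module.Finite.trans B N
  obtain ⟨M, _, _, _, _, _, β, hβ⟩ := exists_dualPair (isAnti_op K B) N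
  exact ⟨M, _, _, _, ‹_›, β, hβ, Module.Finite.of_restrictScalars_finite K Bᵐᵒᵖ M⟩

end RepFiniteTransfer

/-! ### Modules copresented by an injective module `E`, and the functor `Hom(-, E)`. -/

section DomTwo

variable {R E : Type u} [Ring R] [AddCommGroup E] [Module R E]

/-- `X` is the kernel of a map between direct products of copies of `E`, the first product being
finite. -/
def IsDomTwo (E : Type u) [AddCommGroup E] [Module R E] (X : Type u) [AddCommGroup X]
    [Module R X] : Prop :=
  ∃ (ι : Type) (_ : Fintype ι) (f : X →ₗ[R] (ι → E)), Function.Injective f ∧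
    ∀ y, (∀ g : (ι → E) →ₗ[R] E, g ∘ₗ f = 0 → g y = 0) → y ∈ LinearMap.range f

variable {X Z Z' : Type u} [AddCommGroup X] [Module R X] [AddCommGroup Z] [Module R Z]
  [AddCommGroup Z'] [Module R Z']

theorem IsDomTwo.torsionless (h : IsDomTwo (R := R) E X) : Torsionless E R X := by
  obtain ⟨ι, _, f, hf, -⟩ := h
  intro x hx
  apply hf
  rw [map_zero]
  ext i
  exact hx (LinearMap.proj i ∘ₗ f)

theorem exists_extend_pi (hE : Module.Injective R E) {ι : Type} (f : X →ₗ[R] Z)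
    (hf : Function.Injective f) (φ : X →ₗ[R] (ι → E)) : ∃ ψ : Z →ₗ[R] (ι → E), ψ ∘ₗ f = φ := by
  choose ψ hψ using fun i => hE.out f hf (LinearMap.proj i ∘ₗ φ)
  exact ⟨LinearMap.pi ψ, by ext x i; exact hψ i x⟩

/-- Extend `φ` to the finite power of `E` by injectivity; the components of the extension are
endomorphisms of `E`. So the coordinates of `f` generate `Hom(X, E)` over `End(E)`. -/
theorem IsDomTwo.exists_extend (hE : Module.Injective R E) {ι : Type} [Fintype ι]
    (f : X →ₗ[R] (ι → E)) (hf : Function.Injective f) (φ : X →ₗ[R] E) :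
    ∃ c : ι → Module.End R E, φ = ∑ i, c i • (LinearMap.proj i ∘ₗ f) := by
  classical
  obtain ⟨ψ, hψ⟩ := hE.out f hf φ
  refine ⟨fun i => ψ ∘ₗ LinearMap.single R (fun _ => E) i, ?_⟩
  ext x
  rw [← hψ x]
  conv_lhs => rw [← Finset.univ_sum_single (f x), map_sum]
  rw [LinearMap.sum_apply]
  rfl

/-- Modules of `E`-dominant dimension at least two are reflexive with respect to `E`. -/
theorem IsDomTwo.bijective_ev (hE : Module.Injective R E) (h : IsDomTwo (R := R) E X) :
    Function.Bijective (ev R (Module.End R E) E X) := by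
  constructor
  · rw [injective_iff_map_eq_zero]
    exact fun x hx => h.torsionless x fun φ => LinearMap.congr_fun hx φ
  · obtain ⟨ι, _, f, hf, hr⟩ := h
    classical
    intro F
    -- A map `g` with `g ∘ f = 0` is an `End(E)`-linear relation among the coordinates of `f`. By
    -- linearity `F` respects it, so the values of `F` on the coordinates come from an element of
    -- `X`.
    obtain ⟨x, hx⟩ := hr (fun i => F (LinearMap.proj i ∘ₗ f)) (fun g hg => by
      have h1 : ∑ i, (g ∘ₗ LinearMap.single R (fun _ => E) i : Module.End R E) •
          (LinearMap.proj i ∘ₗ f) = g ∘ₗ f := by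
        ext x
        rw [LinearMap.sum_apply]
        conv_rhs => rw [LinearMap.comp_apply, ← Finset.univ_sum_single (f x), map_sum]
        rfl
      have h2 := congrArg F h1
      rw [hg, map_zero, map_sum] at h2
      rw [← h2]
      conv_lhs => rw [← Finset.univ_sum_single (fun i => F (LinearMap.proj i ∘ₗ f)), map_sum]
      refine Finset.sum_congr rfl fun i _ => ?_
      rw [map_smul]
      rfl)
    refine ⟨x, ?_⟩
    ext φ
    obtain ⟨c, rfl⟩ := IsDomTwo.exists_extend hE f hf φ
    rw [ev_apply, LinearMap.sum_apply, map_sum]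
    refine Finset.sum_congr rfl fun i _ => ?_
    rw [map_smul, LinearMap.smul_apply]
    have := congrFun hx i
    exact congrArg _ this

theorem IsDomTwo.finite_dual (hE : Module.Injective R E) (h : IsDomTwo (R := R) E X) :
    Module.Finite (Module.End R E) (X →ₗ[R] E) := by
  obtain ⟨ι, _, f, hf, hr⟩ := h
  refine Module.Finite.of_surjective
    (Fintype.linearCombination (Module.End R E) fun i => LinearMap.proj i ∘ₗ f) fun φ => ?_
  obtain ⟨c, rfl⟩ := IsDomTwo.exists_extend hE f hf φ
  exact ⟨c, by rw [Fintype.linearCombination_apply]⟩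

/-- Write the given point as `f z`. Each `φ ∘ b` extends along `f` to a map that vanishes on `X`,
hence at `f z`; torsionlessness of `Z'` gives `b z = 0`. -/
theorem IsDomTwo.kernel (hE : Module.Injective R E) (hZ : IsDomTwo (R := R) E Z)
    (hZ' : Torsionless E R Z') (a : X →ₗ[R] Z) (b : Z →ₗ[R] Z') (ha : Function.Injective a)
    (hab : Function.Exact a b) : IsDomTwo (R := R) E X := by
  obtain ⟨ι, hι, f, hf, hr⟩ := hZ
  refine ⟨ι, hι, f ∘ₗ a, hf.comp ha, fun y hy => ?_⟩
  obtain ⟨z, rfl⟩ := hr y fun g hg => hy g (by rw [← LinearMap.comp_assoc, hg, LinearMap.zero_comp])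
  have hbz : b z = 0 := hZ' _ fun φ => by
    obtain ⟨ψ, hψ⟩ := hE.out f hf (φ ∘ₗ b)
    have := hy ψ (by
      ext x
      rw [LinearMap.comp_apply, LinearMap.comp_apply, hψ, LinearMap.comp_apply,
        hab.apply_apply_eq_zero, map_zero, LinearMap.zero_apply])
    rw [hψ] at this
    exact this
  obtain ⟨x, rfl⟩ := (hab z).1 hbz
  exact ⟨x, rfl⟩

theorem IsDomTwo.of_retract (hE : Module.Injective R E) (hZ : IsDomTwo (R := R) E Z)
    (f : X →ₗ[R] Z) (g : Z →ₗ[R] X) (hgf : g ∘ₗ f = LinearMap.id) : IsDomTwo (R := R) E X := by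
  have hgf' : ∀ x, g (f x) = x := fun x => LinearMap.congr_fun hgf x
  refine hZ.kernel hE hZ.torsionless f (LinearMap.id - f ∘ₗ g) (injective_of_retract hgf)
    fun z => ⟨fun hz => ⟨g z, (sub_eq_zero.1 hz).symm⟩, ?_⟩
  rintro ⟨x, rfl⟩
  simp [hgf']

theorem IsDomTwo.pi (hX : IsDomTwo (R := R) E X) (n : ℕ) :
    IsDomTwo (R := R) E (Fin n → X) := by
  obtain ⟨ι, _, f, hf, hr⟩ := hX
  refine ⟨Fin n × ι, inferInstance, LinearMap.pi fun p => LinearMap.proj p.2 ∘ₗ f ∘ₗ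
    LinearMap.proj p.1, fun x y hxy => ?_, fun y hy => ?_⟩
  · ext i
    apply hf
    ext k
    exact congrFun hxy (i, k)
  · have : ∀ i, ∃ x, f x = fun k => y (i, k) := fun i => hr _ fun g hg => by
      have := hy (g ∘ₗ LinearMap.pi fun k => LinearMap.proj (i, k)) (by
        exact LinearMap.ext fun z => LinearMap.congr_fun hg (z i))
      exact this
    choose x hx using this
    refine ⟨x, ?_⟩
    ext ⟨i, k⟩
    exact congrFun (hx i) k

theorem IsDomTwo.projective (hE : Module.Injective R E) (hR : IsDomTwo (R := R) E R)
    [Module.Finite R X] [Module.Projective R X] : IsDomTwo (R := R) E X := by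
  obtain ⟨n, π, hπ⟩ := Module.Finite.exists_fin' R X
  obtain ⟨s, hs⟩ := Module.projective_lifting_property π LinearMap.id hπ
  exact (hR.pi n).of_retract hE s π hs

theorem IsDomTwo.of_isSecondSyzygy (hE : Module.Injective R E) (hR : IsDomTwo (R := R) E R)
    {X : ModuleCat.{u} R} (h : IsSecondSyzygy X) : IsDomTwo (R := R) E X := by
  obtain ⟨P, Q, _, _, _, _, f, g, h1, h2, h3, h4, h5, h6⟩ := h
  exact (hR.projective hE).kernel hE (hR.projective hE (X := Q)).torsionless f g h5 h6

theorem lcomp_injective_of_torsionless {S U M N : Type u} [Ring S] [AddCommGroup U] [Module R U]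
    [Module S U] [SMulCommClass R S U] [AddCommGroup M] [Module R M] [AddCommGroup N] [Module R N]
    (hN : Torsionless U R N)
    {f g : M →ₗ[R] N} (h : LinearMap.lcomp S U f = LinearMap.lcomp S U g) : f = g := by
  ext m
  rw [← sub_eq_zero]
  refine hN _ fun φ => ?_
  rw [map_sub, sub_eq_zero]
  exact LinearMap.congr_fun (LinearMap.congr_fun h φ) m

/-- Reflexivity with respect to `E` makes `Hom(-, E)` fully faithful on this class, and its values
are finitely generated over `End(E)`; so indecomposables and isomorphisms can be tested there. -/
theorem isRepFiniteClass_isDomTwo (hE : Module.Injective R E)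
    (h : IsRepFiniteClass fun N : ModuleCat.{u} (Module.End R E) =>
      Module.Finite (Module.End R E) N) :
    IsRepFiniteClass fun X : ModuleCat.{u} R => IsDomTwo (R := R) E X := by
  refine h.of_map (fun X => ModuleCat.of (Module.End R E) (X →ₗ[R] E)) (fun X hX hI => ⟨?_, ?_, ?_⟩)
    (fun X Y hX hY e => ?_)
  · exact hX.finite_dual hE
  · have := hI.1
    by_contra hn
    rw [not_nontrivial_iff_subsingleton] at hn
    obtain ⟨x, hx⟩ := exists_ne (0 : X)
    exact hx (hX.torsionless x fun φ => LinearMap.congr_fun (hn.elim φ (0 : X →ₗ[R] E)) x)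
  · intro e he
    obtain ⟨f, rfl⟩ := exists_eq_lcomp (hX.bijective_ev hE) e
    have : f ∘ₗ f = f := lcomp_injective_of_torsionless hX.torsionless he
    rcases hI.2 f this with rfl | rfl
    · left
      ext φ x
      exact map_zero φ
    · exact Or.inr rfl
  · obtain ⟨f, hf⟩ := exists_eq_lcomp (hX.bijective_ev hE) e.toLinearMap
    obtain ⟨g, hg⟩ := exists_eq_lcomp (hY.bijective_ev hE) e.symm.toLinearMap
    refine ⟨LinearEquiv.ofLinearMap g f ?_ ?_⟩
    · apply lcomp_injective_of_torsionless (S := Module.End R E) hY.torsionless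
      rw [lcomp_comp, ← hf, ← hg]
      exact LinearMap.ext fun x => e.apply_symm_apply x
    · apply lcomp_injective_of_torsionless (S := Module.End R E) hX.torsionless
      rw [lcomp_comp, ← hf, ← hg]
      exact LinearMap.ext fun x => e.symm_apply_apply x

theorem torsionless_of_faithful [FaithfulSMul R E] [Module.Projective R X] :
    Torsionless E R X := by
  intro p hp
  obtain ⟨s, hs⟩ := Module.projective_def'.1 (inferInstance : Module.Projective R X)
  have : s p = 0 := by
    ext x
    refine FaithfulSMul.eq_of_smul_eq_smul (α := E) fun y => ?_
    have := hp (LinearMap.toSpanSingleton R E y ∘ₗ Finsupp.lapply x ∘ₗ s)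
    simpa using this
  have e := LinearMap.congr_fun hs p
  simpa [this] using e.symm

/-- A projective module with two projective terms in its minimal injective resolution. -/
theorem isDomTwo_of_firstTermsProjective (hE : Module.Injective R E) [FaithfulSMul R E]
    {X : ModuleCat.{u} R} {ι : Type} [Fintype ι] (c : X →ₗ[R] (ι → E))
    (hc : Function.Injective c) {n : ℕ} (h : FirstTermsProjective (n + 2) X) :
    IsDomTwo (R := R) E X := by
  obtain ⟨I₀, j, hj, -, I₁, j₁, hj₁, hP, -⟩ := h
  obtain ⟨c', hc'⟩ := exists_extend_pi hE j hj.injective_map c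
  have hinj : Function.Injective c' := by
    rw [← LinearMap.ker_eq_bot]
    -- The kernel of `c'` meets `X` trivially because `c` is injective; essentiality kills it, and
    -- `I₀` becomes a summand of the power of `E`.
    apply hj.essential
    rw [eq_bot_iff]
    rintro _ ⟨hx, x, rfl⟩
    have : c x = 0 := by rw [← hc']; exact hx
    rw [(map_eq_zero_iff c hc).1 this, map_zero]
    exact Submodule.zero_mem _
  obtain ⟨r, hr⟩ := exists_section_of_injective hj.injective_module c' hinj
  have hr' : ∀ x, r (c' x) = x := fun x => LinearMap.congr_fun hr x
  refine ⟨ι, inferInstance, c, hc, fun y hy => ?_⟩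
  have h1 : c' (r y) = y := by
    ext k
    have := hy (LinearMap.proj k ∘ₗ (LinearMap.id - c' ∘ₗ r)) (by
      ext x
      rw [← hc']
      simp [hr'])
    exact (sub_eq_zero.1 this).symm
  -- `I₀ / X` embeds in the projective module `I₁`, whose points are separated by maps to the
  -- faithful module `E`; each such map gives a condition that `y` satisfies.
  have h2 : (LinearMap.range j).mkQ (r y) = 0 := by
    apply hj₁.injective_map
    rw [map_zero]
    refine torsionless_of_faithful (R := R) (E := E) (X := I₁) _ fun φ => ?_
    refine hy (φ ∘ₗ j₁ ∘ₗ (LinearMap.range j).mkQ ∘ₗ r) ?_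
    ext x
    have : (LinearMap.range j).mkQ (j x) = 0 := (Submodule.Quotient.mk_eq_zero _).2 ⟨x, rfl⟩
    rw [← hc']
    simp only [LinearMap.comp_apply, hr', this, map_zero, LinearMap.zero_apply]
  obtain ⟨x, hx⟩ := (Submodule.Quotient.mk_eq_zero _).1 h2
  exact ⟨x, by rw [← hc', LinearMap.comp_apply, hx, h1]⟩

theorem IsDomTwo.of_equiv (e : X ≃ₗ[R] Z) (h : IsDomTwo (R := R) E Z) : IsDomTwo (R := R) E X := by
  obtain ⟨ι, _, f, hf, hr⟩ := h
  refine ⟨ι, inferInstance, f ∘ₗ e.toLinearMap, hf.comp e.injective, fun y hy => ?_⟩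
  obtain ⟨z, rfl⟩ := hr y fun g hg => hy g (by rw [← LinearMap.comp_assoc, hg, LinearMap.zero_comp])
  exact ⟨e.symm z, by simp⟩

theorem exists_firstTermsProjective_of_two_le_domdim {X : ModuleCat.{u} R} (h : 2 ≤ domdim X) :
    ∃ n, FirstTermsProjective (n + 2) X := by
  by_contra hcon
  push Not at hcon
  have : domdim X ≤ 1 := by
    refine iSup₂_le fun n hn => ?_
    rcases n with _ | _ | n
    · simp
    · simp
    · exact absurd hn (hcon n)
  exact absurd (h.trans this) (by decide)

end DomTwo

/-! ### Endomorphism rings of `E` and of `Hom(D(E), U)`. -/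

section RingEquiv

variable {K R S U : Type u} [Field K] [Ring R] [Ring S] [Algebra K R] [Algebra K S]
  [AddCommGroup U] [Module R U] [Module S U] [SMulCommClass R S U] [SMulCommClass S R U]
  {E N : Type u} [AddCommGroup E] [Module R E] [Module K E] [IsScalarTower K R E]
  [AddCommGroup N] [Module S N] [Module K N] [IsScalarTower K S N] {τ : R ≃ S}
  {β : E →ₗ[K] N →ₗ[K] K}

/-- Two contravariant full and faithful steps compose: adjoints across the pairing, and duality into
`U`, for which the projective module `N` is reflexive. With `E = eA` this identifies `End(eA)` with
`B₂`. -/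
theorem exists_end_ringEquiv {u : U} (h : IsRegular R S u) (hβ : IsDualPair τ β)
    [Module.Finite S N] [Module.Projective S N] :
    Nonempty (Module.End R E ≃+* Module.End R (N →ₗ[S] U)) := by
  choose t ht using fun γ : E →ₗ[R] E => exists_adj_right hβ hβ γ
  have hN := h.symm.bijective_ev (P := N)
  have htl : Torsionless U S N := h.symm.torsionless
  let F : Module.End R E →+* Module.End R (N →ₗ[S] U) :=
    { toFun := fun γ => LinearMap.lcomp R U (t γ)
      map_one' := by
        rw [Adj.unique_right hβ (ht 1) adj_id]; rfl
      map_mul' := fun a b => by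
        rw [Adj.unique_right hβ (ht (a * b)) ((ht b).comp (ht a))]; rfl
      map_zero' := by
        rw [Adj.unique_right hβ (ht 0) (g' := 0) (fun m n => by simp)]
        ext φ x; simp [LinearMap.lcomp_apply]
      map_add' := fun a b => by
        rw [Adj.unique_right hβ (ht (a + b)) (g' := t a + t b) (fun m n => by
          simp [ht a m n, ht b m n])]
        ext φ x; simp [LinearMap.lcomp_apply] }
  refine ⟨RingEquiv.ofBijective F ⟨fun a b hab => ?_, fun b => ?_⟩⟩
  · have : t a = t b := lcomp_injective_of_torsionless htl hab
    exact Adj.unique_left hβ (ht a) (this ▸ ht b)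
  · obtain ⟨f, rfl⟩ := exists_eq_lcomp hN b
    obtain ⟨a, ha⟩ := exists_adj_left hβ hβ f
    exact ⟨a, by rw [Adj.unique_right hβ ha (ht a)]; rfl⟩

end RingEquiv

/-! ### Dominant dimension at least two. -/

section DominantDimension

variable {K A : Type u} [Field K] [Ring A] [Algebra K A] [Module.Finite K A]

theorem finite_end {R E : Type u} [Ring R] [Algebra K R] [AddCommGroup E] [Module R E] [Module K E]
    [IsScalarTower K R E] [Module.Finite K E] : Module.Finite K (Module.End R E) :=
  Module.Finite.of_injective (LinearMap.restrictScalarsₗ K R E E K)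
    (LinearMap.restrictScalars_injective K)

theorem isRepFiniteClass_isDomTwo_of_algebraB₂ {e : A} (he : IsMinimalFaithfulIdempotent e)
    (h : IsRepFinite (algebraB₂ K e)) :
    IsRepFiniteClass fun X : ModuleCat.{u} Aᵐᵒᵖ => IsDomTwo (R := Aᵐᵒᵖ) (rightIdeal e) X := by
  have := finite_op K (A := A)
  have hEfin : Module.Finite Aᵐᵒᵖ (rightIdeal e) :=
    inferInstanceAs (Module.Finite Aᵐᵒᵖ (Submodule.span Aᵐᵒᵖ ({e} : Set A)))
  have hEK : Module.Finite K (rightIdeal e) := Module.Finite.trans Aᵐᵒᵖ _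
  obtain ⟨β, hβ⟩ := isDualPair_dualRL K (rightIdeal e) hEfin
  have hNfin := hβ.finite_right
  have hNproj := hβ.projective (isAnti_op K A) he.2.2.1
  obtain ⟨σ⟩ := exists_end_ringEquiv (isRegular_one A) hβ
  have hΓ : IsRepFinite (Module.End Aᵐᵒᵖ (rightIdeal e)) :=
    IsRepFiniteClass.of_ringEquiv (RingEquiv.op σ) h
  have := finite_end (K := K) (R := Aᵐᵒᵖ) (E := rightIdeal e)
  exact isRepFiniteClass_isDomTwo he.2.2.1 (IsRepFiniteClass.of_op K hΓ)

variable (K) in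
include K in
theorem isDomTwo_regular {e : A} (he : IsMinimalFaithfulIdempotent e)
    (hd : 2 ≤ domdim (rightReg A)) : IsDomTwo (R := Aᵐᵒᵖ) (rightIdeal e) Aᵐᵒᵖ := by
  have := finite_op K (A := A)
  have hEfin : Module.Finite Aᵐᵒᵖ (rightIdeal e) :=
    inferInstanceAs (Module.Finite Aᵐᵒᵖ (Submodule.span Aᵐᵒᵖ ({e} : Set A)))
  have hEK : Module.Finite K (rightIdeal e) := Module.Finite.trans Aᵐᵒᵖ _
  have : FaithfulSMul Aᵐᵒᵖ (rightIdeal e) := he.2.2.2.1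
  obtain ⟨n, hn⟩ := exists_firstTermsProjective_of_two_le_domdim hd
  let b := Module.finBasis K (rightIdeal e)
  let ε : Aᵐᵒᵖ ≃ₗ[Aᵐᵒᵖ] A := (isRegular_one A).equiv
  -- Acting on a `K`-basis of `eA` embeds the algebra in a finite power of `eA`, by faithfulness.
  let c : Aᵐᵒᵖ →ₗ[Aᵐᵒᵖ] (Fin (Module.finrank K (rightIdeal e)) → rightIdeal e) :=
    LinearMap.pi fun i => LinearMap.toSpanSingleton Aᵐᵒᵖ _ (b i)
  have hc : Function.Injective c := by
    intro r s hrs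
    refine FaithfulSMul.eq_of_smul_eq_smul (α := rightIdeal e) fun y => ?_
    have : Algebra.lsmul K K (rightIdeal e) r = Algebra.lsmul K K (rightIdeal e) s :=
      b.ext fun i => congrFun hrs i
    exact LinearMap.congr_fun this y
  have := isDomTwo_of_firstTermsProjective he.2.2.1 (X := rightReg A) (c ∘ₗ ε.symm.toLinearMap)
    (hc.comp ε.symm.injective) hn
  exact IsDomTwo.of_equiv (Z := A) ε this

theorem isCMFinite_and_isNearlyGorenstein {e : A} (he : IsMinimalFaithfulIdempotent e)
    (hd : 2 ≤ domdim (rightReg A)) (h : IsRepFinite (algebraB₂ K e)) :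
    IsCMFinite A ∧ IsNearlyGorenstein K A := by
  have hrep := isRepFiniteClass_isDomTwo_of_algebraB₂ he h
  have hA := isDomTwo_regular K he hd
  have hE := he.2.2.1
  have := isArtinianRing_of_finite K (A := A)
  refine ⟨hrep.mono fun M hM => IsDomTwo.of_isSecondSyzygy hE hA
    (IsGPAux.isSecondSyzygy (isRegular_one A) hM), ?_⟩
  refine isNearlyGorenstein_of_finiteNonproj K (C := fun X => IsDomTwo (R := Aᵐᵒᵖ) (rightIdeal e) X)
    ?_ (hrep.mono fun M hM => hM.1) (fun X _ hX => IsDomTwo.of_isSecondSyzygy hE hA hX)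
  exact fun M N f g hgf hN => IsDomTwo.of_retract hE hN f g hgf

end DominantDimension

/-! ### Radical square zero: idempotents, torsionless indecomposables and filtrations by simples. -/

section RadSquareZero

variable {R : Type u} [Ring R]
variable {M N P T : Type u} [AddCommGroup M] [Module R M] [AddCommGroup N] [Module R N]
  [AddCommGroup P] [Module R P] [AddCommGroup T] [Module R T]

theorem smul_eq_zero_of_mem_jacobson [IsSemisimpleModule R M] {j : R} (hj : j ∈ Ring.jacobson R)
    (m : M) : j • m = 0 :=
  Module.mem_annihilator.1 (IsSemisimpleModule.jacobson_le_annihilator R M hj) m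

theorem isSemisimpleModule_of_smul_eq_zero [IsArtinianRing R]
    (h : ∀ j ∈ Ring.jacobson R, ∀ m : M, j • m = 0) : IsSemisimpleModule R M := by
  have hM : Module.IsTorsionBySet R M (Ring.jacobson R) := fun m j => h j j.2 m
  let := hM.module
  exact hM.isSemisimpleModule_iff.1 inferInstance

theorem Indec.isSimpleModule [IsSemisimpleModule R M] (h : Indec R M) : IsSimpleModule R M := by
  have := h.1
  refine { eq_bot_or_eq_top := fun N => ?_ }
  obtain ⟨N', hN'⟩ := exists_isCompl N
  rcases h.2 (N.projection N' hN') (LinearMap.ext fun x => LinearMap.congr_fun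
    (Submodule.isIdempotentElem_projection hN') x) with h0 | h1
  · left
    rw [← Submodule.range_projection hN', h0, LinearMap.range_zero]
  · right
    rw [← Submodule.range_projection hN', h1, LinearMap.range_id]

/-- The image of `L` in the semisimple quotient is generated by an idempotent, represented by some
`x` in `L`. The lift is `3x² - 2x³`, written as a left multiple of `x` so that it stays in `L`. -/
theorem exists_idempotent_of_radSqZero [IsArtinianRing R]
    (hJ : ∀ x ∈ Ring.jacobson R, ∀ y ∈ Ring.jacobson R, x * y = 0) (L : Ideal R) :
    ∃ g ∈ L, IsIdempotentElem g ∧ ∀ l ∈ L, l - l * g ∈ Ring.jacobson R := by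
  let q := Ideal.Quotient.mk (Ring.jacobson R)
  have hq : Function.Surjective q := Ideal.Quotient.mk_surjective
  obtain ⟨e, he, hspan⟩ := IsSemisimpleRing.ideal_eq_span_idempotent (L.map q)
  obtain ⟨x, hx, rfl⟩ := (Ideal.mem_map_iff_of_surjective q hq).1
    (hspan ▸ Ideal.mem_span_singleton_self e)
  have hxx : x * x - x ∈ Ring.jacobson R := by
    rw [← Ideal.Quotient.eq_zero_iff_mem]
    change q (x * x - x) = 0
    rw [map_sub, map_mul, he.eq, sub_self]
  have hsq := hJ _ hxx _ hxx
  have hg : q ((3 * x - 2 * (x * x)) * x) = q x := by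
    have h1 : q x * q x = q x := he
    simp only [map_mul, map_sub, map_ofNat, h1, sub_mul, mul_assoc]
    noncomm_ring
  refine ⟨(3 * x - 2 * (x * x)) * x, L.mul_mem_left _ hx, ?_, fun l hl => ?_⟩
  · unfold IsIdempotentElem
    -- The defect from idempotency is a multiple of `(x² - x)²`, a product of two radical elements.
    have : (3 * x - 2 * (x * x)) * x * ((3 * x - 2 * (x * x)) * x) - (3 * x - 2 * (x * x)) * x =
        ((x * x - x) * (x * x - x)) * (4 * (x * x) - 4 * x - 3) := by noncomm_ring
    rw [hsq, zero_mul, sub_eq_zero] at this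
    exact this
  · rw [← Ideal.Quotient.eq_zero_iff_mem]
    change q _ = 0
    rw [map_sub, map_mul, hg]
    have : q l ∈ Ideal.span {q x} := hspan ▸ Ideal.mem_map_of_mem q hl
    obtain ⟨c, hc⟩ := Ideal.mem_span_singleton'.1 this
    rw [← hc, mul_assoc, he.eq, sub_self]

theorem exists_mul_idempotent [IsArtinianRing R]
    (hJ : ∀ x ∈ Ring.jacobson R, ∀ y ∈ Ring.jacobson R, x * y = 0) {a : R}
    (ha : a ∉ Ring.jacobson R) : ∃ b : R, b * a ≠ 0 ∧ IsIdempotentElem (b * a) := by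
  obtain ⟨g, hg, hid, hl⟩ := exists_idempotent_of_radSqZero hJ (Ideal.span {a})
  obtain ⟨b, rfl⟩ := Ideal.mem_span_singleton'.1 hg
  refine ⟨b, fun h0 => ha ?_, hid⟩
  simpa [h0] using hl a (Ideal.mem_span_singleton_self a)

/-- If `φ m` is outside the radical, some `b * φ m` is a nonzero idempotent. The map `R → M` sending
`1` to `b φ(m) b m` then makes `ψ ∘ φ` a nonzero idempotent endomorphism, hence the identity, and
`M` is a summand of `R`. -/
theorem Indec.apply_mem_jacobson [IsArtinianRing R]
    (hJ : ∀ x ∈ Ring.jacobson R, ∀ y ∈ Ring.jacobson R, x * y = 0) (h : Indec R M)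
    (hP : ¬ Module.Projective R M) (φ : M →ₗ[R] R) (m : M) : φ m ∈ Ring.jacobson R := by
  by_contra hm
  obtain ⟨b, h0, hid⟩ := exists_mul_idempotent hJ hm
  have hg : b * φ m * (b * φ m) = b * φ m := hid
  let ψ : R →ₗ[R] M := LinearMap.toSpanSingleton R M ((b * φ m * b) • m)
  have hψ : φ (ψ 1) = b * φ m := by
    simp only [ψ, LinearMap.toSpanSingleton_apply, one_smul, map_smul, smul_eq_mul]
    rw [mul_assoc]; exact hg
  have hψ1 : (b * φ m) • ψ 1 = ψ 1 := by
    simp only [ψ, LinearMap.toSpanSingleton_apply, one_smul]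
    rw [← mul_smul, ← mul_assoc, hg]
  have hψ' : ∀ r, ψ r = r • ψ 1 := fun r => by rw [← map_smul, smul_eq_mul, mul_one]
  rcases h.2 (ψ ∘ₗ φ) (LinearMap.ext fun x => by
    simp only [LinearMap.comp_apply]
    rw [hψ' (φ x), map_smul, hψ, smul_eq_mul, hψ', mul_smul, hψ1]) with h1 | h1
  · apply h0
    have h2 := congrArg φ (LinearMap.congr_fun h1 (ψ 1))
    rw [LinearMap.comp_apply, hψ, hψ', hψ1, hψ, LinearMap.zero_apply, map_zero] at h2
    exact h2
  · exact hP (Module.Projective.of_split φ ψ h1)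

theorem Indec.smul_eq_zero_of_torsionless [IsArtinianRing R]
    (hJ : ∀ x ∈ Ring.jacobson R, ∀ y ∈ Ring.jacobson R, x * y = 0) (h : Indec R M)
    (hP : ¬ Module.Projective R M) (ht : Torsionless R R M) (j : R) (hj : j ∈ Ring.jacobson R)
    (m : M) : j • m = 0 :=
  ht _ fun φ => by
    rw [map_smul]
    exact hJ j hj _ (h.apply_mem_jacobson hJ hP φ m)

theorem IsRegular.torsionless_self {S U : Type u} [Ring S] [AddCommGroup U] [Module R U]
    [Module S U] {u : U} (h : IsRegular R S u) (hM : Torsionless U R M) : Torsionless R R M :=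
  fun m hm => hM m fun φ => by
    have := hm (h.equiv.symm.toLinearMap ∘ₗ φ)
    simpa using this

theorem Indec.isSimpleModule_of_torsionless [IsArtinianRing R]
    (hJ : ∀ x ∈ Ring.jacobson R, ∀ y ∈ Ring.jacobson R, x * y = 0) (h : Indec R M)
    (hP : ¬ Module.Projective R M) (ht : Torsionless R R M) : IsSimpleModule R M :=
  have := isSemisimpleModule_of_smul_eq_zero (h.smul_eq_zero_of_torsionless hJ hP ht)
  h.isSimpleModule

theorem torsionless_self_of_projective [Module.Projective R M] : Torsionless R R M := by
  obtain ⟨s, hs⟩ := ‹Module.Projective R M›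
  intro m hm
  have : s m = 0 := by
    ext x
    exact hm (Finsupp.lapply x ∘ₗ s)
  rw [← hs m, this, map_zero]

theorem finiteNonproj_isFirstSyzygy [IsArtinianRing R]
    (hJ : ∀ x ∈ Ring.jacobson R, ∀ y ∈ Ring.jacobson R, x * y = 0) :
    FiniteNonproj (IsFirstSyzygy (R := R)) := by
  classical
  -- The modules in question are simple and embed in `R`, so one simple left ideal from each
  -- isotypic component represents them all.
  obtain ⟨n, ⟨ε⟩⟩ := Finite.exists_equiv_fin (isotypicComponents R R)
  choose S hS hcS using fun c : isotypicComponents R R => c.2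
  refine ⟨n, fun i => ModuleCat.of R (S (ε.symm i)), ?_⟩
  rintro M ⟨hM, hP⟩ hind
  rw [indecomposable_iff] at hind
  obtain ⟨-, P, _, _, f, h2, h3, hf⟩ := (isFirstSyzygy_iff M).1 hM
  have ht : Torsionless R R M := (torsionless_self_of_projective (M := P)).of_injective f hf
  have := hind.isSimpleModule_of_torsionless hJ hP ht
  have := hind.1
  obtain ⟨m, hm⟩ := exists_ne (0 : M)
  obtain ⟨φ, hφ⟩ : ∃ φ : M →ₗ[R] R, φ m ≠ 0 := by
    by_contra! h
    exact hm (ht m h)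
  have hinj : Function.Injective φ := LinearMap.injective_of_ne_zero fun h => hφ (by simp [h])
  let e : M ≃ₗ[R] LinearMap.range φ := LinearEquiv.ofInjective φ hinj
  have hs : IsSimpleModule R (LinearMap.range φ) := IsSimpleModule.congr e.symm
  let c : isotypicComponents R R := ⟨isotypicComponent R R (LinearMap.range φ), _, hs, rfl⟩
  have hle : LinearMap.range φ ≤ isotypicComponent R R (S c) :=
    (Submodule.le_isotypicComponent _).trans (hcS c).le
  have := hS c
  obtain ⟨e'⟩ := isIsotypicOfType_submodule_iff.1 (.isotypicComponent R R (S c)) _ hle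
  have e'' : M ≃ₗ[R] S (ε.symm (ε c)) := by
    rw [ε.symm_apply_apply]
    exact e.trans e'
  exact ⟨ε c, ⟨e''.toModuleIso⟩⟩

variable {S U : Type u} [Ring S] [AddCommGroup U] [Module R U] [Module S U]
  [SMulCommClass R S U] [SMulCommClass S R U]

/-- A maximal submodule `X` lying in `⊥U` must be everything: otherwise a simple submodule of `M ⧸
X` enlarges it, by the long exact sequence. -/
theorem ExtVan.of_isSimpleModule [IsArtinianRing R] [Module.Finite R M]
    (h : ∀ (X : Submodule R M) (T : Submodule R (M ⧸ X)), IsSimpleModule R T → ExtVan R T U) :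
    ExtVan R M U := by
  obtain ⟨X, hX, hmax⟩ := (IsWellFounded.wf : WellFounded
    ((· > ·) : Submodule R M → Submodule R M → Prop)).has_min {X | ExtVan R X U}
    ⟨⊥, ExtVan.of_projective inferInstance⟩
  by_cases htop : X = ⊤
  · subst htop
    exact ExtVan.of_retract Submodule.topEquiv.symm.toLinearMap Submodule.topEquiv.toLinearMap
      (by ext; simp) hX
  exfalso
  have : Nontrivial (M ⧸ X) := Submodule.Quotient.nontrivial_iff.2 htop
  obtain ⟨T, hT⟩ := IsAtomic.exists_atom (Submodule R (M ⧸ X))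
  have hT' := isSimpleModule_iff_isAtom.2 hT
  let X' := T.comap X.mkQ
  have hle : X ≤ X' := fun x hx => by
    simp only [X', Submodule.mem_comap, Submodule.mkQ_apply]
    rw [(Submodule.Quotient.mk_eq_zero X (x := x)).2 hx]
    exact T.zero_mem
  refine hmax X' ?_ (lt_of_le_of_ne hle fun heq => hT.1 ?_)
  · change ExtVan R X' U
    let g : X' →ₗ[R] T := (X.mkQ.comp X'.subtype).codRestrict T fun x => x.2
    have hfg : Function.Exact (Submodule.inclusion hle) g := by
      intro x
      rw [← Subtype.coe_inj]
      change X.mkQ x = 0 ↔ _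
      rw [Submodule.mkQ_apply, Submodule.Quotient.mk_eq_zero]
      exact ⟨fun hx => ⟨⟨x, hx⟩, rfl⟩, by rintro ⟨y, rfl⟩; exact y.2⟩
    have hg : Function.Surjective g := by
      rintro ⟨t, ht⟩
      obtain ⟨x, rfl⟩ := X.mkQ_surjective t
      exact ⟨⟨x, ht⟩, rfl⟩
    have h1 := extVan_iff.1 hX
    have h2 := extVan_iff.1 (h X T hT')
    exact extVan_iff.2 fun i => extZero_middle (Submodule.inclusion_injective hle) hfg hg (i + 1)
      (h1 i) (h2 i)
  · rw [eq_bot_iff]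
    intro t ht
    obtain ⟨x, rfl⟩ := X.mkQ_surjective t
    have : x ∈ X := heq ▸ ht
    simpa using this

theorem injective_of_forall_extVan (h : ∀ I : Ideal R, ExtVan R (R ⧸ I) U) :
    Module.Injective R U := by
  refine Module.Baer.injective fun I g => ?_
  have hS : ShortEx I.subtype I.mkQ :=
    ⟨Subtype.val_injective, LinearMap.exact_subtype_mkQ _, Submodule.mkQ_surjective _⟩
  obtain ⟨ψ, hψ⟩ := ((extVan_iff_of_exact hS.inj hS.exact hS.surj inferInstance).1 (h I)).1 g
  exact ⟨ψ, fun x hx => LinearMap.congr_fun hψ ⟨x, hx⟩⟩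

end RadSquareZero

/-! ### Simple modules in `⊥U` and their common annihilator. -/

section PerpSimple

variable {R : Type u} [Ring R]
variable {M N P T : Type u} [AddCommGroup M] [Module R M] [AddCommGroup N] [Module R N]
  [AddCommGroup P] [Module R P] [AddCommGroup T] [Module R T]

theorem StRetract.syzygy {K K' P' M' : Type u} [AddCommGroup K] [Module R K] [AddCommGroup K']
    [Module R K'] [AddCommGroup P'] [Module R P'] [AddCommGroup M'] [Module R M']
    {f : K →ₗ[R] P} {g : P →ₗ[R] M} {f' : K' →ₗ[R] P'} {g' : P' →ₗ[R] M'}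
    (hS : ShortEx f g) (hS' : ShortEx f' g') [Module.Finite R P] [Module.Projective R P]
    [Module.Projective R P'] (h : StRetract R M M') : StRetract R K K' := by
  obtain ⟨a, b, hab⟩ := h
  obtain ⟨A, hA⟩ := Module.projective_lifting_property g' (a ∘ₗ g) hS'.surj
  obtain ⟨B, hB⟩ := Module.projective_lifting_property g (b ∘ₗ g') hS.surj
  obtain ⟨α, hα⟩ := exists_lift_of_exact hS'.inj hS'.exact (A ∘ₗ f) (by
    rw [← LinearMap.comp_assoc, hA, LinearMap.comp_assoc, hS.exact.linearMap_comp_eq_zero,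
      LinearMap.comp_zero])
  obtain ⟨β, hβ⟩ := exists_lift_of_exact hS.inj hS.exact (B ∘ₗ f') (by
    rw [← LinearMap.comp_assoc, hB, LinearMap.comp_assoc, hS'.exact.linearMap_comp_eq_zero,
      LinearMap.comp_zero])
  refine ⟨α, β, StablyZero.syzygy (Φ := B ∘ₗ A - LinearMap.id) hS ?_ ?_
    hS.exact.linearMap_comp_eq_zero hab⟩
  · rw [LinearMap.comp_sub, LinearMap.sub_comp, ← LinearMap.comp_assoc, hβ, LinearMap.comp_assoc,
      hα]; rfl
  · rw [LinearMap.comp_sub, LinearMap.sub_comp, ← LinearMap.comp_assoc, hB, LinearMap.comp_assoc,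
      hA]; rfl

theorem finite_of_isSimpleModule [IsSimpleModule R T] : Module.Finite R T := by
  have := IsSimpleModule.nontrivial R T
  obtain ⟨t, ht⟩ := exists_ne (0 : T)
  exact Module.Finite.of_surjective _ (IsSimpleModule.toSpanSingleton_surjective R ht)

theorem indec_of_isSimpleModule [IsSimpleModule R T] : Indec R T := by
  refine ⟨IsSimpleModule.nontrivial R T, fun e he => ?_⟩
  rcases e.injective_or_eq_zero with h | h
  · exact Or.inr (LinearMap.ext fun x => h (LinearMap.congr_fun he x))
  · exact Or.inl h

/-- A nonzero endomorphism of `T` is invertible, so if it were stably zero, the identity would be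
too. Stable retractions onto such a `T` are therefore genuine ones. -/
theorem eq_zero_of_stablyZero [IsSimpleModule R T] (hP : ¬ Module.Projective R T)
    {σ : T →ₗ[R] T} (h : StablyZero σ) : σ = 0 := by
  by_contra h0
  let e := LinearEquiv.ofBijective σ (LinearMap.bijective_of_ne_zero h0)
  have h1 : StablyZero (LinearMap.id : T →ₗ[R] T) := by
    convert h.comp_left e.symm.toLinearMap
    ext x
    exact (e.symm_apply_apply x).symm
  exact hP (stablyZero_id_iff.1 h1).2

theorem StRetract.exists_of_isSimpleModule [IsSimpleModule R T] (hP : ¬ Module.Projective R T)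
    (h : StRetract R T M) : ∃ (f : T →ₗ[R] M) (g : M →ₗ[R] T), g ∘ₗ f = LinearMap.id := by
  obtain ⟨f, g, h⟩ := h
  exact ⟨f, g, sub_eq_zero.1 (eq_zero_of_stablyZero hP h)⟩

variable {S U : Type u} [Ring S] [AddCommGroup U] [Module R U] [Module S U]
  [SMulCommClass R S U] [SMulCommClass S R U]

variable (R U) in
/-- The simple nonprojective modules in `⊥U`. -/
def PerpSimple (T : Type u) [AddCommGroup T] [Module R T] : Prop :=
  IsSimpleModule R T ∧ ¬ Module.Projective R T ∧ ExtVan R T U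

variable (R U) in
/-- The common annihilator of the simple nonprojective modules in `⊥U`. -/
def perpAnnihilator : Ideal R where
  carrier := {a | ∀ (T : Type u) [AddCommGroup T] [Module R T], PerpSimple R U T →
    ∀ t : T, a • t = 0}
  zero_mem' := fun T _ _ _ t => zero_smul R t
  add_mem' := fun ha hb T _ _ hT t => by rw [add_smul, ha T hT, hb T hT, add_zero]
  smul_mem' := fun c a ha T _ _ hT t => by rw [smul_eq_mul, mul_smul, ha T hT, smul_zero]

theorem smul_eq_zero_of_mem_perpAnnihilator {a : R} (ha : a ∈ perpAnnihilator R U)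
    (hT : PerpSimple R U T) (t : T) : a • t = 0 := ha T hT t

theorem jacobson_le_perpAnnihilator : Ring.jacobson R ≤ perpAnnihilator R U := by
  intro j hj T _ _ hT t
  have := hT.1
  exact smul_eq_zero_of_mem_jacobson hj t

theorem mul_mem_perpAnnihilator {a : R} (ha : a ∈ perpAnnihilator R U) (r : R) :
    a * r ∈ perpAnnihilator R U := fun T _ _ hT t => by
  rw [mul_smul]; exact ha T hT _

theorem PerpSimple.of_equiv (e : M ≃ₗ[R] N) (h : PerpSimple R U M) : PerpSimple R U N := by
  have := h.1
  refine ⟨IsSimpleModule.congr e.symm, fun hP => h.2.1 (Module.Projective.of_equiv e.symm),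
    ExtVan.of_retract e.symm.toLinearMap e.toLinearMap (by ext; simp) h.2.2⟩

/-- The annihilator determines the class. `R ⧸ L` is semisimple, so `T` embeds in it; a nonzero
class there acts nontrivially on some simple module `X` of the class, giving a nonzero map `T → X`,
an isomorphism. -/
theorem perpSimple_of_smul_eq_zero [IsArtinianRing R] [IsSimpleModule R T]
    (h : ∀ a ∈ perpAnnihilator R U, ∀ t : T, a • t = 0) : PerpSimple R U T := by
  let L := perpAnnihilator R U
  have hss : IsSemisimpleModule R (R ⧸ L) := by
    refine isSemisimpleModule_of_smul_eq_zero fun j hj x => ?_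
    obtain ⟨r, rfl⟩ := L.mkQ_surjective x
    rw [← map_smul, Submodule.mkQ_apply, Submodule.Quotient.mk_eq_zero]
    exact mul_mem_perpAnnihilator (jacobson_le_perpAnnihilator hj) r
  have := IsSimpleModule.nontrivial R T
  obtain ⟨t, ht⟩ := exists_ne (0 : T)
  let p : (R ⧸ L) →ₗ[R] T := L.liftQ (LinearMap.toSpanSingleton R T t) fun a ha => h a ha t
  have hp : Function.Surjective p := by
    intro x
    obtain ⟨r, rfl⟩ := IsSimpleModule.toSpanSingleton_surjective R ht x
    exact ⟨L.mkQ r, rfl⟩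
  obtain ⟨s, hs⟩ := IsSemisimpleModule.lifting_property p hp (LinearMap.id : T →ₗ[R] T)
  have hst : s t ≠ 0 := fun h0 => ht (by
    have := LinearMap.congr_fun hs t
    rw [LinearMap.comp_apply, h0, map_zero] at this
    exact this.symm)
  obtain ⟨r, hr⟩ := L.mkQ_surjective (s t)
  have hrL : r ∉ L := fun hmem => hst (by
    rw [← hr, Submodule.mkQ_apply, Submodule.Quotient.mk_eq_zero]; exact hmem)
  obtain ⟨X, _, _, hX, x, hx⟩ : ∃ (X : Type u) (_ : AddCommGroup X) (_ : Module R X),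
      PerpSimple R U X ∧ ∃ x : X, r • x ≠ 0 := by
    by_contra! hcon
    exact hrL fun X _ _ hX x => hcon X _ _ hX x
  let q : (R ⧸ L) →ₗ[R] X := L.liftQ (LinearMap.toSpanSingleton R X x) fun a ha => ha X hX x
  have := hX.1
  have hne : q ∘ₗ s ≠ 0 := fun h0 => hx (by
    have := LinearMap.congr_fun h0 t
    rw [LinearMap.comp_apply, ← hr] at this
    exact this)
  exact hX.of_equiv (LinearEquiv.ofBijective _ (LinearMap.bijective_of_ne_zero hne)).symm

theorem extVan_of_smul_eq_zero [IsArtinianRing R] [Module.Finite R M]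
    (h : ∀ a ∈ perpAnnihilator R U, ∀ m : M, a • m = 0) : ExtVan R M U :=
  ExtVan.of_isSimpleModule fun X T hT => (perpSimple_of_smul_eq_zero fun a ha t => by
    obtain ⟨m, hm⟩ := X.mkQ_surjective t
    apply Subtype.ext
    rw [Submodule.coe_smul, ← hm, ← map_smul, h a ha, map_zero, Submodule.coe_zero]).2.2

/-- If `L P ⊆ J P` for a projective module `P`, then `L J P = 0`. -/
theorem perpAnnihilator_smul_eq_zero [IsArtinianRing R] {u : U} (hu : IsRegular R S u)
    [Module.Finite R P] [Module.Projective R P] (X : Submodule R P)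
    (hX : ∀ a ∈ perpAnnihilator R U, ∀ p : P, a • p ∈ X)
    (hX' : ∀ j ∈ Ring.jacobson R, ∀ x ∈ X, j • x = 0)
    (hXJ : X ≤ Submodule.span R {x | ∃ j ∈ Ring.jacobson R, ∃ p : P, x = j • p}) :
    ∀ a ∈ perpAnnihilator R U, ∀ x ∈ X, a • x = 0 := by
  have hquot : ExtVan R (P ⧸ X) U := extVan_of_smul_eq_zero fun a ha m => by
    obtain ⟨p, rfl⟩ := X.mkQ_surjective m
    rw [← map_smul, Submodule.mkQ_apply, Submodule.Quotient.mk_eq_zero]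
    exact hX a ha p
  have hS : ShortEx X.subtype X.mkQ :=
    ⟨Subtype.val_injective, LinearMap.exact_subtype_mkQ _, Submodule.mkQ_surjective _⟩
  obtain ⟨h1, h2⟩ := (extVan_iff_of_exact hS.inj hS.exact hS.surj ‹_›).1 hquot
  have hext := hu.extendsProj h1
  have hss : IsSemisimpleModule R X :=
    isSemisimpleModule_of_smul_eq_zero fun j hj x => Subtype.ext (hX' j hj x x.2)
  let Z : Submodule R X :=
    { carrier := {x | ∀ a ∈ perpAnnihilator R U, a • x = 0}
      zero_mem' := fun a _ => smul_zero a
      add_mem' := fun hx hy a ha => by rw [smul_add, hx a ha, hy a ha, add_zero]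
      smul_mem' := fun c x hx a ha => by
        rw [← mul_smul]; exact hx _ (mul_mem_perpAnnihilator ha c) }
  have hZ : (⊤ : Submodule R X) ≤ Z := by
    rw [← IsSemisimpleModule.sSup_simples_eq_top R X]
    refine sSup_le fun T hT => ?_
    have hT : IsSimpleModule R T := hT
    obtain ⟨T', hT'⟩ := exists_isCompl T
    let π : X →ₗ[R] T := T.projectionOnto T' hT'
    have hπ : π ∘ₗ T.subtype = LinearMap.id :=
      LinearMap.ext fun t => Submodule.projectionOnto_apply_left hT' t
    have hperp : PerpSimple R U T := by
      refine ⟨hT, fun hproj => ?_, ExtVan.of_retract T.subtype π hπ h2⟩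
      -- Were `T` projective, the projection `X → T` would extend to `P`; but every map from `P` to
      -- a simple module kills the radical part, which contains `X`.
      obtain ⟨ψ, hψ⟩ := hext T finite_of_isSimpleModule hproj π
      have hker : X ≤ LinearMap.ker ψ := hXJ.trans <| Submodule.span_le.2 <| by
        rintro _ ⟨j, hj, p, rfl⟩
        change ψ (j • p) = 0
        rw [map_smul]
        exact smul_eq_zero_of_mem_jacobson hj (ψ p)
      have := IsSimpleModule.nontrivial R T
      obtain ⟨t, ht⟩ := exists_ne (0 : T)
      apply ht
      have h3 := LinearMap.congr_fun hπ t
      rw [← hψ] at h3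
      exact h3.symm.trans (hker (t : X).2)
    intro t ht a ha
    exact congrArg Subtype.val (smul_eq_zero_of_mem_perpAnnihilator ha hperp ⟨t, ht⟩)
  exact fun a ha x hx => congrArg Subtype.val (hZ (x := ⟨x, hx⟩) trivial a ha)

theorem projective_span_idempotent {e : R} (he : IsIdempotentElem e) :
    Module.Projective R (Ideal.span {e}) := by
  refine Module.Projective.of_split (Ideal.span {e}).subtype
    ((LinearMap.toSpanSingleton R R e).codRestrict (Ideal.span {e})
      fun r => Ideal.mul_mem_left _ r (Ideal.mem_span_singleton_self e)) ?_
  ext ⟨x, hx⟩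
  obtain ⟨r, rfl⟩ := Ideal.mem_span_singleton'.1 hx
  change r * e * e = r * e
  rw [mul_assoc, he.eq]

theorem torsionless_of_radSqZero [IsArtinianRing R]
    (hJ : ∀ x ∈ Ring.jacobson R, ∀ y ∈ Ring.jacobson R, x * y = 0) {u : U} (hu : IsRegular R S u)
    [Module.Finite R M] (hM : ExtVan R M U) : Torsionless R R M :=
  hu.torsionless_self <| torsionless_of_finite hu summandClosed_isFirstSyzygy
    (finiteNonproj_isFirstSyzygy hJ) (fun _ h1 _ h3 => h3.isFirstSyzygy h1) M hM

/-- An indecomposable summand of `M` whose idempotent is not stably zero is nonprojective; it lies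
in `⊥U`, so it is torsionless, hence simple. -/
theorem exists_perpSimple_range [IsArtinianRing R]
    (hJ : ∀ x ∈ Ring.jacobson R, ∀ y ∈ Ring.jacobson R, x * y = 0) {u : U} (hu : IsRegular R S u)
    [Module.Finite R M] (hM : ExtVan R M U) (hP : ¬ Module.Projective R M) :
    ∃ e : M →ₗ[R] M, e ∘ₗ e = e ∧ ¬ StablyZero e ∧ PerpSimple R U (LinearMap.range e) := by
  obtain ⟨e, he, hne, hind⟩ := exists_indec_range (R := R) (M := M) (fun e => ¬ StablyZero e)
    (fun h => h StablyZero.zero) (fun h => hP (stablyZero_id_iff.1 h).2)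
    (fun e e₁ _ hp _ _ _ => by
      by_contra! hcon
      exact hp (by simpa using hcon.1.add hcon.2))
  have hfin : Module.Finite R (LinearMap.range e) := inferInstance
  have hproj : ¬ Module.Projective R (LinearMap.range e) := fun h =>
    hne ⟨LinearMap.range e, _, _, e.rangeRestrict, (LinearMap.range e).subtype, hfin, h, rfl⟩
  have hext : ExtVan R (LinearMap.range e) U := ExtVan.of_retract _ _
    (rangeRestrict_comp_subtype he) hM
  exact ⟨e, he, hne, hind.isSimpleModule_of_torsionless hJ hproj
    (torsionless_of_radSqZero hJ hu hext), hproj, hext⟩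

/-! ### Centrality of the idempotent generating the annihilator modulo the radical. -/

section Idempotent

variable [IsArtinianRing R] (hJ : ∀ x ∈ Ring.jacobson R, ∀ y ∈ Ring.jacobson R, x * y = 0)
  {u : U} (hu : IsRegular R S u) {f : R} (hf : IsIdempotentElem f) (hfL : f ∈ perpAnnihilator R U)
  (hLf : ∀ l ∈ perpAnnihilator R U, l - l * f ∈ Ring.jacobson R)
include hJ hu hf hfL hLf

theorem mul_one_sub_mem_jacobson (l : R) (hl : l ∈ perpAnnihilator R U) :
    l * (1 - f) ∈ Ring.jacobson R := by
  rw [mul_sub, mul_one]; exact hLf l hl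

/-- Apply `perpAnnihilator_smul_eq_zero` to `P = R(1 - f)` and its intersection with the radical,
which contains `f r (1 - f)`; multiplying by `f` in `L` fixes this element and kills it. -/
theorem mul_mul_one_sub_eq_zero (r : R) : f * r * (1 - f) = 0 := by
  have he : IsIdempotentElem (1 - f) := hf.one_sub
  have hmem : ∀ r, r * (1 - f) ∈ Ideal.span {1 - f} := fun r =>
    Ideal.mul_mem_left _ r (Ideal.mem_span_singleton_self _)
  have hval : ∀ p ∈ Ideal.span {1 - f}, p * (1 - f) = p := fun p hp => by
    obtain ⟨r, rfl⟩ := Ideal.mem_span_singleton'.1 hp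
    rw [mul_assoc, he.eq]
  have := projective_span_idempotent he
  have key := perpAnnihilator_smul_eq_zero hu (P := Ideal.span {1 - f})
    (Submodule.comap (Ideal.span {1 - f}).subtype (Ring.jacobson R)) (fun a ha p => by
      change a * p ∈ Ring.jacobson R
      rw [← hval p p.2, ← mul_assoc]
      exact mul_one_sub_mem_jacobson hJ hu hf hfL hLf _ (mul_mem_perpAnnihilator ha _))
    (fun j hj x hx => Subtype.ext (hJ j hj x hx))
    (fun x hx => Submodule.subset_span ⟨x.1, hx, ⟨1 - f, Ideal.mem_span_singleton_self _⟩,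
      Subtype.ext (hval x.1 x.2).symm⟩)
  have h1 := mul_one_sub_mem_jacobson hJ hu hf hfL hLf _ (mul_mem_perpAnnihilator hfL r)
  have h2 := congrArg Subtype.val (key f hfL ⟨_, hmem (f * r)⟩ h1)
  change f * (f * r * (1 - f)) = 0 at h2
  rwa [← mul_assoc, ← mul_assoc, hf.eq] at h2

/-- Outside the radical, a left multiple of the element would be a nonzero idempotent, but its
square contains a factor `f b (1 - f) = 0`. -/
theorem one_sub_mul_mul_mem_jacobson (r : R) : (1 - f) * r * f ∈ Ring.jacobson R := by
  by_contra hy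
  obtain ⟨b, h0, hid⟩ := exists_mul_idempotent hJ hy
  apply h0
  rw [← hid.eq]
  have := mul_mul_one_sub_eq_zero hJ hu hf hfL hLf b
  calc b * ((1 - f) * r * f) * (b * ((1 - f) * r * f))
      = b * (1 - f) * r * (f * b * (1 - f)) * r * f := by noncomm_ring
    _ = 0 := by rw [this]; simp

theorem one_sub_mul_mul_eq_zero (r : R) : (1 - f) * r * f = 0 := by
  by_contra hx
  set x := (1 - f) * r * f with hxdef
  have hxJ : x ∈ Ring.jacobson R := one_sub_mul_mul_mem_jacobson hJ hu hf hfL hLf r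
  have he : IsIdempotentElem (1 - f) := hf.one_sub
  have hex : (1 - f) * x = x := by rw [hxdef, ← mul_assoc, ← mul_assoc, he.eq]
  have hxf : x * f = x := by rw [hxdef, mul_assoc, hf.eq]
  have hLx : ∀ l ∈ perpAnnihilator R U, l * x = 0 := fun l hl => by
    rw [← hex, ← mul_assoc]
    exact hJ _ (mul_one_sub_mem_jacobson hJ hu hf hfL hLf l hl) _ hxJ
  -- a simple module `T ⊆ R x` in the class
  have hLspan : ∀ l ∈ perpAnnihilator R U, ∀ y : Ideal.span {x}, l • y = 0 := by
    rintro l hl ⟨y, hy⟩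
    obtain ⟨c, rfl⟩ := Ideal.mem_span_singleton'.1 hy
    apply Subtype.ext
    change l * (c * x) = 0
    rw [← mul_assoc]
    exact hLx _ (mul_mem_perpAnnihilator hl c)
  have hss : IsSemisimpleModule R (Ideal.span {x}) :=
    isSemisimpleModule_of_smul_eq_zero fun j hj y => hLspan j (jacobson_le_perpAnnihilator hj) y
  have : Nontrivial (Ideal.span {x}) :=
    ⟨⟨x, Ideal.mem_span_singleton_self x⟩, 0, fun h => hx (congrArg Subtype.val h)⟩
  obtain ⟨T, hT⟩ := IsSemisimpleModule.exists_simple_submodule R (Ideal.span {x})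
  let ι : T →ₗ[R] R := (Ideal.span {x}).subtype ∘ₗ T.subtype
  have hι : Function.Injective ι := Subtype.val_injective.comp Subtype.val_injective
  have hιf : ∀ t, ι t * f = ι t := fun t => by
    obtain ⟨c, hc⟩ := Ideal.mem_span_singleton'.1 (t : Ideal.span {x}).2
    change ((t : Ideal.span {x}) : R) * f = (t : Ideal.span {x})
    rw [← hc, mul_assoc, hxf]
  have hTperp : PerpSimple R U T := perpSimple_of_smul_eq_zero fun a ha t =>
    Subtype.ext (hLspan a ha t)
  -- `T` is a stable retract of a syzygy of some simple module `Z` in the class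
  have hTfin : Module.Finite R T := finite_of_isSimpleModule
  obtain ⟨Y, hY0, hY⟩ := exists_isSyzygySeq hu (ModuleCat.of R T) hTfin hTperp.2.2
    (indec_of_isSimpleModule (R := R) (T := T)).stablyIndec hTperp.2.1
  obtain ⟨k, l, hkl, hr, -⟩ := exists_stRetract_of_finiteNonproj summandClosed_isFirstSyzygy
    (finiteNonproj_isFirstSyzygy hJ) (fun k => Y (k + 1)) (fun k => hY.finite _)
    (fun k => hY.stablyIndec _) (fun k => hY.not_projective _) (fun k => by
      obtain ⟨Q, _, _, i, g, h1, h2, h3⟩ := hY.syzygy k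
      exact (isFirstSyzygy_iff _).2 ⟨hY.finite _, Q, _, _, i, h1, h2, h3.inj⟩)
  obtain ⟨c, rfl⟩ : ∃ c, l = k + c + 1 := ⟨l - k - 1, by omega⟩
  have hr0 : StRetract R (Y 0) (Y (c + 1)) := hY.stRetract_of_add hu (k + 1) (c + 1) (by
    rwa [show k + 1 + (c + 1) = k + c + 1 + 1 by omega])
  -- `T` is a retract of the kernel `X` of a surjection from `R (1 - f)` to `Z`
  obtain ⟨e, hee, hne, hZ⟩ := by
    have := hY.finite c
    exact exists_perpSimple_range hJ hu (hY.extVan c) (hY.not_projective c)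
  have hZs := hZ.1
  have hrZ : StRetract R (Y c) (LinearMap.range e) :=
    ⟨e.rangeRestrict, (LinearMap.range e).subtype,
      ((hY.stablyIndec c) e (by rw [hee, sub_self]; exact StablyZero.zero)).resolve_left hne⟩
  have := IsSimpleModule.nontrivial R (LinearMap.range e)
  obtain ⟨z, hz⟩ := exists_ne (0 : LinearMap.range e)
  let p : Ideal.span {1 - f} →ₗ[R] LinearMap.range e :=
    LinearMap.toSpanSingleton R _ z ∘ₗ (Ideal.span {1 - f}).subtype
  have hp : Function.Surjective p := by
    intro w
    obtain ⟨r, rfl⟩ := IsSimpleModule.toSpanSingleton_surjective R hz w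
    refine ⟨⟨r * (1 - f), Ideal.mem_span_singleton'.2 ⟨r, rfl⟩⟩, ?_⟩
    change (r * (1 - f)) • z = r • z
    rw [mul_smul, sub_smul, one_smul, smul_eq_zero_of_mem_perpAnnihilator hfL hZ, sub_zero]
  have hS := shortEx_ker p hp
  have hprojE := projective_span_idempotent he
  obtain ⟨Q, _, _, i, q, hQ, hQ', hSY⟩ := hY.syzygy c
  obtain ⟨a, b, hab⟩ := StRetract.exists_of_isSimpleModule hTperp.2.1
    ((show StRetract R T (Y (c + 1)) by rw [hY0] at hr0; exact hr0).trans (hrZ.syzygy hSY hS))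
  -- `Ext^1(Z, U) = 0` extends the map from the kernel through `T` into `R` to all of `R (1 - f)`.
  obtain ⟨h, hh⟩ := hu.extendsProj
    ((extVan_iff_of_exact hS.inj hS.exact hS.surj hprojE).1 hZ.2.2).1 R inferInstance inferInstance
    (ι ∘ₗ b)
  have := IsSimpleModule.nontrivial R T
  obtain ⟨t, ht⟩ := exists_ne (0 : T)
  refine ht (hι ?_)
  have hbt : b (a t) = t := LinearMap.congr_fun hab t
  have hat : ((a t : Ideal.span {1 - f}) : R) ∈ Ring.jacobson R :=
    (indec_of_isSimpleModule (R := R) (T := T)).apply_mem_jacobson hJ hTperp.2.1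
      ((Ideal.span {1 - f}).subtype ∘ₗ (LinearMap.ker p).subtype ∘ₗ a) t
  have hval : (a t : Ideal.span {1 - f}) = ((a t : Ideal.span {1 - f}) : R) •
      (⟨1 - f, Ideal.mem_span_singleton_self _⟩ : Ideal.span {1 - f}) := by
    apply Subtype.ext
    obtain ⟨r, hr⟩ := Ideal.mem_span_singleton'.1 (a t : Ideal.span {1 - f}).2
    change ((a t : Ideal.span {1 - f}) : R) = (a t : Ideal.span {1 - f}) * (1 - f)
    rw [← hr, mul_assoc, he.eq]
  have h1 : h (a t) = ι t := by
    have := LinearMap.congr_fun hh (a t)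
    rwa [LinearMap.comp_apply, LinearMap.comp_apply, hbt] at this
  set w := h ⟨1 - f, Ideal.mem_span_singleton_self _⟩ with hw
  have h2 : ι t = ((a t : Ideal.span {1 - f}) : R) * w := by
    rw [← h1, ← smul_eq_mul, hw, ← map_smul, ← hval]
  have h3 : (1 - f) * w = w := by
    rw [hw, ← smul_eq_mul, ← map_smul]
    congr 1
    exact Subtype.ext he.eq
  -- `ι t` equals `a(t) · (1 - f) w f`, a product of two radical elements.
  rw [map_zero, ← hιf, h2, ← h3, mul_assoc]
  exact hJ _ hat _ (one_sub_mul_mul_mem_jacobson hJ hu hf hfL hLf w)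

theorem commute_of_radSqZero (r : R) : f * r = r * f := by
  have h1 := mul_mul_one_sub_eq_zero hJ hu hf hfL hLf r
  have h2 := one_sub_mul_mul_eq_zero hJ hu hf hfL hLf r
  rw [mul_sub, mul_one, sub_eq_zero] at h1
  rw [sub_mul, sub_mul, one_mul, sub_eq_zero] at h2
  rw [h1, h2]

end Idempotent

/-- If `f = 0`, then `L` lies in the radical and kills all simple modules, so all of them lie in
`⊥U` and `U` is injective by Baer's criterion. If `f = 1`, then `1` kills the simple module obtained
from `M`. -/
theorem projective_of_radSqZero [IsArtinianRing R]
    (hJ : ∀ x ∈ Ring.jacobson R, ∀ y ∈ Ring.jacobson R, x * y = 0) {u : U} (hu : IsRegular R S u)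
    (hconn : ∀ e : R, (∀ r, e * r = r * e) → IsIdempotentElem e → e = 0 ∨ e = 1)
    (hU : ¬ Module.Injective R U) [Module.Finite R M] (hM : ExtVan R M U) :
    Module.Projective R M := by
  by_contra hP
  obtain ⟨e, -, -, hT⟩ := exists_perpSimple_range hJ hu hM hP
  obtain ⟨f, hfL, hf, hLf⟩ := exists_idempotent_of_radSqZero hJ (perpAnnihilator R U)
  rcases hconn f (commute_of_radSqZero hJ hu hf hfL hLf) hf with rfl | rfl
  · refine hU (injective_of_forall_extVan fun I => ExtVan.of_isSimpleModule fun X T hT =>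
      (perpSimple_of_smul_eq_zero fun a ha t => smul_eq_zero_of_mem_jacobson ?_ t).2.2)
    simpa using hLf a ha
  · have := hT.1
    have := IsSimpleModule.nontrivial R (LinearMap.range e)
    obtain ⟨t, ht⟩ := exists_ne (0 : LinearMap.range e)
    exact ht (by simpa using smul_eq_zero_of_mem_perpAnnihilator hfL hT t)

end PerpSimple

/-! ### Global dimension, and transport of the radical condition to the opposite ring. -/

section Conclusion

theorem hasProjectiveDimensionLE_of_perp_projective {R U : Type u} [Ring R] [IsNoetherianRing R]
    [AddCommGroup U] [Module R U] {n : ℕ}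
    (hU : HasInjectiveDimensionLE (ModuleCat.of R U) n)
    (h : ∀ (M : Type u) [AddCommGroup M] [Module R M] [Module.Finite R M],
      ExtVan R M U → Module.Projective R M)
    (M : ModuleCat.{u} R) (hM : Module.Finite R M) : HasProjectiveDimensionLE M n := by
  obtain ⟨Y, rfl, hfin, hsyz⟩ := exists_resolution M hM
  -- Dimension shifting: `Ext^(i+1)` of the `k`-th syzygy is `Ext^(i+k+1)` of `M`, which vanishes
  -- beyond `n`. Hence the `n`-th syzygy lies in `⊥U`.
  have hext : ∀ k i, n < i + k + 1 → ExtZero R (Y k) U (i + 1) := by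
    intro k
    induction k with
    | zero =>
      intro i hi
      exact ⟨fun a b => (a.eq_zero_of_hasInjectiveDimensionLT (n + 1) (by omega)).trans
        (b.eq_zero_of_hasInjectiveDimensionLT (n + 1) (by omega)).symm⟩
    | succ k ih =>
      intro i hi
      obtain ⟨P, _, _, f, g, h1, h2, hS⟩ := hsyz k
      exact (extZero_succ_iff hS.inj hS.exact hS.surj h2 i).1 (ih (i + 1) (by omega))
  have hpd : ∀ k l, k + l = n → HasProjectiveDimensionLE (Y l) k := by
    intro k
    induction k with
    | zero =>
      intro l hl
      have := hfin l
      have hproj := h (Y l) (extVan_iff.2 fun i => hext l i (by omega))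
      exact (projective_iff_hasProjectiveDimensionLE_zero _).1
        ((IsProjective.iff_projective (R := R) (Y l)).1 hproj)
    | succ k ih =>
      intro l hl
      obtain ⟨P, _, _, f, g, h1, h2, hS⟩ := hsyz l
      have hP : Projective (ModuleCat.of R P) := (IsProjective.iff_projective (R := R) P).1 h2
      exact ((shortExact_of_linearMap f g hS.inj hS.exact hS.surj).hasProjectiveDimensionLT_X₃_iff
        k hP).2 (ih (l + 1) (by omega))
  exact hpd n 0 rfl

variable (K : Type u) {A : Type u} [Field K] [Ring A] [Algebra K A] [Module.Finite K A]

include K in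
theorem mul_eq_zero_of_mem_jacobson_op (h : Ring.jacobson A ^ 2 = ⊥) :
    ∀ x ∈ Ring.jacobson Aᵐᵒᵖ, ∀ y ∈ Ring.jacobson Aᵐᵒᵖ, x * y = 0 := by
  have := isArtinianRing_of_finite K (A := A)
  let q : Aᵐᵒᵖ →+* (A ⧸ Ring.jacobson A)ᵐᵒᵖ := (Ideal.Quotient.mk (Ring.jacobson A)).op
  have hq : Function.Surjective q := fun y => by
    obtain ⟨a, ha⟩ := Ideal.Quotient.mk_surjective y.unop
    exact ⟨MulOpposite.op a, MulOpposite.unop_injective ha⟩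
  have : RingHomSurjective q := ⟨hq⟩
  -- The radical of the opposite ring maps to zero in the semisimple ring `(A ⧸ Ring.jacobson
  -- A)ᵐᵒᵖ`.
  have hmem : ∀ x ∈ Ring.jacobson Aᵐᵒᵖ, x.unop ∈ Ring.jacobson A := fun x hx => by
    have h1 : q x = 0 := (IsSemisimpleRing.jacobson_eq_bot (A ⧸ Ring.jacobson A)ᵐᵒᵖ).le
      (Ring.le_comap_jacobson q hx)
    exact Ideal.Quotient.eq_zero_iff_mem.1 (congrArg MulOpposite.unop h1)
  intro x hx y hy
  have h2 : y.unop * x.unop ∈ Ring.jacobson A ^ 2 := by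
    rw [Ideal.IsTwoSided.pow_succ, Submodule.pow_one]
    exact Ideal.mul_mem_mul (hmem y hy) (hmem x hx)
  rw [h] at h2
  exact MulOpposite.unop_injective h2

theorem isNearlyGorenstein_of_radSqZero (h : Ring.jacobson A ^ 2 = ⊥) :
    IsNearlyGorenstein K A := by
  have := finite_op K (A := A)
  have := isArtinianRing_of_finite K (A := Aᵐᵒᵖ)
  exact isNearlyGorenstein_of_finiteNonproj K summandClosed_isFirstSyzygy
    (finiteNonproj_isFirstSyzygy (mul_eq_zero_of_mem_jacobson_op K h))
    fun _ h1 h2 => h2.isFirstSyzygy h1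

include K in
theorem inPerpA_iff_of_radSqZero (h : Ring.jacobson A ^ 2 = ⊥) (hconn : IsConnectedAlgebra A)
    (hself : ¬ IsSelfinjective A) (M : ModuleCat.{u} Aᵐᵒᵖ) :
    InPerpA M ↔ Module.Finite Aᵐᵒᵖ M ∧ Module.Projective Aᵐᵒᵖ M := by
  have := finite_op K (A := A)
  have := isArtinianRing_of_finite K (A := Aᵐᵒᵖ)
  refine and_congr_right fun hM => ⟨fun hE => ?_, fun hP => ExtVan.of_projective hP⟩
  refine projective_of_radSqZero (mul_eq_zero_of_mem_jacobson_op K h) (isRegular_one A)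
    (fun e he hid => ?_) hself hE
  rcases hconn.2 e.unop (Subring.mem_center_iff.2 fun r =>
    congrArg MulOpposite.unop (he (MulOpposite.op r))) (congrArg MulOpposite.unop hid) with h0 | h0
  · exact Or.inl (MulOpposite.unop_injective h0)
  · exact Or.inr (MulOpposite.unop_injective h0)

include K in
theorem not_isGorenstein_or_hasFiniteGlobalDimension
    (h : ∀ M : ModuleCat.{u} Aᵐᵒᵖ, InPerpA M ↔ Module.Finite Aᵐᵒᵖ M ∧ Module.Projective Aᵐᵒᵖ M) :
    ¬ IsGorenstein A ∨ HasFiniteGlobalDimension A := by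
  have := finite_op K (A := A)
  have := isArtinianRing_of_finite K (A := Aᵐᵒᵖ)
  refine or_iff_not_imp_left.2 fun hG => ?_
  obtain ⟨g, hg, -⟩ := not_not.1 hG
  exact ⟨g, hasProjectiveDimensionLE_of_perp_projective
    ((injectiveDimension_le_iff _ g).1 hg.le)
    fun M _ _ hM hE => ((h (ModuleCat.of Aᵐᵒᵖ M)).1 ⟨hM, hE⟩).2⟩

end Conclusion

end NearlyGor

end

theorem mainTheorem5 {K A : Type u} [Field K] [Ring A] [Algebra K A] [Module.Finite K A] :
    ((NearlyGor.IsRepFiniteClass (NearlyGor.InPerpA (A := A)) ∧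
        NearlyGor.IsRepFiniteClass (NearlyGor.InDAPerp K (A := A)) →
          NearlyGor.IsNearlyGorenstein K A) ∧
      (NearlyGor.IsRepFinite A → NearlyGor.IsNearlyGorenstein K A)) ∧
    (∀ e : A, 2 ≤ NearlyGor.domdim (NearlyGor.rightReg A) →
      NearlyGor.IsMinimalFaithfulIdempotent e →
      NearlyGor.IsRepFinite (NearlyGor.algebraB₂ K e) →
        NearlyGor.IsCMFinite A ∧ NearlyGor.IsNearlyGorenstein K A) ∧
    (NearlyGor.IsTorsionlessFinite A → NearlyGor.IsNearlyGorenstein K A) ∧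
    (Ring.jacobson A ^ 2 = ⊥ →
      NearlyGor.IsNearlyGorenstein K A ∧
      (NearlyGor.IsConnectedAlgebra A → ¬ NearlyGor.IsSelfinjective A →
        (∀ M : ModuleCat.{u} Aᵐᵒᵖ, NearlyGor.InPerpA M ↔
          Module.Finite Aᵐᵒᵖ M ∧ Module.Projective Aᵐᵒᵖ M) ∧
        (¬ NearlyGor.IsGorenstein A ∨ NearlyGor.HasFiniteGlobalDimension A))) := by
  refine ⟨⟨fun h => NearlyGor.isNearlyGorenstein_of_isRepFiniteClass K h.1 h.2,
    NearlyGor.isNearlyGorenstein_of_isRepFinite K⟩,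
    fun e hd he h => NearlyGor.isCMFinite_and_isNearlyGorenstein he hd h,
    NearlyGor.isNearlyGorenstein_of_isTorsionlessFinite K,
    fun h => ⟨NearlyGor.isNearlyGorenstein_of_radSqZero K h, fun hc hs => ?_⟩⟩
  have hperp := NearlyGor.inPerpA_iff_of_radSqZero K h hc hs
  exact ⟨hperp, NearlyGor.not_isGorenstein_or_hasFiniteGlobalDimension K hperp⟩
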